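/- Let $\alpha\in(2,3)$, $n\in\mathbb N$, $s=\frac{\alpha-1}{2}\in(\frac12,1)$. Let $H:=H^{(1+\alpha)/2,2}(\mathbb R/\mathbb Z,\mathbb R^n)$ be the fractional Sobolev space of all $f\in H^{1,2}(\mathbb R/\mathbb Z,\mathbb R^n)$ for which $$\|f\|_H:=\bigl(\|f\|_{L^2}^2+\|f'\|_{L^2}^2\bigr)^{1/2}+\Bigl(\int_{\mathbb R/\mathbb Z}\int_{-1/2}^{1/2}\frac{|f'(u+w)-f'(u)|^2}{|w|^{1+2s}}\,dw\,du\Bigr)^{1/2}$$ is finite, where $f'$ is the weak derivative; its elements are identified with their continuous representatives (which are of class $C^1$). Let $H_{\mathrm{ir}}\subset H$ be the set of injective curves $\gamma\in H$ that are regular, i.e. $\gamma'(u)\neq0$ for all $u$. Write $\Delta\gamma=\gamma(u+w)-\gamma(u)$ and $\Delta h=h(u+w)-h(u)$. For a Lipschitz curve $\gamma$, let $\mathscr L(\gamma)=\int_0^1|\gamma'|$, let $\mathscr L(\gamma|_{[u,u+w]})=\bigl|\int_0^w|\gamma'(u+\theta)|\,d\theta\bigr|$ for $|w|\le\frac12$,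 let $d_\gamma(u+w,u)=\min\{\mathscr L(\gamma|_{[u,u+w]}),\mathscr L(\gamma)-\mathscr L(\gamma|_{[u,u+w]})\}$ be the intrinsic distance, and let O'Hara's energy be $$E^{(\alpha)}(\gamma)=\int_{\mathbb R/\mathbb Z}\int_{-1/2}^{1/2}\Bigl(\frac1{|\Delta\gamma|^\alpha}-\frac1{d_\gamma(u+w,u)^\alpha}\Bigr)|\gamma'(u+w)||\gamma'(u)|\,dw\,du\in[0,\infty].$$ For $\varepsilon>0$ put $U_\varepsilon=\mathbb R/\mathbb Z\times([-\frac12,-\varepsilon]\cup[\varepsilon,\frac12])$. Then: 1. $H_{\mathrm{ir}}$ is open in $H$, and $E^{(\alpha)}$ is finite and continuously (Fréchet) differentiable on $H_{\mathrm{ir}}$. 2. For all $\gamma\in H_{\mathrm{ir}}$ and $h\in H$, the derivative $\frac{d}{d\tau}\big|_{\tau=0}d_{\gamma+\tau h}(u+w,u)$ exists for almost every $(u,w)\in\mathbb R/\mathbb Z\times[-\frac12,\frac12]$, and the derivative of $E^{(\alpha)}$ at $\gamma$ in direction $h$ is $$\delta E^{(\alpha)}(\gamma;h)=\lim_{\varepsilon\searrow0}\iint_{U_\varepsilon}\Bigl\{2\Bigl(\frac1{|\Delta\gamma|^\alpha}-\frac1{d_\gamma(u+w,u)^\alpha}\Bigr)\Bigl\langle\frac{\gamma'(u)}{|\gamma'(u)|^2},h'(u)\Bigr\rangle-\alpha\Bigl(\frac{\langle\Delta\gamma,\Delta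 h\rangle}{|\Delta\gamma|^{\alpha+2}}-\frac{\frac{d}{d\tau}\big|_{\tau=0}d_{\gamma+\tau h}(u+w,u)}{d_\gamma(u+w,u)^{\alpha+1}}\Bigr)\Bigr\}|\gamma'(u+w)||\gamma'(u)|\,dw\,du,$$ the integrand being integrable on $U_\varepsilon$ for every $\varepsilon>0$. 3. If $\gamma\in H_{\mathrm{ir}}$ is moreover parametrized by arc length, i.e. $|\gamma'(u)|=1$ for all $u$, then for all $h\in H$ $$\delta E^{(\alpha)}(\gamma;h)=\lim_{\varepsilon\searrow0}\iint_{U_\varepsilon}\Bigl((\alpha-2)\frac{\langle\gamma'(u),h'(u)\rangle}{|w|^\alpha}+2\frac{\langle\gamma'(u),h'(u)\rangle}{|\Delta\gamma|^\alpha}-\alpha\frac{\langle\Delta\gamma,\Delta h\rangle}{|\Delta\gamma|^{\alpha+2}}\Bigr)\,dw\,du,$$ the integrand being integrable on $U_\varepsilon$ for every $\varepsilon>0$. -/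

import Mathlib

open MeasureTheory Set Filter Topology
open scoped ENNReal

namespace OHara

noncomputable section

/-! ### Calculus on the circle `ℝ/ℤ` -/

/-- The derivative of a map defined on `ℝ/ℤ`: `f'(u) = d/dt f(u + t)` at `t = 0`. -/
def circleDeriv {F : Type*} [NormedAddCommGroup F] [NormedSpace ℝ F]
    (f : UnitAddCircle → F) (u : UnitAddCircle) : F :=
  deriv (fun t : ℝ => f (u + (t : UnitAddCircle))) 0

/-- Smooth real-valued functions on `ℝ/ℤ`. -/
def IsTest (φ : UnitAddCircle → ℝ) : Prop :=
  ContDiff ℝ ((⊤ : ℕ∞) : WithTop ℕ∞) (fun t : ℝ => φ (t : UnitAddCircle))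

/-- `g` is a weak derivative of `f` on `ℝ/ℤ`. -/
def IsWeakDeriv {F : Type*} [NormedAddCommGroup F] [NormedSpace ℝ F]
    (f g : UnitAddCircle → F) : Prop :=
  ∀ φ : UnitAddCircle → ℝ, IsTest φ →
    ∫ u, circleDeriv φ u • f u = - ∫ u, φ u • g u

theorem circleDeriv_coe {F : Type*} [NormedAddCommGroup F] [NormedSpace ℝ F]
    (f : UnitAddCircle → F) (t : ℝ) :
    circleDeriv f (t : UnitAddCircle) = deriv (fun t : ℝ => f (t : UnitAddCircle)) t := by
  have h := deriv_comp_const_add (f := fun t : ℝ => f (t : UnitAddCircle)) t 0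
  simpa [circleDeriv] using h

theorem continuous_of_coe {F : Type*} [TopologicalSpace F] {f : UnitAddCircle → F}
    (h : Continuous (fun t : ℝ => f (t : UnitAddCircle))) : Continuous f :=
  (QuotientAddGroup.isQuotientMap_mk (N := AddSubgroup.zmultiples (1 : ℝ))).continuous_iff.2 h

theorem IsTest.continuous {φ : UnitAddCircle → ℝ} (h : IsTest φ) : Continuous φ :=
  continuous_of_coe (ContDiff.continuous h)

theorem IsTest.continuous_circleDeriv {φ : UnitAddCircle → ℝ} (h : IsTest φ) :
    Continuous (circleDeriv φ) := by
  apply continuous_of_coe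
  simp only [circleDeriv_coe]
  exact ContDiff.continuous_deriv h (by simp)

theorem integrable_smul_of_continuous {F : Type*} [NormedAddCommGroup F] [NormedSpace ℝ F]
    {φ : UnitAddCircle → ℝ} (hφ : Continuous φ) {g : UnitAddCircle → F}
    (hg : Integrable g) : Integrable (fun u => φ u • g u) := by
  obtain ⟨C, hC⟩ := isCompact_univ.exists_bound_of_continuousOn hφ.continuousOn
  exact hg.bdd_smul C hφ.aestronglyMeasurable (Eventually.of_forall fun u => hC u (mem_univ u))

/-! ### The fractional Sobolev space `H^{1+s,2}(ℝ/ℤ, ℝⁿ)` -/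

/-- Parameter domain `w ∈ [-1/2, 1/2]`. -/
def W : Set ℝ := Icc (-(1 / 2)) (1 / 2)

/-- The Gagliardo (Sobolev-Slobodeckij) seminorm of order `s`,
`(∫_{ℝ/ℤ} ∫_{-1/2}^{1/2} |g(u+w) - g(u)|² / |w|^{1+2s} dw du)^{1/2}`, with values in `[0, ∞]`. -/
def gagliardo {n : ℕ} (s : ℝ) (g : UnitAddCircle → EuclideanSpace ℝ (Fin n)) : ℝ≥0∞ :=
  (∫⁻ u : UnitAddCircle, ∫⁻ w : ℝ in W,
    ENNReal.ofReal (‖g (u + (w : UnitAddCircle)) - g u‖ ^ 2 / |w| ^ (1 + 2 * s))) ^ (1 / 2 : ℝ)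

/-- The weighted difference, whose `L²` norm is the Gagliardo seminorm. -/
def diffQuot {n : ℕ} (s : ℝ) (g : UnitAddCircle → EuclideanSpace ℝ (Fin n))
    (p : UnitAddCircle × ℝ) : EuclideanSpace ℝ (Fin n) :=
  (√(|p.2| ^ (1 + 2 * s)))⁻¹ • (g (p.1 + (p.2 : UnitAddCircle)) - g p.1)

/-- The measure `du dw` on `ℝ/ℤ × [-1/2, 1/2]`. -/
abbrev stripMeasure : Measure (UnitAddCircle × ℝ) :=
  (volume : Measure UnitAddCircle).prod ((volume : Measure ℝ).restrict W)

theorem stronglyMeasurable_diffQuot {n : ℕ} (s : ℝ)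
    {g : UnitAddCircle → EuclideanSpace ℝ (Fin n)} (hg : StronglyMeasurable g) :
    StronglyMeasurable (diffQuot s g) := by
  have h1 : Measurable (fun p : UnitAddCircle × ℝ => p.1 + (p.2 : UnitAddCircle)) := by
    have : Continuous (fun p : UnitAddCircle × ℝ => p.1 + (p.2 : UnitAddCircle)) :=
      continuous_fst.add ((AddCircle.continuous_mk' 1).comp continuous_snd)
    exact this.measurable
  have h2 : Measurable (fun p : UnitAddCircle × ℝ => (√(|p.2| ^ (1 + 2 * s)))⁻¹) := by
    fun_prop
  exact h2.stronglyMeasurable.smul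
    ((hg.comp_measurable h1).sub (hg.comp_measurable measurable_fst))

theorem gagliardo_eq_eLpNorm {n : ℕ} (s : ℝ)
    {g : UnitAddCircle → EuclideanSpace ℝ (Fin n)} (hg : StronglyMeasurable g) :
    gagliardo s g = eLpNorm (diffQuot s g) 2 stripMeasure := by
  have hm := stronglyMeasurable_diffQuot s hg
  rw [eLpNorm_eq_lintegral_rpow_enorm_toReal (by simp) (by simp), gagliardo]
  rw [lintegral_prod _ (hm.enorm.pow_const _).aemeasurable]
  congr 1
  refine lintegral_congr fun u => lintegral_congr fun w => ?_
  simp only [diffQuot, ENNReal.toReal_ofNat, ENNReal.rpow_ofNat]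
  rw [← ofReal_norm, ← ENNReal.ofReal_pow (norm_nonneg _), norm_smul, mul_pow, norm_inv,
    inv_pow, Real.norm_of_nonneg (Real.sqrt_nonneg _), Real.sq_sqrt (by positivity),
    div_eq_inv_mul]

theorem diffQuot_congr_ae {n : ℕ} (s : ℝ)
    {g k : UnitAddCircle → EuclideanSpace ℝ (Fin n)} (h : g =ᵐ[volume] k) :
    diffQuot s g =ᵐ[stripMeasure] diffQuot s k := by
  have h1 : ∀ᵐ p : UnitAddCircle × ℝ ∂stripMeasure, g p.1 = k p.1 :=
    Measure.quasiMeasurePreserving_fst.ae h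
  have h2 : ∀ᵐ p : UnitAddCircle × ℝ ∂stripMeasure,
      g (p.1 + (p.2 : UnitAddCircle)) = k (p.1 + (p.2 : UnitAddCircle)) := by
    have hq : Measure.QuasiMeasurePreserving
        (fun p : UnitAddCircle × ℝ => p.1 + (p.2 : UnitAddCircle)) stripMeasure volume := by
      have hc : Measurable (fun p : UnitAddCircle × ℝ => p.1 + (p.2 : UnitAddCircle)) := by
        have : Continuous (fun p : UnitAddCircle × ℝ => p.1 + (p.2 : UnitAddCircle)) :=
          continuous_fst.add ((AddCircle.continuous_mk' 1).comp continuous_snd)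
        exact this.measurable
      refine ⟨hc, Measure.AbsolutelyContinuous.mk fun t ht h0 => ?_⟩
      rw [Measure.map_apply hc ht, Measure.prod_apply_symm (hc ht)]
      refine lintegral_eq_zero_of_ae_eq_zero (Eventually.of_forall fun w => ?_)
      have : (fun u : UnitAddCircle => (u, w)) ⁻¹'
          ((fun p : UnitAddCircle × ℝ => p.1 + (p.2 : UnitAddCircle)) ⁻¹' t)
          = (fun u : UnitAddCircle => u + (w : UnitAddCircle)) ⁻¹' t := rfl
      change volume ((fun u : UnitAddCircle => (u, w)) ⁻¹'
          ((fun p : UnitAddCircle × ℝ => p.1 + (p.2 : UnitAddCircle)) ⁻¹' t)) = 0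
      rw [this, measure_preimage_add_right, h0]
    exact hq.ae h
  filter_upwards [h1, h2] with p hp1 hp2
  simp [diffQuot, hp1, hp2]

theorem gagliardo_zero {n : ℕ} (s : ℝ) :
    gagliardo s (⇑(0 : Lp (EuclideanSpace ℝ (Fin n)) 2 (volume : Measure UnitAddCircle))) = 0 := by
  rw [gagliardo_eq_eLpNorm s (Lp.stronglyMeasurable _),
    eLpNorm_congr_ae (diffQuot_congr_ae s (Lp.coeFn_zero _ _ _))]
  have : diffQuot s (0 : UnitAddCircle → EuclideanSpace ℝ (Fin n)) = 0 := by
    funext p; simp [diffQuot]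
  rw [this, eLpNorm_zero]

theorem gagliardo_add_le {n : ℕ} (s : ℝ)
    (g k : Lp (EuclideanSpace ℝ (Fin n)) 2 (volume : Measure UnitAddCircle)) :
    gagliardo s (⇑(g + k)) ≤ gagliardo s g + gagliardo s k := by
  rw [gagliardo_eq_eLpNorm s (Lp.stronglyMeasurable _),
    gagliardo_eq_eLpNorm s (Lp.stronglyMeasurable _),
    gagliardo_eq_eLpNorm s (Lp.stronglyMeasurable _),
    eLpNorm_congr_ae (diffQuot_congr_ae s (Lp.coeFn_add g k))]
  have : diffQuot s (⇑g + ⇑k) = diffQuot s g + diffQuot s k := by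
    funext p
    simp only [diffQuot, Pi.add_apply, ← smul_add]
    congr 1
    abel
  rw [this]
  exact eLpNorm_add_le (stronglyMeasurable_diffQuot s (Lp.stronglyMeasurable g)).aestronglyMeasurable
    (stronglyMeasurable_diffQuot s (Lp.stronglyMeasurable k)).aestronglyMeasurable (by norm_num)

theorem gagliardo_smul {n : ℕ} (s c : ℝ)
    (g : Lp (EuclideanSpace ℝ (Fin n)) 2 (volume : Measure UnitAddCircle)) :
    gagliardo s (⇑(c • g)) = ‖c‖ₑ * gagliardo s g := by
  rw [gagliardo_eq_eLpNorm s (Lp.stronglyMeasurable _),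
    gagliardo_eq_eLpNorm s (Lp.stronglyMeasurable _),
    eLpNorm_congr_ae (diffQuot_congr_ae s (Lp.coeFn_smul c g))]
  have : diffQuot s (c • ⇑g) = c • diffQuot s g := by
    funext p
    simp only [diffQuot, Pi.smul_apply, ← smul_sub]
    rw [smul_comm]
  rw [this, eLpNorm_const_smul]

/-- Pairs `(f, f')` of a continuous function `f` on `ℝ/ℤ` and its (unique) weak derivative
`f' ∈ L²` with finite Gagliardo seminorm of order `s`. An element of `H^{1,2}` of the circle has
exactly one continuous representative. -/
def sobolevSubmodule (n : ℕ) (s : ℝ) :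
    Submodule ℝ (C(UnitAddCircle, EuclideanSpace ℝ (Fin n)) ×
      Lp (EuclideanSpace ℝ (Fin n)) 2 (volume : Measure UnitAddCircle)) where
  carrier := {p | IsWeakDeriv (⇑p.1) (⇑p.2) ∧ gagliardo s (⇑p.2) < ⊤}
  zero_mem' := by
    refine ⟨fun φ _ => ?_, ?_⟩
    · have h : ∫ u, φ u • (⇑(0 : Lp (EuclideanSpace ℝ (Fin n)) 2
          (volume : Measure UnitAddCircle))) u = 0 := by
        refine integral_eq_zero_of_ae ?_
        filter_upwards [Lp.coeFn_zero (EuclideanSpace ℝ (Fin n)) 2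
          (volume : Measure UnitAddCircle)] with u hu
        rw [hu, Pi.zero_apply, smul_zero]
      change ∫ u, circleDeriv φ u • (0 : EuclideanSpace ℝ (Fin n)) = _
      rw [Prod.snd_zero, h]
      simp
    · exact (gagliardo_zero (n := n) s).trans_lt (by simp)
  add_mem' := by
    rintro ⟨f, g⟩ ⟨f₂, g₂⟩ ⟨h1, h2⟩ ⟨h3, h4⟩
    refine ⟨fun φ hφ => ?_, (gagliardo_add_le s g g₂).trans_lt (ENNReal.add_lt_top.2 ⟨h2, h4⟩)⟩
    have hi : ∀ f : C(UnitAddCircle, EuclideanSpace ℝ (Fin n)),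
        Integrable (fun u => circleDeriv φ u • f u) := fun f =>
      integrable_smul_of_continuous hφ.continuous_circleDeriv
        (f.continuous.integrable_of_hasCompactSupport (HasCompactSupport.of_compactSpace _))
    have hj : ∀ g : Lp (EuclideanSpace ℝ (Fin n)) 2 (volume : Measure UnitAddCircle),
        Integrable (fun u => φ u • g u) := fun g =>
      integrable_smul_of_continuous hφ.continuous ((Lp.memLp g).integrable (by norm_num))
    have e1 := h1 φ hφ
    have e2 := h3 φ hφ
    have e3 : ∫ u, φ u • (⇑(g + g₂)) u = ∫ u, (φ u • g u + φ u • g₂ u) := by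
      refine integral_congr_ae ?_
      filter_upwards [Lp.coeFn_add g g₂] with u hu
      rw [hu, Pi.add_apply, smul_add]
    simp only [Prod.mk_add_mk, ContinuousMap.add_apply, smul_add] at e1 e2 ⊢
    rw [e3, integral_add (hi f) (hi f₂), integral_add (hj g) (hj g₂), e1, e2, neg_add]
  smul_mem' := by
    rintro c ⟨f, g⟩ ⟨h1, h2⟩
    refine ⟨fun φ hφ => ?_, (gagliardo_smul s c g).trans_lt (ENNReal.mul_lt_top (by simp) h2)⟩
    have e1 := h1 φ hφ
    have e3 : ∫ u, φ u • (⇑(c • g)) u = ∫ u, c • φ u • g u := by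
      refine integral_congr_ae ?_
      filter_upwards [Lp.coeFn_smul c g] with u hu
      simp only [hu, Pi.smul_apply]
      rw [smul_comm]
    simp only [Prod.smul_mk, ContinuousMap.smul_apply] at e1 ⊢
    rw [e3, integral_smul, ← smul_neg, ← e1, ← integral_smul]
    simp only [smul_comm c]

/-- The fractional Sobolev space `H^{1+s,2}(ℝ/ℤ, ℝⁿ)`, elements being identified with their
continuous representatives. -/
def FracSobolev (n : ℕ) (s : ℝ) : Type := sobolevSubmodule n s

namespace FracSobolev

variable {n : ℕ} {s : ℝ}

instance : AddCommGroup (FracSobolev n s) := inferInstanceAs (AddCommGroup (sobolevSubmodule n s))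

instance : Module ℝ (FracSobolev n s) := inferInstanceAs (Module ℝ (sobolevSubmodule n s))

/-- The continuous representative. -/
def toC (f : FracSobolev n s) : C(UnitAddCircle, EuclideanSpace ℝ (Fin n)) := f.1.1

/-- The weak derivative, an element of `L²`. -/
def weakDeriv (f : FracSobolev n s) :
    Lp (EuclideanSpace ℝ (Fin n)) 2 (volume : Measure UnitAddCircle) := f.1.2

/-- The class of `f` in `L²`. -/
def toLp (f : FracSobolev n s) :
    Lp (EuclideanSpace ℝ (Fin n)) 2 (volume : Measure UnitAddCircle) :=
  ContinuousMap.toLp (E := EuclideanSpace ℝ (Fin n)) 2 volume ℝ f.toC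

instance : CoeFun (FracSobolev n s) (fun _ => UnitAddCircle → EuclideanSpace ℝ (Fin n)) :=
  ⟨fun f => f.toC⟩

theorem gagliardo_lt_top (f : FracSobolev n s) : gagliardo s f.weakDeriv < ⊤ := f.2.2

/-- The norm `‖f‖_{H^{1,2}} + [f']_{H^{s,2}}`,
where `‖f‖_{H^{1,2}} = (‖f‖_{L²}² + ‖f'‖_{L²}²)^{1/2}`. -/
instance : Norm (FracSobolev n s) :=
  ⟨fun f => √(‖f.toLp‖ ^ 2 + ‖f.weakDeriv‖ ^ 2) + (gagliardo s f.weakDeriv).toReal⟩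

theorem norm_def (f : FracSobolev n s) :
    ‖f‖ = √(‖f.toLp‖ ^ 2 + ‖f.weakDeriv‖ ^ 2) + (gagliardo s f.weakDeriv).toReal := rfl

theorem toLp_add (f g : FracSobolev n s) : (f + g).toLp = f.toLp + g.toLp :=
  map_add (ContinuousMap.toLp (E := EuclideanSpace ℝ (Fin n)) 2 volume ℝ) f.toC g.toC

theorem toLp_smul (c : ℝ) (f : FracSobolev n s) : (c • f).toLp = c • f.toLp :=
  map_smul (ContinuousMap.toLp (E := EuclideanSpace ℝ (Fin n)) 2 volume ℝ) c f.toC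

theorem weakDeriv_add (f g : FracSobolev n s) :
    (f + g).weakDeriv = f.weakDeriv + g.weakDeriv := rfl

theorem weakDeriv_smul (c : ℝ) (f : FracSobolev n s) :
    (c • f).weakDeriv = c • f.weakDeriv := rfl

theorem norm_smul_eq (c : ℝ) (f : FracSobolev n s) : ‖c • f‖ = ‖c‖ * ‖f‖ := by
  simp only [norm_def, toLp_smul, weakDeriv_smul, norm_smul, gagliardo_smul, ENNReal.toReal_mul,
    toReal_enorm, mul_pow, ← mul_add]
  rw [Real.sqrt_mul (by positivity), Real.sqrt_sq (norm_nonneg _), mul_add]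

theorem norm_add_le_aux (f g : FracSobolev n s) : ‖f + g‖ ≤ ‖f‖ + ‖g‖ := by
  simp only [norm_def, toLp_add, weakDeriv_add]
  have h1 : (gagliardo s (⇑(f.weakDeriv + g.weakDeriv))).toReal
      ≤ (gagliardo s f.weakDeriv).toReal + (gagliardo s g.weakDeriv).toReal := by
    rw [← ENNReal.toReal_add f.gagliardo_lt_top.ne g.gagliardo_lt_top.ne]
    exact ENNReal.toReal_mono
      (ENNReal.add_ne_top.2 ⟨f.gagliardo_lt_top.ne, g.gagliardo_lt_top.ne⟩) (gagliardo_add_le s _ _)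
  have h2 := norm_add_le (WithLp.toLp 2 (f.toLp, f.weakDeriv)) (WithLp.toLp 2 (g.toLp, g.weakDeriv))
  rw [← WithLp.toLp_add, WithLp.prod_norm_eq_of_L2, WithLp.prod_norm_eq_of_L2,
    WithLp.prod_norm_eq_of_L2] at h2
  simp only [WithLp.toLp_fst, WithLp.toLp_snd, Prod.mk_add_mk] at h2
  linarith

theorem eq_zero_of_norm (f : FracSobolev n s) (h : ‖f‖ = 0) : f = 0 := by
  have h0 : √(‖f.toLp‖ ^ 2 + ‖f.weakDeriv‖ ^ 2) = 0 := by
    rw [norm_def] at h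
    have := Real.sqrt_nonneg (‖f.toLp‖ ^ 2 + ‖f.weakDeriv‖ ^ 2)
    have := ENNReal.toReal_nonneg (a := gagliardo s f.weakDeriv)
    linarith
  rw [Real.sqrt_eq_zero (by positivity)] at h0
  have h1 : ‖f.toLp‖ = 0 := by nlinarith [sq_nonneg ‖f.toLp‖, sq_nonneg ‖f.weakDeriv‖]
  have h2 : ‖f.weakDeriv‖ = 0 := by nlinarith [sq_nonneg ‖f.toLp‖, sq_nonneg ‖f.weakDeriv‖]
  have h3 : f.toC = 0 := by
    refine ContinuousMap.toLp_injective (E := EuclideanSpace ℝ (Fin n)) (p := 2) (𝕜 := ℝ)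
      (volume : Measure UnitAddCircle) ?_
    rw [map_zero]
    exact norm_eq_zero.1 h1
  exact Subtype.ext (Prod.ext h3 (norm_eq_zero.1 h2))

instance : NormedAddCommGroup (FracSobolev n s) :=
  AddGroupNorm.toNormedAddCommGroup
    { toFun := fun f => ‖f‖
      map_zero' := by simpa using norm_smul_eq (0 : ℝ) (0 : FracSobolev n s)
      add_le' := norm_add_le_aux
      neg' := fun f => by simpa using norm_smul_eq (-1 : ℝ) f
      eq_zero_of_map_eq_zero' := eq_zero_of_norm }

instance : NormedSpace ℝ (FracSobolev n s) where
  norm_smul_le c f := (norm_smul_eq c f).le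

/-- The set of injective regular curves. -/
def ir (n : ℕ) (s : ℝ) : Set (FracSobolev n s) :=
  {γ | Function.Injective γ ∧ ∀ u, circleDeriv γ u ≠ 0}

end FracSobolev

/-! ### O'Hara's energies -/

section Energy

variable {n : ℕ}

/-- The length of `γ` restricted to the arc between `u` and `u + w`. -/
def arcLength (γ : UnitAddCircle → EuclideanSpace ℝ (Fin n)) (u : UnitAddCircle) (w : ℝ) : ℝ :=
  |∫ θ in (0 : ℝ)..w, ‖circleDeriv γ (u + (θ : UnitAddCircle))‖|

/-- The length of `γ`. -/
def totalLength (γ : UnitAddCircle → EuclideanSpace ℝ (Fin n)) : ℝ :=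
  ∫ θ in (0 : ℝ)..1, ‖circleDeriv γ (θ : UnitAddCircle)‖

/-- The intrinsic distance `d_γ(u + w, u)`, for `|w| ≤ 1/2`. -/
def intrinsicDist (γ : UnitAddCircle → EuclideanSpace ℝ (Fin n)) (u : UnitAddCircle) (w : ℝ) : ℝ :=
  min (arcLength γ u w) (totalLength γ - arcLength γ u w)

/-- The difference `γ(u + w) - γ(u)`. -/
def delta (γ : UnitAddCircle → EuclideanSpace ℝ (Fin n)) (u : UnitAddCircle) (w : ℝ) :
    EuclideanSpace ℝ (Fin n) :=
  γ (u + (w : UnitAddCircle)) - γ u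

/-- O'Hara's energy `E^{(α)}(γ) ∈ [0, ∞]`. The subtraction in `[0, ∞]` is not truncating, because
`|γ(u+w) - γ(u)| ≤ d_γ(u+w,u)`, and `0⁻¹ = ∞`. -/
def energy (α : ℝ) (γ : UnitAddCircle → EuclideanSpace ℝ (Fin n)) : ℝ≥0∞ :=
  ∫⁻ u : UnitAddCircle, ∫⁻ w : ℝ in W,
    ((ENNReal.ofReal ‖delta γ u w‖ ^ α)⁻¹ - (ENNReal.ofReal (intrinsicDist γ u w) ^ α)⁻¹) *
      ENNReal.ofReal ‖circleDeriv γ (u + (w : UnitAddCircle))‖ *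
      ENNReal.ofReal ‖circleDeriv γ u‖

/-- The punctured strip `U_ε = ℝ/ℤ × ([-1/2, -ε] ∪ [ε, 1/2])`. -/
def U (ε : ℝ) : Set (UnitAddCircle × ℝ) :=
  univ ×ˢ (Icc (-(1 / 2)) (-ε) ∪ Icc ε (1 / 2))

/-- The derivative of `τ ↦ d_{γ + τ h}(u + w, u)` at `τ = 0`. -/
def intrinsicDistDeriv (γ h : UnitAddCircle → EuclideanSpace ℝ (Fin n)) (u : UnitAddCircle)
    (w : ℝ) : ℝ :=
  deriv (fun τ : ℝ => intrinsicDist (fun v => γ v + τ • h v) u w) 0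

/-- The integrand of the first variation at a general regular curve. -/
def variationIntegrand (α : ℝ) (γ h : UnitAddCircle → EuclideanSpace ℝ (Fin n))
    (p : UnitAddCircle × ℝ) : ℝ :=
  let u := p.1
  let w := p.2
  (2 * (1 / ‖delta γ u w‖ ^ α - 1 / intrinsicDist γ u w ^ α) *
        inner ℝ ((1 / ‖circleDeriv γ u‖ ^ 2) • circleDeriv γ u) (circleDeriv h u)
      - α * (inner ℝ (delta γ u w) (delta h u w) / ‖delta γ u w‖ ^ (α + 2)
          - intrinsicDistDeriv γ h u w / intrinsicDist γ u w ^ (α + 1)))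
    * ‖circleDeriv γ (u + (w : UnitAddCircle))‖ * ‖circleDeriv γ u‖

/-- The integrand of the first variation at a curve parametrized by arc length. -/
def arcVariationIntegrand (α : ℝ) (γ h : UnitAddCircle → EuclideanSpace ℝ (Fin n))
    (p : UnitAddCircle × ℝ) : ℝ :=
  let u := p.1
  let w := p.2
  (α - 2) * (inner ℝ (circleDeriv γ u) (circleDeriv h u) / |w| ^ α)
    + 2 * (inner ℝ (circleDeriv γ u) (circleDeriv h u) / ‖delta γ u w‖ ^ α)
    - α * (inner ℝ (delta γ u w) (delta h u w) / ‖delta γ u w‖ ^ (α + 2))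

end Energy

end

end OHara

/-!
The energy depends on a curve `γ` only through its derivative `g = γ'`. Write the chord over the
arc from `u` to `u + w` as `w` times the average `arcMean g (u, w)`, and let `X` and `Y` be the
lengths of this arc and of its complement. Since `min X Y ^ (-α) + max X Y ^ (-α)` equals
`X ^ (-α) + Y ^ (-α)`, the difference `|Δγ| ^ (-α) - min X Y ^ (-α)` is the sum of
`|Δγ| ^ (-α) - X ^ (-α)`, which is singular at `w = 0` but does not see the cut locus, and of
`max X Y ^ (-α) - Y ^ (-α)`, which is bounded but not smooth where `X = Y`.

For the singular part, `(∫ |g|)² - |∫ g|²` over the arc is the double integral of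
`|g(s)| |g(t)| - ⟨g(s), g(t)⟩`, a quantity of second order in `g(s) - g(t)`. When `g` is perturbed
by `k` with `|k| ≤ η`, its value, its first-order change and its remainder are controlled by the
mean square oscillations of `g` and `k` on the arc (`jet_norm_mul_norm_sub_inner`,
`jet_speed_sq_sub_chord_sq`), and this survives composition with a power (`jet_rpow_sub`). Weighted
with `|w| ^ (-α)` and integrated, these oscillations are bounded by the squared Gagliardo seminorm
(`lintegral_osc_le`). For the bounded part the expansion fails to be of second order only where
`|X - Y|` is at most a multiple of `η`; there the remainder is of order `η`, but this set has
measure of order `η`, because `X` grows in `|w|` at least as fast as the minimal speed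
(`jet_max_rpow_sub`, `stripMeasure_arcLen_close_le`).

Consequently the energy has, locally uniformly on the injective regular curves, a first-order
expansion with a quadratic remainder (`FracSobolev.exists_energy_expansion`). Such a functional is
differentiable, with continuous derivative (`hasFDerivAt_of_quadratic_remainder`). The input needed
for this is the embedding of `H^{1+s,2}`, `s > 1/2`, into `C¹`, which follows from the Fourier
series of the weak derivative (`FracSobolev.exists_norm_circleDeriv_le`), and compactness, which
gives uniform lower bounds for speed and chords, stable under `C¹`-small perturbations.

The derivative is the integral of the pointwise first-order change of the density over the whole
strip. The reflection `(u, w) ↦ (u + w, -w)`, which exchanges the end points, turns it into the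
integral of the stated integrand (`integral_dDensity_symm`); this integrand is even absolutely
integrable on the strip, so that the limit over the punctured strips follows by dominated
convergence. For curves parametrized by arc length, the two integrands differ by a multiple of
`|w| ^ (-α) (T(u) - arcMean T (u, w))`, where `T = ⟨γ', h'⟩`, whose integral over the circle
vanishes for each `w ≠ 0` (`integral_sub_arcMean`).
-/

namespace OHara

/-! ### Fourier coefficients and the Gagliardo seminorm -/

section Fourier

open AddCircle

theorem haarAddCircle_eq_volume :
    (haarAddCircle : Measure UnitAddCircle) = volume := by
  rw [volume_eq_smul_haarAddCircle]
  simp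

theorem fourierCoeff_translate (f : UnitAddCircle → ℂ) (a : UnitAddCircle) (k : ℤ) :
    fourierCoeff (fun u => f (u + a)) k = fourier k a * fourierCoeff f k := by
  unfold fourierCoeff
  rw [haarAddCircle_eq_volume]
  have h := integral_add_right_eq_self (μ := (volume : Measure UnitAddCircle))
    (fun u => fourier (-k) (u - a) • f u) a
  simp only [add_sub_cancel_right] at h
  rw [h, ← integral_const_mul]
  congr 1
  ext u
  have : (fourier (-k) (u - a) : ℂ) = fourier k a * fourier (-k) u := by
    have e : (-k) • (u - a) = k • a + (-k) • u := by
      rw [smul_sub, neg_smul k a]; abel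
    rw [fourier_apply, e, toCircle_add, Circle.coe_mul, fourier_apply, fourier_apply]
  rw [this, smul_eq_mul, smul_eq_mul, mul_assoc]

/-- Bessel's inequality. -/
theorem sum_sq_fourierCoeff_le {f : UnitAddCircle → ℂ} (hf : MemLp f 2 volume) (S : Finset ℤ) :
    ∑ k ∈ S, ENNReal.ofReal (‖fourierCoeff f k‖ ^ 2) ≤ ∫⁻ u, ENNReal.ofReal (‖f u‖ ^ 2) := by
  rw [← haarAddCircle_eq_volume] at hf ⊢
  have h := hasSum_sq_fourierCoeff hf.toLp
  have hi : Integrable (fun u => ‖f u‖ ^ 2) haarAddCircle := hf.integrable_norm_pow (by norm_num)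
  rw [← ENNReal.ofReal_sum_of_nonneg (fun _ _ => by positivity),
    ← ofReal_integral_eq_lintegral_ofReal hi (Eventually.of_forall fun _ => by positivity)]
  refine ENNReal.ofReal_le_ofReal ?_
  have h1 : ∀ k, fourierCoeff (hf.toLp) k = fourierCoeff f k := fun k =>
    congrFun (fourierCoeff_congr_ae hf.coeFn_toLp) k
  have h2 : ∫ u, ‖(hf.toLp) u‖ ^ 2 ∂haarAddCircle = ∫ u, ‖f u‖ ^ 2 ∂haarAddCircle := by
    refine integral_congr_ae ?_
    filter_upwards [hf.coeFn_toLp] with u hu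
    rw [hu]
  simp only [h1, h2] at h
  exact sum_le_hasSum S (fun _ _ => by positivity) h

/-- For `1 / (4|k|) ≤ w ≤ 1 / (2|k|)` the number `exp (2πikw)` has nonpositive real part. -/
theorem one_le_norm_fourier_sub_one {k : ℤ} {w : ℝ} (h1 : 1 / (4 * |(k : ℝ)|) ≤ w)
    (h2 : w ≤ 1 / (2 * |(k : ℝ)|)) (hk : k ≠ 0) :
    1 ≤ ‖(fourier k (w : UnitAddCircle) : ℂ) - 1‖ := by
  have hk' : 0 < |(k : ℝ)| := by positivity
  have hre : (fourier k (w : UnitAddCircle) : ℂ).re = Real.cos (2 * Real.pi * (|(k : ℝ)| * w)) := by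
    rw [fourier_coe_apply, Complex.exp_re]
    have e1 : (2 * (Real.pi : ℂ) * Complex.I * k * w / ((1 : ℝ) : ℂ))
        = ((2 * Real.pi * (k * w) : ℝ) : ℂ) * Complex.I := by
      push_cast; ring
    rw [e1, Complex.re_ofReal_mul, Complex.im_ofReal_mul]
    simp only [Complex.I_re, Complex.I_im, mul_zero, Real.exp_zero, one_mul, mul_one]
    rcases abs_cases (k : ℝ) with ⟨h, _⟩ | ⟨h, _⟩
    · rw [h]
    · rw [h, ← Real.cos_neg]; ring_nf
  have h3 : 1 / 4 ≤ |(k : ℝ)| * w := by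
    rw [div_le_iff₀ (by positivity)] at h1; linarith
  have h4 : |(k : ℝ)| * w ≤ 1 / 2 := by
    rw [le_div_iff₀ (by positivity)] at h2; linarith
  have h5 : Real.cos (2 * Real.pi * (|(k : ℝ)| * w)) ≤ 0 := by
    apply Real.cos_nonpos_of_pi_div_two_le_of_le <;> nlinarith [Real.pi_pos]
  have h6 := Complex.abs_re_le_norm ((fourier k (w : UnitAddCircle) : ℂ) - 1)
  rw [Complex.sub_re, hre, Complex.one_re] at h6
  have := neg_abs_le (Real.cos (2 * Real.pi * (|(k : ℝ)| * w)) - 1)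
  linarith

/-- The Fourier multiplier of the squared Gagliardo seminorm of order `s` is at least a multiple of
`|k| ^ (2s)`: integrate only over `1 / (4|k|) ≤ w ≤ 1 / (2|k|)`. -/
theorem le_lintegral_fourier_sub_one {s : ℝ} (hs : 0 < s) {k : ℤ} (hk : k ≠ 0) :
    ENNReal.ofReal (|(k : ℝ)| ^ (2 * s) / 2) ≤ ∫⁻ w : ℝ in W,
      ENNReal.ofReal (‖(fourier k (w : UnitAddCircle) : ℂ) - 1‖ ^ 2 / |w| ^ (1 + 2 * s)) := by
  have hk1 : (1 : ℝ) ≤ |(k : ℝ)| := by exact_mod_cast Int.one_le_abs hk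
  have hk' : 0 < |(k : ℝ)| := by linarith
  set I := Icc (1 / (4 * |(k : ℝ)|)) (1 / (2 * |(k : ℝ)|)) with hI
  have hIW : I ⊆ W := by
    apply Icc_subset_Icc
    · have : 0 < 1 / (4 * |(k : ℝ)|) := by positivity
      linarith
    · gcongr; linarith
  calc ENNReal.ofReal (|(k : ℝ)| ^ (2 * s) / 2)
      ≤ ENNReal.ofReal ((2 * |(k : ℝ)|) ^ (1 + 2 * s)) * volume I := by
        rw [hI, Real.volume_Icc, ← ENNReal.ofReal_mul (by positivity)]
        apply ENNReal.ofReal_le_ofReal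
        have e1 : 1 / (2 * |(k : ℝ)|) - 1 / (4 * |(k : ℝ)|) = 1 / (4 * |(k : ℝ)|) := by
          field_simp; norm_num
        have h2 : (2 : ℝ) ≤ 2 ^ (1 + 2 * s) := by
          calc (2 : ℝ) = 2 ^ (1 : ℝ) := by simp
            _ ≤ _ := Real.rpow_le_rpow_of_exponent_le (by norm_num) (by linarith)
        rw [e1, Real.mul_rpow (by norm_num) hk'.le, Real.rpow_add hk', Real.rpow_one]
        have e2 : 2 ^ (1 + 2 * s) * (|(k : ℝ)| * |(k : ℝ)| ^ (2 * s)) * (1 / (4 * |(k : ℝ)|))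
          = 2 ^ (1 + 2 * s) / 4 * |(k : ℝ)| ^ (2 * s) := by field_simp
        rw [e2]
        have : 0 ≤ |(k : ℝ)| ^ (2 * s) := by positivity
        nlinarith
    _ = ∫⁻ w : ℝ in I, ENNReal.ofReal ((2 * |(k : ℝ)|) ^ (1 + 2 * s)) := by
        rw [setLIntegral_const]
    _ ≤ ∫⁻ w : ℝ in I,
      ENNReal.ofReal (‖(fourier k (w : UnitAddCircle) : ℂ) - 1‖ ^ 2 / |w| ^ (1 + 2 * s)) := by
        refine setLIntegral_mono' measurableSet_Icc fun w hw => ENNReal.ofReal_le_ofReal ?_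
        have h1 := one_le_norm_fourier_sub_one hw.1 hw.2 hk
        have hw0 : 0 < w := lt_of_lt_of_le (by positivity) hw.1
        rw [abs_of_pos hw0, le_div_iff₀ (by positivity), ← Real.mul_rpow (by positivity) hw0.le]
        have h3 : 2 * |(k : ℝ)| * w ≤ 1 := by
          have := hw.2
          rw [le_div_iff₀ (by positivity)] at this; linarith
        calc (2 * |(k : ℝ)| * w) ^ (1 + 2 * s) ≤ 1 :=
              Real.rpow_le_one (by positivity) h3 (by linarith)
          _ ≤ _ := by nlinarith
    _ ≤ _ := lintegral_mono_set hIW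

/-- Bessel's inequality for the differences `f (· + w) - f`, whose Fourier coefficients are
`(exp (2πikw) - 1) f̂(k)`, integrated over `w`. -/
theorem sum_abs_rpow_mul_fourierCoeff_le {s : ℝ} (hs : 0 < s) {f : UnitAddCircle → ℂ}
    (hfm : StronglyMeasurable f) (hf : MemLp f 2 volume) (S : Finset ℤ) :
    ∑ k ∈ S, ENNReal.ofReal (|(k : ℝ)| ^ (2 * s) / 2 * ‖fourierCoeff f k‖ ^ 2) ≤
      ∫⁻ u : UnitAddCircle, ∫⁻ w : ℝ in W,
        ENNReal.ofReal (‖f (u + (w : UnitAddCircle)) - f u‖ ^ 2 / |w| ^ (1 + 2 * s)) := by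
  have hmeas : Measurable (fun p : UnitAddCircle × ℝ => p.1 + (p.2 : UnitAddCircle)) := by
    have : Continuous (fun p : UnitAddCircle × ℝ => p.1 + (p.2 : UnitAddCircle)) :=
      continuous_fst.add ((AddCircle.continuous_mk' 1).comp continuous_snd)
    exact this.measurable
  have hm : Measurable (fun p : UnitAddCircle × ℝ =>
      ENNReal.ofReal (‖f (p.1 + (p.2 : UnitAddCircle)) - f p.1‖ ^ 2 / |p.2| ^ (1 + 2 * s))) := by
    have h1 : Measurable (fun p : UnitAddCircle × ℝ => f (p.1 + (p.2 : UnitAddCircle)) - f p.1) :=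
      (hfm.measurable.comp hmeas).sub (hfm.measurable.comp measurable_fst)
    fun_prop
  rw [lintegral_lintegral_swap hm.aemeasurable]
  have hkw : ∀ k : ℤ, Measurable (fun w : ℝ => ENNReal.ofReal
      (‖fourierCoeff f k‖ ^ 2 * (‖(fourier k (w : UnitAddCircle) : ℂ) - 1‖ ^ 2
        / |w| ^ (1 + 2 * s)))) := fun k => by
    have : Measurable (fun w : ℝ => (fourier k (w : UnitAddCircle) : ℂ)) :=
      ((fourier k).continuous.comp (AddCircle.continuous_mk' 1)).measurable
    fun_prop
  calc ∑ k ∈ S, ENNReal.ofReal (|(k : ℝ)| ^ (2 * s) / 2 * ‖fourierCoeff f k‖ ^ 2)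
      ≤ ∑ k ∈ S, ∫⁻ w : ℝ in W, ENNReal.ofReal
          (‖fourierCoeff f k‖ ^ 2 * (‖(fourier k (w : UnitAddCircle) : ℂ) - 1‖ ^ 2
            / |w| ^ (1 + 2 * s))) := by
        refine Finset.sum_le_sum fun k _ => ?_
        by_cases hk : k = 0
        · subst hk
          rw [Int.cast_zero, abs_zero, Real.zero_rpow (by linarith)]
          simp
        · simp_rw [ENNReal.ofReal_mul (sq_nonneg ‖fourierCoeff f k‖)]
          rw [lintegral_const_mul' _ _ ENNReal.ofReal_ne_top, mul_comm, ENNReal.ofReal_mul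
            (by positivity)]
          gcongr
          exact le_lintegral_fourier_sub_one hs hk
    _ = ∫⁻ w : ℝ in W, ∑ k ∈ S, ENNReal.ofReal
          (‖fourierCoeff f k‖ ^ 2 * (‖(fourier k (w : UnitAddCircle) : ℂ) - 1‖ ^ 2
            / |w| ^ (1 + 2 * s))) := by
        rw [lintegral_finsetSum _ fun k _ => hkw k]
    _ ≤ _ := by
        refine lintegral_mono fun w => ?_
        have hq : MemLp (fun u => f (u + (w : UnitAddCircle))) 2 volume :=
          hf.comp_measurePreserving (measurePreserving_add_right volume (w : UnitAddCircle))
        have hd : MemLp (fun u => f (u + (w : UnitAddCircle)) - f u) 2 volume := hq.sub hf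
        have hc : ∀ k, fourierCoeff (fun u => f (u + (w : UnitAddCircle)) - f u) k
            = (fourier k (w : UnitAddCircle) - 1) * fourierCoeff f k := fun k => by
          have e1 : (fun u => f (u + (w : UnitAddCircle)) - f u)
              = (fun u => f (u + (w : UnitAddCircle))) + ((-1 : ℂ) • f) := by
            ext u; simp [sub_eq_add_neg]
          have i1 : Integrable (fun u => f (u + (w : UnitAddCircle))) haarAddCircle := by
            rw [haarAddCircle_eq_volume]; exact hq.integrable (by norm_num)
          have i2 : Integrable ((-1 : ℂ) • f) haarAddCircle := by
            rw [haarAddCircle_eq_volume]; exact (hf.integrable (by norm_num)).smul _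
          rw [e1, fourierCoeff.add i1 i2, Pi.add_apply, fourierCoeff_translate,
            fourierCoeff.const_smul, smul_eq_mul]
          ring
        have h := sum_sq_fourierCoeff_le hd S
        simp only [hc, norm_mul, mul_pow] at h
        have e : ∀ x : ℝ, ENNReal.ofReal (x / |w| ^ (1 + 2 * s))
            = ENNReal.ofReal x * ENNReal.ofReal ((|w| ^ (1 + 2 * s))⁻¹) := fun x => by
          rw [div_eq_mul_inv, ENNReal.ofReal_mul' (by positivity)]
        simp_rw [← mul_div_assoc, e]
        rw [← Finset.sum_mul, lintegral_mul_const' _ _ ENNReal.ofReal_ne_top]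
        gcongr
        simpa only [mul_comm] using h

/-- The fractional Sobolev embedding in Fourier terms: for `s > 1/2` the coefficients are absolutely
summable, by the Cauchy-Schwarz inequality with the weights `|k| ^ (± s)`. -/
theorem exists_tsum_fourierCoeff_le {s : ℝ} (hs : 1 / 2 < s) :
    ∃ C : ℝ, 0 ≤ C ∧ ∀ f : UnitAddCircle → ℂ, StronglyMeasurable f → MemLp f 2 volume →
      fourierCoeff f 0 = 0 → ∀ G : ℝ, 0 ≤ G →
      (∫⁻ u : UnitAddCircle, ∫⁻ w : ℝ in W,
        ENNReal.ofReal (‖f (u + (w : UnitAddCircle)) - f u‖ ^ 2 / |w| ^ (1 + 2 * s)))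
          ≤ ENNReal.ofReal (G ^ 2) →
      Summable (fun k => ‖fourierCoeff f k‖) ∧ ∑' k, ‖fourierCoeff f k‖ ≤ C * G := by
  have hsum := Real.summable_abs_int_rpow (b := 2 * s) (by linarith)
  set A := ∑' n : ℤ, |(n : ℝ)| ^ (-(2 * s)) with hA
  have hA0 : 0 ≤ A := tsum_nonneg fun _ => by positivity
  refine ⟨√(2 * A), by positivity, fun f hfm hf h0 G hG hle => ?_⟩
  have key : ∀ S : Finset ℤ, ∑ k ∈ S, ‖fourierCoeff f k‖ ≤ √(2 * A) * G := fun S => by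
    have h1 := (sum_abs_rpow_mul_fourierCoeff_le (by linarith) hfm hf S).trans hle
    rw [← ENNReal.ofReal_sum_of_nonneg (fun _ _ => by positivity),
      ENNReal.ofReal_le_ofReal_iff (by positivity)] at h1
    have h2 : (∑ k ∈ S, ‖fourierCoeff f k‖) ^ 2 ≤
        (∑ k ∈ S, |(k : ℝ)| ^ (-(2 * s))) *
          ∑ k ∈ S, |(k : ℝ)| ^ (2 * s) * ‖fourierCoeff f k‖ ^ 2 := by
      have := Finset.sum_mul_sq_le_sq_mul_sq S (fun k : ℤ => |(k : ℝ)| ^ (-s))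
        (fun k => |(k : ℝ)| ^ s * ‖fourierCoeff f k‖)
      have e1 : ∀ k : ℤ, |(k : ℝ)| ^ (-s) * (|(k : ℝ)| ^ s * ‖fourierCoeff f k‖)
          = ‖fourierCoeff f k‖ := fun k => by
        by_cases hk : k = 0
        · simp [hk, h0]
        · have : 0 < |(k : ℝ)| := by positivity
          rw [← mul_assoc, ← Real.rpow_add this, neg_add_cancel, Real.rpow_zero, one_mul]
      have e2 : ∀ (k : ℤ) (t : ℝ), (|(k : ℝ)| ^ t) ^ 2 = |(k : ℝ)| ^ (2 * t) := fun k t => by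
        rw [← Real.rpow_mul_natCast (abs_nonneg _), mul_comm]
        norm_num
      simpa only [e1, mul_pow, e2, mul_neg] using this
    have h3 : ∑ k ∈ S, |(k : ℝ)| ^ (-(2 * s)) ≤ A :=
      hsum.sum_le_tsum S fun _ _ => by positivity
    have h4 : ∑ k ∈ S, |(k : ℝ)| ^ (2 * s) * ‖fourierCoeff f k‖ ^ 2 ≤ 2 * G ^ 2 := by
      have : ∑ k ∈ S, |(k : ℝ)| ^ (2 * s) * ‖fourierCoeff f k‖ ^ 2
          = 2 * ∑ k ∈ S, |(k : ℝ)| ^ (2 * s) / 2 * ‖fourierCoeff f k‖ ^ 2 := by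
        rw [Finset.mul_sum]
        exact Finset.sum_congr rfl fun k _ => by ring
      linarith
    refine abs_le_of_sq_le_sq' ?_ (by positivity) |>.2
    rw [mul_pow, Real.sq_sqrt (by positivity)]
    calc _ ≤ _ := h2
      _ ≤ A * (2 * G ^ 2) := by gcongr
      _ = _ := by ring
  have hs' := summable_of_sum_le (fun k => norm_nonneg (fourierCoeff f k)) key
  exact ⟨hs', hs'.tsum_le_of_sum_le key⟩

/-- An `L²` function whose Fourier coefficients are summable is the sum of its Fourier series. -/
theorem ae_eq_tsum_fourier {f : UnitAddCircle → ℂ} (hf : MemLp f 2 volume)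
    (h : Summable (fun k => ‖fourierCoeff f k‖)) :
    f =ᵐ[volume] fun u => ∑' k, fourierCoeff f k * fourier k u := by
  rw [← haarAddCircle_eq_volume] at hf ⊢
  have hs : Summable (fun k => fourierCoeff f k • (fourier k : C(UnitAddCircle, ℂ))) := by
    refine Summable.of_norm ?_
    simpa only [norm_smul, fourier_norm (T := 1), mul_one] using h
  obtain ⟨Φ, hΦ⟩ := hs
  have h1 := (ContinuousMap.toLp (E := ℂ) 2 haarAddCircle ℂ).hasSum hΦ
  have h2 := hasSum_fourier_series_L2 hf.toLp
  have h3 : ∀ k, fourierCoeff (hf.toLp) k = fourierCoeff f k := fun k =>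
    congrFun (fourierCoeff_congr_ae hf.coeFn_toLp) k
  simp only [h3] at h2
  have h4 : ContinuousMap.toLp (E := ℂ) 2 haarAddCircle ℂ Φ = hf.toLp := by
    refine h1.unique ?_
    convert h2 using 2 with k
    rw [map_smul]
  have h5 := ContinuousMap.coeFn_toLp (E := ℂ) (p := 2) (𝕜 := ℂ) haarAddCircle Φ
  rw [h4] at h5
  filter_upwards [h5, hf.coeFn_toLp] with u hu hv
  rw [← hv, hu]
  have := ((ContinuousMap.evalCLM ℂ u).hasSum hΦ).tsum_eq
  simpa using this.symm

end Fourier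

/-! ### The embedding of the fractional Sobolev space into `C¹` -/

section Embedding

open AddCircle

theorem fourier_coe_re (k : ℤ) (t : ℝ) :
    (fourier k (t : UnitAddCircle) : ℂ).re = Real.cos (2 * Real.pi * k * t) := by
  have : (2 * (Real.pi : ℂ) * Complex.I * k * t / ((1 : ℝ) : ℂ))
      = ((2 * Real.pi * k * t : ℝ) : ℂ) * Complex.I := by
    push_cast; ring
  rw [fourier_coe_apply, this, Complex.exp_ofReal_mul_I_re]

theorem fourier_coe_im (k : ℤ) (t : ℝ) :
    (fourier k (t : UnitAddCircle) : ℂ).im = Real.sin (2 * Real.pi * k * t) := by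
  have : (2 * (Real.pi : ℂ) * Complex.I * k * t / ((1 : ℝ) : ℂ))
      = ((2 * Real.pi * k * t : ℝ) : ℂ) * Complex.I := by
    push_cast; ring
  rw [fourier_coe_apply, this, Complex.exp_ofReal_mul_I_im]

theorem isTest_fourier_re (k : ℤ) :
    IsTest (fun u : UnitAddCircle => (fourier k u : ℂ).re) := by
  unfold IsTest
  simp only [fourier_coe_re]
  fun_prop

theorem isTest_fourier_im (k : ℤ) :
    IsTest (fun u : UnitAddCircle => (fourier k u : ℂ).im) := by
  unfold IsTest
  simp only [fourier_coe_im]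
  fun_prop

theorem circleDeriv_fourier_re (k : ℤ) (u : UnitAddCircle) :
    circleDeriv (fun u : UnitAddCircle => (fourier k u : ℂ).re) u
      = -(2 * Real.pi * k) * (fourier k u : ℂ).im := by
  obtain ⟨t, rfl⟩ := QuotientAddGroup.mk_surjective u
  refine (circleDeriv_coe _ t).trans ?_
  erw [fourier_coe_im]
  simp only [fourier_coe_re]
  have h : HasDerivAt (fun t : ℝ => 2 * Real.pi * k * t) (2 * Real.pi * k) t := by
    simpa using (hasDerivAt_id t).const_mul (2 * Real.pi * k)
  rw [h.cos.deriv]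
  ring

theorem circleDeriv_fourier_im (k : ℤ) (u : UnitAddCircle) :
    circleDeriv (fun u : UnitAddCircle => (fourier k u : ℂ).im) u
      = (2 * Real.pi * k) * (fourier k u : ℂ).re := by
  obtain ⟨t, rfl⟩ := QuotientAddGroup.mk_surjective u
  refine (circleDeriv_coe _ t).trans ?_
  erw [fourier_coe_re]
  simp only [fourier_coe_im]
  have h : HasDerivAt (fun t : ℝ => 2 * Real.pi * k * t) (2 * Real.pi * k) t := by
    simpa using (hasDerivAt_id t).const_mul (2 * Real.pi * k)
  rw [h.sin.deriv]
  ring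

namespace FracSobolev

variable {n : ℕ} {s : ℝ}

theorem isWeakDeriv (f : FracSobolev n s) : IsWeakDeriv f f.weakDeriv := f.2.1

theorem integrable_weakDeriv (f : FracSobolev n s) : Integrable f.weakDeriv :=
  (Lp.memLp f.weakDeriv).integrable (by norm_num)

theorem weakDeriv_coord (f : FracSobolev n s) (i : Fin n) {φ : UnitAddCircle → ℝ}
    (hφ : IsTest φ) :
    ∫ u, circleDeriv φ u * f u i = - ∫ u, φ u * f.weakDeriv u i := by
  have h := congrArg (EuclideanSpace.proj (𝕜 := ℝ) i) (f.isWeakDeriv φ hφ)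
  have hi : Integrable (fun u => circleDeriv φ u • f u) :=
    integrable_smul_of_continuous hφ.continuous_circleDeriv
      (f.toC.continuous.integrable_of_hasCompactSupport (HasCompactSupport.of_compactSpace _))
  rw [map_neg, ← ContinuousLinearMap.integral_comp_comm _ hi, ←
    ContinuousLinearMap.integral_comp_comm _
    (integrable_smul_of_continuous hφ.continuous f.integrable_weakDeriv)] at h
  simpa using h

/-- The Fourier coefficients of the weak derivative, obtained by testing with the real and imaginary
parts of the characters. -/
theorem fourierCoeff_weakDeriv (f : FracSobolev n s) (i : Fin n) (k : ℤ) :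
    fourierCoeff (fun u => ((f.weakDeriv u i : ℝ) : ℂ)) k
      = 2 * Real.pi * Complex.I * k * fourierCoeff (fun u => ((f u i : ℝ) : ℂ)) k := by
  have hf : Integrable (fun u => f u i) :=
    Continuous.integrable_of_hasCompactSupport
      ((EuclideanSpace.proj (𝕜 := ℝ) i).continuous.comp f.toC.continuous)
      (HasCompactSupport.of_compactSpace _)
  have hg : Integrable (fun u => f.weakDeriv u i) :=
    (EuclideanSpace.proj (𝕜 := ℝ) i).integrable_comp f.integrable_weakDeriv
  have e : ∀ q : UnitAddCircle → ℝ, Integrable q →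
      fourierCoeff (fun u => ((q u : ℝ) : ℂ)) k
        = ((∫ u, (fourier k u : ℂ).re * q u : ℝ) : ℂ)
          - Complex.I * ((∫ u, (fourier k u : ℂ).im * q u : ℝ) : ℂ) := fun q hq => by
    have i1 : Integrable (fun u => (fourier k u : ℂ).re * q u) := by
      simpa using integrable_smul_of_continuous (isTest_fourier_re k).continuous hq
    have i2 : Integrable (fun u => (fourier k u : ℂ).im * q u) := by
      simpa using integrable_smul_of_continuous (isTest_fourier_im k).continuous hq
    have j1 : Integrable (fun u => (((fourier k u : ℂ).re * q u : ℝ) : ℂ)) := i1.ofReal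
    have j2 : Integrable (fun u => (((fourier k u : ℂ).im * q u : ℝ) : ℂ)) := i2.ofReal
    rw [← integral_complex_ofReal, ← integral_complex_ofReal, ← integral_const_mul,
      ← integral_sub j1 (j2.const_mul _), fourierCoeff, haarAddCircle_eq_volume]
    congr 1
    ext u
    rw [fourier_neg]
    have := Complex.re_add_im (fourier k u)
    conv_lhs => rw [← this]
    simp only [map_add, map_mul, Complex.conj_ofReal, Complex.conj_I, smul_eq_mul]
    push_cast
    ring
  have h1 := f.weakDeriv_coord i (isTest_fourier_re k)
  have h2 := f.weakDeriv_coord i (isTest_fourier_im k)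
  simp only [circleDeriv_fourier_re, circleDeriv_fourier_im, mul_assoc, neg_mul,
    integral_const_mul, integral_neg] at h1 h2
  rw [e _ hf, e _ hg]
  rw [neg_inj] at h1
  rw [← h1, ← neg_eq_iff_eq_neg.2 h2]
  push_cast
  linear_combination (2 * Real.pi * k * (∫ u, (fourier k u : ℂ).im * f u i : ℝ)) * Complex.I_sq

theorem lintegral_coord_le (f : FracSobolev n s) (i : Fin n) :
    (∫⁻ u : UnitAddCircle, ∫⁻ w : ℝ in W,
      ENNReal.ofReal (‖((f.weakDeriv (u + (w : UnitAddCircle)) i : ℝ) : ℂ)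
        - ((f.weakDeriv u i : ℝ) : ℂ)‖ ^ 2 / |w| ^ (1 + 2 * s)))
      ≤ ENNReal.ofReal ((gagliardo s f.weakDeriv).toReal ^ 2) := by
  rw [ENNReal.ofReal_pow ENNReal.toReal_nonneg, ENNReal.ofReal_toReal f.gagliardo_lt_top.ne,
    gagliardo, ← ENNReal.rpow_mul_natCast]
  norm_num
  refine lintegral_mono fun u => lintegral_mono fun w => ENNReal.ofReal_le_ofReal ?_
  rw [← Complex.ofReal_sub, Complex.norm_real]
  gcongr
  exact PiLp.norm_apply_le (f.weakDeriv (u + (w : UnitAddCircle)) - f.weakDeriv u) i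

/-- Elements of `H^{1+s,2}`, `s > 1/2`, are of class `C¹`: the classical derivative exists, is
continuous, represents the weak derivative, and is controlled in the supremum norm. -/
theorem exists_norm_circleDeriv_le (n : ℕ) {s : ℝ} (hs : 1 / 2 < s) :
    ∃ C : ℝ, 0 ≤ C ∧ ∀ f : FracSobolev n s,
      (∀ t : ℝ, HasDerivAt (fun t : ℝ => f (t : UnitAddCircle))
        (circleDeriv f (t : UnitAddCircle)) t) ∧
      Continuous (circleDeriv f) ∧ circleDeriv f =ᵐ[volume] f.weakDeriv ∧
      ∀ u, ‖circleDeriv f u‖ ≤ C * ‖f‖ := by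
  obtain ⟨C, hC, H⟩ := exists_tsum_fourierCoeff_le hs
  refine ⟨√n * C, by positivity, fun f => ?_⟩
  set G := (gagliardo s f.weakDeriv).toReal with hG
  have hG0 : 0 ≤ G := ENNReal.toReal_nonneg
  have hGf : G ≤ ‖f‖ := by
    rw [norm_def]; linarith [Real.sqrt_nonneg (‖f.toLp‖ ^ 2 + ‖f.weakDeriv‖ ^ 2)]
  let q : Fin n → UnitAddCircle → ℂ := fun i u => ((f.weakDeriv u i : ℝ) : ℂ)
  have hqm : ∀ i, StronglyMeasurable (q i) := fun i =>
    (Complex.continuous_ofReal.comp (EuclideanSpace.proj (𝕜 := ℝ)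
      i).continuous).comp_stronglyMeasurable
      (Lp.stronglyMeasurable f.weakDeriv)
  have hq2 : ∀ i, MemLp (q i) 2 volume := fun i =>
    (Lp.memLp f.weakDeriv).mono (hqm i).aestronglyMeasurable (Eventually.of_forall fun u => by
      simp only [q, Complex.norm_real]; exact PiLp.norm_apply_le _ i)
  have hq0 : ∀ i, fourierCoeff (q i) 0 = 0 := fun i => by
    rw [f.fourierCoeff_weakDeriv i 0]; simp
  have HH := fun i => H (q i) (hqm i) (hq2 i) (hq0 i) G hG0 (f.lintegral_coord_le i)
  -- the derivative, as a Fourier series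
  let Φ : Fin n → UnitAddCircle → ℂ := fun i u => ∑' k, fourierCoeff (q i) k * fourier k u
  have hnf : ∀ (k : ℤ) (u : UnitAddCircle), ‖(fourier k u : ℂ)‖ = 1 := fun k u => by
    rw [fourier_apply, Circle.norm_coe]
  have hΦc : ∀ i, Continuous (Φ i) := fun i =>
    continuous_tsum (fun k => by fun_prop) (HH i).1 fun k u => by rw [norm_mul, hnf, mul_one]
  have hΦn : ∀ i u, ‖Φ i u‖ ≤ C * G := fun i u => by
    refine le_trans (norm_tsum_le_tsum_norm ?_) ?_
    · simpa only [norm_mul, hnf, mul_one] using (HH i).1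
    · simpa only [norm_mul, hnf, mul_one] using (HH i).2
  have hder : ∀ i (t : ℝ), HasDerivAt (fun t : ℝ => f (t : UnitAddCircle) i)
      (Φ i (t : UnitAddCircle)).re t := fun i t => by
    let fi : C(UnitAddCircle, ℂ) := ⟨fun u => ((f u i : ℝ) : ℂ),
      Complex.continuous_ofReal.comp
        ((EuclideanSpace.proj (𝕜 := ℝ) i).continuous.comp f.toC.continuous)⟩
    have hfi : ∀ k, fourierCoeff (q i) k = 2 * Real.pi * Complex.I * k * fourierCoeff fi k :=
      fun k => f.fourierCoeff_weakDeriv i k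
    have hsum : Summable (fourierCoeff fi) := by
      refine Summable.of_norm_bounded_eventually (HH i).1 ?_
      have : ∀ᶠ k : ℤ in cofinite, k ≠ 0 := eventually_cofinite_ne 0
      filter_upwards [this] with k hk
      rw [hfi k, norm_mul]
      have h1 : 1 ≤ ‖(2 * Real.pi * Complex.I * k : ℂ)‖ := by
        simp only [norm_mul, Complex.norm_I, Complex.norm_real, Complex.norm_ofNat, mul_one,
          Complex.norm_intCast]
        have : (1 : ℝ) ≤ |(k : ℝ)| := by exact_mod_cast Int.one_le_abs hk
        have h3 := Real.pi_gt_three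
        rw [Real.norm_of_nonneg (by positivity)]
        nlinarith
      nlinarith [norm_nonneg (fourierCoeff fi k)]
    have hpt : ∀ x : ℝ, ((f (x : UnitAddCircle) i : ℝ) : ℂ)
        = ∑' k, fourierCoeff fi k * fourier k (x : UnitAddCircle) := fun x =>
      ((has_pointwise_sum_fourier_series_of_summable hsum (x : UnitAddCircle)).tsum_eq).symm
    have hd := hasDerivAt_tsum (𝕜 := ℝ) (F := ℂ) (g := fun k
      (x : ℝ) => fourierCoeff fi k * fourier k (x : UnitAddCircle))
      (g' := fun k (x : ℝ) => fourierCoeff (q i) k * fourier k (x : UnitAddCircle))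
      (y₀ := 0) (HH i).1
      (fun k x => by
        have := (hasDerivAt_fourier 1 k x).const_mul (fourierCoeff fi k)
        refine this.congr_deriv ?_
        rw [hfi, Complex.ofReal_one, div_one]
        ring)
      (fun k x => by rw [norm_mul, hnf, mul_one])
      (by
        have := (has_pointwise_sum_fourier_series_of_summable hsum (0 : UnitAddCircle)).summable
        simpa using this) t
    have h2 : HasDerivAt (fun x : ℝ => ((f (x : UnitAddCircle) i : ℝ) : ℂ)) (Φ i t) t := by
      simpa only [hpt] using hd
    have h3 := (Complex.reCLM.hasFDerivAt.comp_hasDerivAt t h2)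
    simpa [Function.comp_def] using h3
  have hder' : ∀ t : ℝ, HasDerivAt (fun t : ℝ => f (t : UnitAddCircle))
      (WithLp.toLp 2 fun i => (Φ i (t : UnitAddCircle)).re) t := fun t => by
    have h1 : HasDerivAt (fun (t : ℝ) i => f (t : UnitAddCircle) i)
        (fun i => (Φ i (t : UnitAddCircle)).re) t := hasDerivAt_pi.2 fun i => hder i t
    exact ((PiLp.continuousLinearEquiv 2 ℝ fun _ : Fin n => ℝ).symm :
      (Fin n → ℝ) →L[ℝ] EuclideanSpace ℝ (Fin n)).hasFDerivAt.comp_hasDerivAt t h1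
  have hcd : ∀ u : UnitAddCircle,
      circleDeriv f u = WithLp.toLp 2 fun i => (Φ i u).re := fun u => by
    obtain ⟨t, rfl⟩ := QuotientAddGroup.mk_surjective u
    exact (circleDeriv_coe _ t).trans (hder' t).deriv
  refine ⟨fun t => by rw [hcd]; exact hder' t, ?_, ?_, fun u => ?_⟩
  · rw [funext hcd]
    have : Continuous fun u i => (Φ i u).re :=
      continuous_pi fun i => Complex.continuous_re.comp (hΦc i)
    exact (PiLp.continuous_toLp 2 _).comp this
  · have h1 : ∀ᵐ u : UnitAddCircle, ∀ i, q i u = Φ i u :=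
      ae_all_iff.2 fun i => ae_eq_tsum_fourier (hq2 i) (HH i).1
    filter_upwards [h1] with u hu
    rw [hcd]
    ext i
    simp [← hu i, q]
  · rw [hcd, EuclideanSpace.norm_eq]
    have h1 : ∑ i : Fin n, ‖(Φ i u).re‖ ^ 2 ≤ n * (C * G) ^ 2 := by
      have : ∀ i ∈ Finset.univ, ‖(Φ i u).re‖ ^ 2 ≤ (C * G) ^ 2 := fun i _ => by
        have h1 : ‖(Φ i u).re‖ ≤ C * G := (Complex.abs_re_le_norm _).trans (hΦn i u)
        gcongr
      simpa using Finset.sum_le_sum this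
    calc √(∑ i : Fin n, ‖(Φ i u).re‖ ^ 2) ≤ √(n * (C * G) ^ 2) := Real.sqrt_le_sqrt h1
      _ = √n * (C * G) := by
        rw [Real.sqrt_mul (by positivity), Real.sqrt_sq (by positivity)]
      _ ≤ √n * C * ‖f‖ := by rw [← mul_assoc]; gcongr

end FracSobolev

end Embedding

/-! ### First-order expansions with remainder -/

/-- `x₁` is the value of a quantity after a perturbation, `x` its value before, and `x'` a
candidate for the first-order change; `m₀`, `m₁`, `m₂` bound the value, the first-order change and
the remainder. -/
structure Jet (m₀ m₁ m₂ x x₁ x' : ℝ) : Prop where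
  val : |x| ≤ m₀
  der : |x'| ≤ m₁
  rem : |x₁ - x - x'| ≤ m₂

namespace Jet

variable {m₀ m₁ m₂ l₀ l₁ l₂ x x₁ x' y y₁ y' : ℝ}

theorem mono (h : Jet m₀ m₁ m₂ x x₁ x') (h₀ : m₀ ≤ l₀) (h₁ : m₁ ≤ l₁) (h₂ : m₂ ≤ l₂) :
    Jet l₀ l₁ l₂ x x₁ x' :=
  ⟨h.val.trans h₀, h.der.trans h₁, h.rem.trans h₂⟩

theorem diff_le (h : Jet m₀ m₁ m₂ x x₁ x') : |x₁ - x| ≤ m₁ + m₂ := by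
  have := abs_add_le x' (x₁ - x - x')
  rw [add_sub_cancel] at this
  linarith [h.der, h.rem]

theorem add (h : Jet m₀ m₁ m₂ x x₁ x') (k : Jet l₀ l₁ l₂ y y₁ y') :
    Jet (m₀ + l₀) (m₁ + l₁) (m₂ + l₂) (x + y) (x₁ + y₁) (x' + y') where
  val := (abs_add_le _ _).trans (add_le_add h.val k.val)
  der := (abs_add_le _ _).trans (add_le_add h.der k.der)
  rem := by
    have e : x₁ + y₁ - (x + y) - (x' + y') = (x₁ - x - x') + (y₁ - y - y') := by ring
    rw [e]
    exact (abs_add_le _ _).trans (add_le_add h.rem k.rem)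

theorem const_mul (h : Jet m₀ m₁ m₂ x x₁ x') {a : ℝ} (ha : 0 ≤ a) :
    Jet (a * m₀) (a * m₁) (a * m₂) (a * x) (a * x₁) (a * x') where
  val := by rw [abs_mul, abs_of_nonneg ha]; exact mul_le_mul_of_nonneg_left h.val ha
  der := by rw [abs_mul, abs_of_nonneg ha]; exact mul_le_mul_of_nonneg_left h.der ha
  rem := by
    rw [← mul_sub, ← mul_sub, abs_mul, abs_of_nonneg ha]
    exact mul_le_mul_of_nonneg_left h.rem ha

theorem neg (h : Jet m₀ m₁ m₂ x x₁ x') : Jet m₀ m₁ m₂ (-x) (-x₁) (-x') where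
  val := by rw [abs_neg]; exact h.val
  der := by rw [abs_neg]; exact h.der
  rem := by
    have e : -x₁ - -x - -x' = -(x₁ - x - x') := by ring
    rw [e, abs_neg]; exact h.rem

theorem sub (h : Jet m₀ m₁ m₂ x x₁ x') (k : Jet l₀ l₁ l₂ y y₁ y') :
    Jet (m₀ + l₀) (m₁ + l₁) (m₂ + l₂) (x - y) (x₁ - y₁) (x' - y') := by
  simpa only [sub_eq_add_neg] using h.add k.neg

theorem mul (h : Jet m₀ m₁ m₂ x x₁ x') (k : Jet l₀ l₁ l₂ y y₁ y') :
    Jet (m₀ * l₀) (m₁ * l₀ + m₀ * l₁) (m₂ * (l₀ + l₁ + l₂) + m₁ * (l₁ + l₂) + m₀ * l₂)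
      (x * y) (x₁ * y₁) (x' * y + x * y') := by
  have a0 := (abs_nonneg _).trans h.val
  have a1 := (abs_nonneg _).trans h.der
  have a2 := (abs_nonneg _).trans h.rem
  have hy1 : |y₁| ≤ l₀ + l₁ + l₂ := by
    have := abs_add_le y (y₁ - y)
    rw [add_sub_cancel] at this
    linarith [k.val, k.diff_le]
  refine ⟨?_, (abs_add_le _ _).trans (add_le_add ?_ ?_), ?_⟩
  · rw [abs_mul]; exact mul_le_mul h.val k.val (abs_nonneg _) a0
  · rw [abs_mul]; exact mul_le_mul h.der k.val (abs_nonneg _) a1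
  · rw [abs_mul]; exact mul_le_mul h.val k.der (abs_nonneg _) a0
  · have e : x₁ * y₁ - x * y - (x' * y + x * y')
        = (x₁ - x - x') * y₁ + x' * (y₁ - y) + x * (y₁ - y - y') := by ring
    rw [e]
    refine (abs_add_three _ _ _).trans (add_le_add_three ?_ ?_ ?_) <;> rw [abs_mul]
    · exact mul_le_mul h.rem hy1 (abs_nonneg _) a2
    · exact mul_le_mul h.der k.diff_le (abs_nonneg _) a1
    · exact mul_le_mul h.val k.rem (abs_nonneg _) a0

/-- The product of a quantity with an expansion of second order in `η` and a bounded one. -/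
theorem mul_bounded {η K A Q M : ℝ} (hη : 0 < η) (hη1 : η ≤ 1) (hK : 1 ≤ K) (hA : 0 ≤ A)
    (hQM : η ^ 2 * Q ≤ M) (hM : 0 ≤ M)
    (h : Jet (A * Q) (A * M / η) (A * M) x x₁ x') (k : Jet K (K * η) (K * η ^ 2) y y₁ y') :
    Jet (A * K * Q) (2 * A * K * M / η) (6 * A * K * M) (x * y) (x₁ * y₁) (x' * y + x * y') := by
  have hQ : 0 ≤ A * Q := (abs_nonneg _).trans h.val
  have hη2 : η ^ 2 ≤ 1 := by nlinarith
  refine (h.mul k).mono (by linarith) ?_ ?_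
  · have : A * Q * (K * η) ≤ A * K * M / η := by
      rw [le_div_iff₀ hη]
      calc A * Q * (K * η) * η = A * K * (η ^ 2 * Q) := by ring
        _ ≤ A * K * M := by gcongr
    calc _ ≤ A * M / η * K + A * K * M / η := by linarith
      _ = _ := by ring
  · have e1 : A * M * (K + K * η + K * η ^ 2) ≤ 3 * (A * K * M) := by
      calc A * M * (K + K * η + K * η ^ 2) ≤ A * M * (K + K * 1 + K * 1) := by gcongr
        _ = _ := by ring
    have e2 : A * M / η * (K * η + K * η ^ 2) ≤ 2 * (A * K * M) := by
      have : A * M / η * (K * η + K * η ^ 2) = A * K * M * (1 + η) := by field_simp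
      rw [this]
      have : 0 ≤ A * K * M := by positivity
      nlinarith
    have e3 : A * Q * (K * η ^ 2) ≤ A * K * M := by
      calc A * Q * (K * η ^ 2) = A * K * (η ^ 2 * Q) := by ring
        _ ≤ A * K * M := by gcongr
    linarith

end Jet

/-! ### Expansion of the norm -/

section Norm

variable {V : Type*} [NormedAddCommGroup V] [InnerProductSpace ℝ V]

/-- The derivative of the norm at `a` in direction `h`. -/
noncomputable def dnorm (a h : V) : ℝ := inner ℝ a h / ‖a‖

theorem abs_dnorm_le (a h : V) : |dnorm a h| ≤ ‖h‖ := by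
  unfold dnorm
  rw [abs_div, abs_norm]
  exact div_le_of_le_mul₀ (norm_nonneg _) (norm_nonneg _)
    ((abs_real_inner_le_norm a h).trans_eq (mul_comm _ _))

theorem dnorm_add_right (a h k : V) : dnorm a (h + k) = dnorm a h + dnorm a k := by
  unfold dnorm; rw [inner_add_right, add_div]

theorem dnorm_sub_right (a h k : V) : dnorm a (h - k) = dnorm a h - dnorm a k := by
  unfold dnorm; rw [inner_sub_right, sub_div]

theorem dnorm_smul_right (a h : V) (t : ℝ) : dnorm a (t • h) = t * dnorm a h := by
  unfold dnorm; rw [inner_smul_right, mul_div_assoc]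

theorem abs_dnorm_sub_le {c : ℝ} (hc : 0 < c) {a b : V} (ha : c ≤ ‖a‖) (hb : c ≤ ‖b‖) (h k : V) :
    |dnorm a h - dnorm b k| ≤ ‖h - k‖ + 2 / c * ‖k‖ * ‖a - b‖ := by
  have ha0 : 0 < ‖a‖ := hc.trans_le ha
  have hb0 : 0 < ‖b‖ := hc.trans_le hb
  have e : dnorm a h - dnorm b k
      = dnorm a (h - k) + (inner ℝ (a - b) k / ‖a‖ + dnorm b k * (‖b‖ - ‖a‖) / ‖a‖) := by
    rw [dnorm_sub_right]
    unfold dnorm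
    rw [inner_sub_left]
    field_simp
    ring
  have h1 : |inner ℝ (a - b) k / ‖a‖| ≤ ‖a - b‖ * ‖k‖ / c := by
    rw [abs_div, abs_norm]
    gcongr
    exact abs_real_inner_le_norm _ _
  have h2 : |dnorm b k * (‖b‖ - ‖a‖) / ‖a‖| ≤ ‖k‖ * ‖a - b‖ / c := by
    rw [abs_div, abs_norm, abs_mul]
    gcongr
    · exact abs_dnorm_le _ _
    · rw [norm_sub_rev a b]; exact abs_norm_sub_norm_le _ _
  rw [e]
  calc _ ≤ |dnorm a (h - k)| + |inner ℝ (a - b) k / ‖a‖ + dnorm b k * (‖b‖ - ‖a‖) / ‖a‖| :=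
        abs_add_le _ _
    _ ≤ ‖h - k‖ + (‖a - b‖ * ‖k‖ / c + ‖k‖ * ‖a - b‖ / c) :=
        add_le_add (abs_dnorm_le _ _) ((abs_add_le _ _).trans (add_le_add h1 h2))
    _ = _ := by ring

theorem norm_add_sub_norm_sub_dnorm {a h : V} (ha : a ≠ 0) :
    (‖a + h‖ - ‖a‖ - dnorm a h) * (‖a + h‖ + ‖a‖ + dnorm a h) = ‖h‖ ^ 2 - dnorm a h ^ 2 := by
  have h1 : dnorm a h * ‖a‖ = inner ℝ a h := div_mul_cancel₀ _ (norm_ne_zero_iff.2 ha)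
  have h2 := norm_add_sq_real a h
  linear_combination h2 - 2 * h1

theorem le_norm_add_add {c : ℝ} {a h : V} (ha : c ≤ ‖a‖) (hh : ‖h‖ ≤ c / 2) :
    c ≤ ‖a + h‖ + ‖a‖ + dnorm a h := by
  have h1 := neg_abs_le (dnorm a h)
  have h2 := abs_dnorm_le a h
  have h3 := norm_sub_le (a + h) h
  rw [add_sub_cancel_right] at h3
  linarith

theorem norm_add_remainder {c : ℝ} (hc : 0 < c) {a h : V} (ha : c ≤ ‖a‖) (hh : ‖h‖ ≤ c / 2) :
    ‖a + h‖ - ‖a‖ - dnorm a h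
      = (‖h‖ ^ 2 - dnorm a h ^ 2) / (‖a + h‖ + ‖a‖ + dnorm a h) := by
  have := le_norm_add_add ha hh
  rw [eq_div_iff (by linarith)]
  exact norm_add_sub_norm_sub_dnorm (norm_pos_iff.1 (hc.trans_le ha))

theorem abs_sq_sub_dnorm_sq_le (a h : V) : |‖h‖ ^ 2 - dnorm a h ^ 2| ≤ ‖h‖ ^ 2 := by
  have := sq_le_sq' (abs_le.1 (abs_dnorm_le a h)).1 (abs_le.1 (abs_dnorm_le a h)).2
  rw [abs_of_nonneg (by linarith)]
  nlinarith [sq_nonneg (dnorm a h)]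

theorem jet_norm {c C η : ℝ} (hc : 0 < c) {a h : V} (ha : c ≤ ‖a‖) (hC : ‖a‖ ≤ C)
    (hh : ‖h‖ ≤ η) (hη : η ≤ c / 2) :
    Jet C η (η ^ 2 / c) ‖a‖ ‖a + h‖ (dnorm a h) := by
  refine ⟨by rwa [abs_norm], (abs_dnorm_le _ _).trans hh, ?_⟩
  have h1 := le_norm_add_add ha (hh.trans hη)
  rw [norm_add_remainder hc ha (hh.trans hη), abs_div, abs_of_pos (hc.trans_le h1)]
  have h2 := abs_sq_sub_dnorm_sq_le a h
  gcongr
  exact h2.trans (by gcongr)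

/-- The remainder of the expansion of the norm depends in a Lipschitz way on the data. -/
theorem norm_remainder_diff_le {c η : ℝ} (hc : 0 < c) (hc1 : c ≤ 1) {a b h k : V}
    (ha : c ≤ ‖a‖) (hb : c ≤ ‖b‖) (hh : ‖h‖ ≤ η) (hk : ‖k‖ ≤ η) (hη : η ≤ c / 2) :
    |(‖a + h‖ - ‖a‖ - dnorm a h) - (‖b + k‖ - ‖b‖ - dnorm b k)|
      ≤ 5 * (η / c) * ‖h - k‖ + 7 * (η / c) ^ 2 * ‖a - b‖ := by
  have hη0 : 0 ≤ η := (norm_nonneg _).trans hh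
  have hκ : η / c ≤ 1 / 2 := by rw [div_le_iff₀ hc]; linarith
  have hκ0 : 0 ≤ η / c := by positivity
  have hηκ : η ≤ η / c := by rw [le_div_iff₀ hc]; nlinarith
  have h1 := le_norm_add_add ha (hh.trans hη)
  have h2 := le_norm_add_add hb (hk.trans hη)
  have hd : |dnorm a h - dnorm b k| ≤ ‖h - k‖ + 2 * (η / c) * ‖a - b‖ := by
    refine (abs_dnorm_sub_le hc ha hb h k).trans ?_
    have : 2 / c * ‖k‖ ≤ 2 * (η / c) := by
      rw [mul_div_assoc', div_mul_eq_mul_div]; gcongr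
    gcongr
  rw [norm_add_remainder hc ha (hh.trans hη), norm_add_remainder hc hb (hk.trans hη)]
  set D₁ := ‖a + h‖ + ‖a‖ + dnorm a h with hD₁
  set D₂ := ‖b + k‖ + ‖b‖ + dnorm b k with hD₂
  set N₁ := ‖h‖ ^ 2 - dnorm a h ^ 2 with hN₁
  set N₂ := ‖k‖ ^ 2 - dnorm b k ^ 2 with hN₂
  set δ := ‖a - b‖ with hδ
  set ε := ‖h - k‖ with hε
  have hδ0 : 0 ≤ δ := norm_nonneg _
  have hε0 : 0 ≤ ε := norm_nonneg _
  have hN : |N₁ - N₂| ≤ 4 * η * ε + 4 * η * (η / c) * δ := by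
    have e : N₁ - N₂ = (‖h‖ - ‖k‖) * (‖h‖ + ‖k‖)
        - (dnorm a h - dnorm b k) * (dnorm a h + dnorm b k) := by
      rw [hN₁, hN₂]; ring
    have b1 : |(‖h‖ - ‖k‖) * (‖h‖ + ‖k‖)| ≤ ε * (2 * η) := by
      rw [abs_mul]
      gcongr
      · exact abs_norm_sub_norm_le _ _
      · rw [abs_of_nonneg (by positivity)]; linarith
    have b2 : |(dnorm a h - dnorm b k) * (dnorm a h + dnorm b k)|
        ≤ (ε + 2 * (η / c) * δ) * (2 * η) := by
      rw [abs_mul]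
      gcongr
      refine (abs_add_le _ _).trans ?_
      linarith [abs_dnorm_le a h, abs_dnorm_le b k]
    rw [e]
    refine (abs_sub _ _).trans ((add_le_add b1 b2).trans_eq ?_)
    ring
  have hD : |D₂ - D₁| ≤ 3 * δ + 2 * ε := by
    have e : D₂ - D₁ = -((‖a + h‖ - ‖b + k‖) + (‖a‖ - ‖b‖) + (dnorm a h - dnorm b k)) := by
      rw [hD₁, hD₂]; ring
    have b1 : |‖a + h‖ - ‖b + k‖| ≤ δ + ε := by
      refine (abs_norm_sub_norm_le _ _).trans ?_
      rw [add_sub_add_comm]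
      exact norm_add_le _ _
    have b2 : 2 * (η / c) * δ ≤ δ := by nlinarith
    rw [e, abs_neg]
    refine (abs_add_three _ _ _).trans ?_
    linarith [abs_norm_sub_norm_le a b]
  have hD1 : 0 < D₁ := hc.trans_le h1
  have hD2 : 0 < D₂ := hc.trans_le h2
  have hN2 : |N₂| ≤ η ^ 2 := (abs_sq_sub_dnorm_sq_le b k).trans (by gcongr)
  have e : N₁ / D₁ - N₂ / D₂ = (N₁ - N₂) / D₁ + N₂ * (D₂ - D₁) / (D₁ * D₂) := by
    field_simp; ring
  rw [e]
  calc _ ≤ |(N₁ - N₂) / D₁| + |N₂ * (D₂ - D₁) / (D₁ * D₂)| := abs_add_le _ _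
    _ ≤ (4 * η * ε + 4 * η * (η / c) * δ) / c + η ^ 2 * (3 * δ + 2 * ε) / (c * c) := by
        rw [abs_div, abs_div, abs_mul, abs_mul, abs_of_pos hD1, abs_of_pos hD2]
        gcongr
    _ = 4 * (η / c) * ε + 2 * (η / c) * (η / c) * ε + 7 * (η / c) ^ 2 * δ := by
        field_simp; ring
    _ ≤ 4 * (η / c) * ε + 2 * (η / c) * (1 / 2) * ε + 7 * (η / c) ^ 2 * δ := by gcongr
    _ = _ := by ring

/-- The expansion of `‖a‖ ‖b‖ - ⟨a, b⟩`, which vanishes to second order at `a = b`: value, first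
order change and remainder are quadratic in the differences `a - b` and `h - k`. -/
theorem jet_norm_mul_norm_sub_inner {c η : ℝ} (hc : 0 < c) (hc1 : c ≤ 1) {a b h k : V}
    (ha : c ≤ ‖a‖) (hb : c ≤ ‖b‖) (hh : ‖h‖ ≤ η) (hk : ‖k‖ ≤ η) (hη0 : 0 < η) (hη : η ≤ c / 2) :
    Jet (40 / c ^ 2 * ‖a - b‖ ^ 2) (40 / c ^ 2 * (‖h - k‖ ^ 2 + η ^ 2 * ‖a - b‖ ^ 2) / η)
      (40 / c ^ 2 * (‖h - k‖ ^ 2 + η ^ 2 * ‖a - b‖ ^ 2))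
      (‖a‖ * ‖b‖ - inner ℝ a b) (‖a + h‖ * ‖b + k‖ - inner ℝ (a + h) (b + k))
      (dnorm a h * ‖b‖ + ‖a‖ * dnorm b k - inner ℝ h b - inner ℝ a k) := by
  have hK : 1 ≤ 1 / c := by rw [le_div_iff₀ hc]; linarith
  have hκ : η / c ≤ 1 / 2 := by rw [div_le_iff₀ hc]; linarith
  have hκ0 : 0 ≤ η / c := by positivity
  have hR := norm_remainder_diff_le hc hc1 ha hb hh hk hη
  have hd : |dnorm a h - dnorm b k| ≤ ‖h - k‖ + 2 * (η / c) * ‖a - b‖ := by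
    refine (abs_dnorm_sub_le hc ha hb h k).trans ?_
    have : 2 / c * ‖k‖ ≤ 2 * (η / c) := by
      rw [mul_div_assoc', div_mul_eq_mul_div]; gcongr
    gcongr
  have hv : |‖a‖ - ‖b‖| ≤ ‖a - b‖ := abs_norm_sub_norm_le _ _
  have hin : |inner ℝ (a - b) (h - k)| ≤ ‖a - b‖ * ‖h - k‖ := abs_real_inner_le_norm _ _
  have q1 := norm_sub_sq_real a b
  have q2 := norm_sub_sq_real (a + h) (b + k)
  have q3 : ‖(a + h) - (b + k)‖ ^ 2
      = ‖a - b‖ ^ 2 + 2 * inner ℝ (a - b) (h - k) + ‖h - k‖ ^ 2 := by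
    rw [add_sub_add_comm, norm_add_sq_real]
  have hda : dnorm a h * ‖a‖ = inner ℝ a h :=
    div_mul_cancel₀ _ (hc.trans_le ha).ne'
  have hdb : dnorm b k * ‖b‖ = inner ℝ b k :=
    div_mul_cancel₀ _ (hc.trans_le hb).ne'
  have hinner : inner ℝ (a - b) (h - k)
      = inner ℝ a h - inner ℝ a k - inner ℝ h b + inner ℝ b k := by
    rw [inner_sub_left, inner_sub_right, inner_sub_right, real_inner_comm b h]; ring
  set δ := ‖a - b‖ with hδ
  set ε := ‖h - k‖ with hε
  set κ := η / c with hκd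
  set ρ := ‖a‖ - ‖b‖ with hρ
  set ρ' := dnorm a h - dnorm b k with hρ'
  set r := (‖a + h‖ - ‖a‖ - dnorm a h) - (‖b + k‖ - ‖b‖ - dnorm b k) with hr
  have hδ0 : 0 ≤ δ := norm_nonneg _
  have hε0 : 0 ≤ ε := norm_nonneg _
  have hηκ : η = c * κ := by rw [hκd]; field_simp
  have e40 : 40 / c ^ 2 * (ε ^ 2 + η ^ 2 * δ ^ 2)
      = 40 * ((1 / c) ^ 2 * ε ^ 2) + 40 * (κ * δ) ^ 2 := by
    rw [hκd]; field_simp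
  have hK2 : ε ^ 2 ≤ (1 / c) ^ 2 * ε ^ 2 := by
    have : (1 : ℝ) ≤ (1 / c) ^ 2 := one_le_pow₀ hK
    nlinarith [sq_nonneg ε]
  have hp : ‖a‖ * ‖b‖ - inner ℝ a b = (δ ^ 2 - ρ ^ 2) / 2 := by rw [q1, hρ]; ring
  have hp' : dnorm a h * ‖b‖ + ‖a‖ * dnorm b k - inner ℝ h b - inner ℝ a k
      = inner ℝ (a - b) (h - k) - ρ * ρ' := by
    rw [hinner, hρ, hρ']; linear_combination hda + hdb
  have hκδ : 0 ≤ κ * δ := by positivity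
  have hρ2 : ρ ^ 2 ≤ δ ^ 2 := sq_le_sq' (abs_le.1 hv).1 (abs_le.1 hv).2
  refine ⟨?_, ?_, ?_⟩
  · rw [hp, abs_of_nonneg (by linarith)]
    have h1 : (1 : ℝ) ≤ 40 / c ^ 2 := by
      rw [le_div_iff₀ (by positivity)]
      linarith [pow_le_one₀ (n := 2) hc.le hc1]
    calc (δ ^ 2 - ρ ^ 2) / 2 ≤ 1 * δ ^ 2 := by linarith [sq_nonneg ρ, sq_nonneg δ]
      _ ≤ _ := by gcongr
  · rw [hp', le_div_iff₀ hη0, e40]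
    have h1 : |inner ℝ (a - b) (h - k) - ρ * ρ'| ≤ δ * ε + δ * (ε + 2 * κ * δ) := by
      refine (abs_sub _ _).trans (add_le_add hin ?_)
      rw [abs_mul]; gcongr
    calc _ ≤ (δ * ε + δ * (ε + 2 * κ * δ)) * η := by gcongr
      _ = c * (2 * ((κ * δ) * ε) + 2 * (κ * δ) ^ 2) := by rw [hηκ]; ring
      _ ≤ 1 * (2 * ((κ * δ) * ε) + 2 * (κ * δ) ^ 2) := by gcongr
      _ ≤ _ := by
        have b5 : (κ * δ) * ε ≤ ((κ * δ) ^ 2 + ε ^ 2) / 2 := by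
          linarith [sq_nonneg (κ * δ - ε), sub_sq (κ * δ) ε]
        linarith [sq_nonneg (κ * δ), sq_nonneg ε]
  · have er : ‖a + h‖ * ‖b + k‖ - inner ℝ (a + h) (b + k) - (‖a‖ * ‖b‖ - inner ℝ a b)
        - (dnorm a h * ‖b‖ + ‖a‖ * dnorm b k - inner ℝ h b - inner ℝ a k)
        = ε ^ 2 / 2 - ρ * r - (ρ' + r) ^ 2 / 2 := by
      rw [hp, hp']
      have : ‖a + h‖ - ‖b + k‖ = ρ + ρ' + r := by rw [hρ, hρ', hr]; ring
      have h2 : ‖a + h‖ * ‖b + k‖ - inner ℝ (a + h) (b + k)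
          = (‖(a + h) - (b + k)‖ ^ 2 - (‖a + h‖ - ‖b + k‖) ^ 2) / 2 := by rw [q2]; ring
      rw [h2, q3, this]; ring
    rw [er, e40]
    have b1 : |ρ * r| ≤ δ * (5 * κ * ε + 7 * κ ^ 2 * δ) := by rw [abs_mul]; gcongr
    have b2 : |ρ' + r| ≤ 4 * ε + 6 * (κ * δ) := by
      have b0 : κ ^ 2 * δ ≤ 1 / 2 * (κ * δ) := by
        calc κ ^ 2 * δ = κ * (κ * δ) := by ring
          _ ≤ _ := by gcongr
      have b1' : κ * ε ≤ 1 / 2 * ε := by gcongr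
      have := abs_add_le ρ' r
      linarith
    have b3 : (ρ' + r) ^ 2 ≤ (4 * ε + 6 * (κ * δ)) ^ 2 :=
      sq_le_sq' (abs_le.1 b2).1 (abs_le.1 b2).2
    have b4 : |ρ * r| ≤ 5 * (κ * δ) * ε + 7 * (κ * δ) ^ 2 := b1.trans_eq (by ring)
    have b5 : (κ * δ) * ε ≤ ((κ * δ) ^ 2 + ε ^ 2) / 2 := by
      linarith [sq_nonneg (κ * δ - ε), sub_sq (κ * δ) ε]
    have b6 : (ρ' + r) ^ 2 ≤ 16 * ε ^ 2 + 48 * ((κ * δ) * ε) + 36 * (κ * δ) ^ 2 :=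
      b3.trans_eq (by ring)
    have b7 := abs_le.1 b4
    have b8 := sq_nonneg (ρ' + r)
    have b9 := sq_nonneg (κ * δ)
    have b10 := sq_nonneg ε
    rw [abs_le]
    constructor <;> linarith

end Norm

/-! ### Speed and chord of a path -/

section Path

theorem continuous_integral_right {F : ℝ → ℝ → ℝ} (hF : Continuous (Function.uncurry F)) :
    Continuous fun s => ∫ t in (0 : ℝ)..1, F s t :=
  intervalIntegral.continuous_parametric_intervalIntegral_of_continuous' hF 0 1

theorem integral_integral_add {F G : ℝ → ℝ → ℝ} (hF : Continuous (Function.uncurry F))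
    (hG : Continuous (Function.uncurry G)) :
    ∫ s in (0 : ℝ)..1, ∫ t in (0 : ℝ)..1, (F s t + G s t)
      = (∫ s in (0 : ℝ)..1, ∫ t in (0 : ℝ)..1, F s t)
        + ∫ s in (0 : ℝ)..1, ∫ t in (0 : ℝ)..1, G s t := by
  have hF' : ∀ s, Continuous (F s) := fun s => hF.comp (by fun_prop : Continuous fun t => (s, t))
  have hG' : ∀ s, Continuous (G s) := fun s => hG.comp (by fun_prop : Continuous fun t => (s, t))
  rw [← intervalIntegral.integral_add ((continuous_integral_right hF).intervalIntegrable _ _)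
    ((continuous_integral_right hG).intervalIntegrable _ _)]
  congr 1
  ext s
  rw [intervalIntegral.integral_add ((hF' s).intervalIntegrable _ _)
    ((hG' s).intervalIntegrable _ _)]

theorem integral_integral_neg (F : ℝ → ℝ → ℝ) :
    ∫ s in (0 : ℝ)..1, ∫ t in (0 : ℝ)..1, -F s t
      = -∫ s in (0 : ℝ)..1, ∫ t in (0 : ℝ)..1, F s t := by
  simp only [intervalIntegral.integral_neg]

theorem integral_integral_sub {F G : ℝ → ℝ → ℝ} (hF : Continuous (Function.uncurry F))
    (hG : Continuous (Function.uncurry G)) :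
    ∫ s in (0 : ℝ)..1, ∫ t in (0 : ℝ)..1, (F s t - G s t)
      = (∫ s in (0 : ℝ)..1, ∫ t in (0 : ℝ)..1, F s t)
        - ∫ s in (0 : ℝ)..1, ∫ t in (0 : ℝ)..1, G s t := by
  simp only [sub_eq_add_neg]
  rw [← integral_integral_neg G]
  exact integral_integral_add hF hG.neg

theorem abs_integral_integral_le {F G : ℝ → ℝ → ℝ}
    (hG : Continuous (Function.uncurry G)) (h : ∀ s t, |F s t| ≤ G s t) :
    |∫ s in (0 : ℝ)..1, ∫ t in (0 : ℝ)..1, F s t| ≤ ∫ s in (0 : ℝ)..1, ∫ t in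
      (0 : ℝ)..1, G s t := by
  have hG' : ∀ s, Continuous (G s) := fun s => hG.comp (by fun_prop : Continuous fun t => (s, t))
  refine intervalIntegral.norm_integral_le_of_norm_le (f := fun s => ∫ t in (0 : ℝ)..1, F s t)
    zero_le_one (Eventually.of_forall fun s _ => ?_)
    ((continuous_integral_right hG).intervalIntegrable _ _)
  exact intervalIntegral.norm_integral_le_of_norm_le (f := fun t => F s t)
    zero_le_one (Eventually.of_forall fun t _ => h s t) ((hG' s).intervalIntegrable _ _)

theorem integral_integral_mul (f g : ℝ → ℝ) :
    ∫ s in (0 : ℝ)..1, ∫ t in (0 : ℝ)..1, f s * g t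
      = (∫ s in (0 : ℝ)..1, f s) * ∫ t in (0 : ℝ)..1, g t := by
  simp only [intervalIntegral.integral_const_mul, intervalIntegral.integral_mul_const]

variable {V : Type*} [NormedAddCommGroup V] [InnerProductSpace ℝ V]

theorem integral_integral_inner [CompleteSpace V] {x y : ℝ → V} (hx : Continuous x)
    (hy : Continuous y) :
    ∫ s in (0 : ℝ)..1, ∫ t in (0 : ℝ)..1, inner ℝ (x s) (y t)
      = inner ℝ (∫ s in (0 : ℝ)..1, x s) (∫ t in (0 : ℝ)..1, y t) := by
  have h1 : ∀ s, ∫ t in (0 : ℝ)..1, inner ℝ (x s) (y t)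
      = inner ℝ (∫ t in (0 : ℝ)..1, y t) (x s) := fun s => by
    rw [real_inner_comm]
    exact (innerSL ℝ (x s)).intervalIntegral_comp_comm (hy.intervalIntegrable 0 1)
  simp only [h1]
  rw [real_inner_comm]
  exact (innerSL ℝ (∫ t in (0 : ℝ)..1, y t)).intervalIntegral_comp_comm
    (hx.intervalIntegrable 0 1)

theorem continuous_dnorm {X : Type*} [TopologicalSpace X] {x κ : X → V} (hx : Continuous x)
    (hκ : Continuous κ) (h0 : ∀ s, x s ≠ 0) : Continuous fun s => dnorm (x s) (κ s) :=
  (hx.inner hκ).div hx.norm fun s => norm_ne_zero_iff.2 (h0 s)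

/-- The squared length of a path minus the squared length of its chord, expressed through the
second-order quantity `‖a‖ ‖b‖ - ⟨a, b⟩`. -/
theorem speed_sq_sub_chord_sq [CompleteSpace V] {x : ℝ → V} (hx : Continuous x) :
    (∫ s in (0 : ℝ)..1, ‖x s‖) ^ 2 - ‖∫ s in (0 : ℝ)..1, x s‖ ^ 2
      = ∫ s in (0 : ℝ)..1, ∫ t in (0 : ℝ)..1, (‖x s‖ * ‖x t‖ - inner ℝ (x s) (x t)) := by
  rw [integral_integral_sub (by unfold Function.uncurry; fun_prop)
    (by unfold Function.uncurry; fun_prop), integral_integral_mul, integral_integral_inner hx hx,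
    real_inner_self_eq_norm_sq, sq]

theorem integral_integral_sq_sub_le {E : Type*} [NormedAddCommGroup E] {x : ℝ → E}
    (hx : Continuous x) :
    ∫ s in (0 : ℝ)..1, ∫ t in (0 : ℝ)..1, ‖x s - x t‖ ^ 2
      ≤ 4 * ∫ s in (0 : ℝ)..1, ‖x s - x 0‖ ^ 2 := by
  have h := abs_integral_integral_le (F := fun s t => ‖x s - x t‖ ^ 2)
    (G := fun s t => 2 * ‖x s - x 0‖ ^ 2 * 1 + 1 * (2 * ‖x t - x 0‖ ^ 2))
    (by unfold Function.uncurry; fun_prop) fun s t => by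
      rw [abs_of_nonneg (by positivity)]
      have e : x s - x t = (x s - x 0) - (x t - x 0) := by abel
      have h1 : ‖x s - x t‖ ≤ ‖x s - x 0‖ + ‖x t - x 0‖ := by rw [e]; exact norm_sub_le _ _
      have h2 : ‖x s - x t‖ ^ 2 ≤ (‖x s - x 0‖ + ‖x t - x 0‖) ^ 2 := by gcongr
      linarith [sq_nonneg (‖x s - x 0‖ - ‖x t - x 0‖), sub_sq ‖x s - x 0‖ ‖x t - x 0‖,
        add_sq ‖x s - x 0‖ ‖x t - x 0‖]
  refine (le_abs_self _).trans (h.trans_eq ?_)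
  rw [integral_integral_add (F := fun s t => 2 * ‖x s - x 0‖ ^ 2 * 1)
    (G := fun s t => 1 * (2 * ‖x t - x 0‖ ^ 2)) (by unfold Function.uncurry; fun_prop)
    (by unfold Function.uncurry; fun_prop), integral_integral_mul (fun s => 2 * ‖x s - x 0‖ ^ 2),
    integral_integral_mul (fun _ => 1)]
  simp only [intervalIntegral.integral_const_mul, intervalIntegral.integral_const]
  simp
  ring

theorem jet_speed {c C η : ℝ} (hc : 0 < c) {x κ : ℝ → V} (hx : Continuous x) (hκ : Continuous κ)
    (hxc : ∀ s, c ≤ ‖x s‖) (hxC : ∀ s, ‖x s‖ ≤ C) (hκη : ∀ s, ‖κ s‖ ≤ η) (hη : η ≤ c / 2) :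
    Jet C η (η ^ 2 / c) (∫ s in (0 : ℝ)..1, ‖x s‖) (∫ s in (0 : ℝ)..1, ‖x s + κ s‖)
      (∫ s in (0 : ℝ)..1, dnorm (x s) (κ s)) := by
  have hJ := fun s => jet_norm hc (hxc s) (hxC s) (hκη s) hη
  have hd : Continuous fun s => dnorm (x s) (κ s) :=
    continuous_dnorm hx hκ fun s => norm_pos_iff.1 (hc.trans_le (hxc s))
  have key : ∀ {f : ℝ → ℝ} {B : ℝ}, (∀ s, |f s| ≤ B) → |∫ s in (0 : ℝ)..1, f s| ≤ B :=
    fun {f B} h => by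
      have := intervalIntegral.norm_integral_le_of_norm_le_const (a := 0) (b := 1) (f := f)
        (C := B) fun s _ => h s
      simpa using this
  refine ⟨key fun s => (hJ s).val, key fun s => (hJ s).der, ?_⟩
  have i1 : Continuous fun s => ‖x s + κ s‖ := by fun_prop
  have i2 : Continuous fun s => ‖x s + κ s‖ - ‖x s‖ := by fun_prop
  rw [← intervalIntegral.integral_sub (i1.intervalIntegrable _ _)
    (hx.norm.intervalIntegrable _ _), ← intervalIntegral.integral_sub
    (i2.intervalIntegrable _ _) (hd.intervalIntegrable _ _)]
  exact key fun s => (hJ s).rem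

theorem jet_chord_sq {C η : ℝ} {x κ : ℝ → V} (hx : Continuous x) (hκ : Continuous κ)
    (hxC : ∀ s, ‖x s‖ ≤ C) (hκη : ∀ s, ‖κ s‖ ≤ η) :
    Jet (C ^ 2) (2 * C * η) (η ^ 2) (‖∫ s in (0 : ℝ)..1, x s‖ ^ 2)
      (‖∫ s in (0 : ℝ)..1, (x s + κ s)‖ ^ 2)
      (2 * inner ℝ (∫ s in (0 : ℝ)..1, x s) (∫ s in (0 : ℝ)..1, κ s)) := by
  have key : ∀ {f : ℝ → V} {B : ℝ}, (∀ s, ‖f s‖ ≤ B) → ‖∫ s in (0 : ℝ)..1, f s‖ ≤ B :=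
    fun {f B} h => by
      have := intervalIntegral.norm_integral_le_of_norm_le_const (a := 0) (b := 1) (f := f)
        (C := B) fun s _ => h s
      simpa using this
  have h1 := key hxC
  have h2 := key hκη
  rw [intervalIntegral.integral_add (hx.intervalIntegrable _ _) (hκ.intervalIntegrable _ _),
    norm_add_sq_real]
  refine ⟨?_, ?_, ?_⟩
  · rw [abs_of_nonneg (by positivity)]; gcongr
  · rw [abs_mul, abs_two, mul_assoc]
    gcongr
    refine (abs_real_inner_le_norm _ _).trans ?_
    have := (norm_nonneg _).trans h1
    gcongr
  · have e : ∀ a b d : ℝ, a + b + d - a - b = d := fun a b d => by ring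
    rw [e, abs_of_nonneg (by positivity)]
    gcongr

/-- The expansion of the squared length minus the squared chord of a path: value, first-order change
and remainder are quadratic in the oscillations of `x` and of the perturbation `κ`. -/
theorem jet_speed_sq_sub_chord_sq [CompleteSpace V] {c η : ℝ} (hc : 0 < c)
    (hc1 : c ≤ 1) {x κ : ℝ → V}
    (hx : Continuous x) (hκ : Continuous κ) (hxc : ∀ s, c ≤ ‖x s‖) (hκη : ∀ s, ‖κ s‖ ≤ η)
    (hη0 : 0 < η) (hη : η ≤ c / 2) {Q M : ℝ} (hQ : Q = ∫ s in (0 : ℝ)..1, ‖x s - x 0‖ ^ 2)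
    (hM : M = (∫ s in (0 : ℝ)..1, ‖κ s - κ 0‖ ^ 2) + η ^ 2 * Q) :
    Jet (160 / c ^ 2 * Q) (160 / c ^ 2 * M / η) (160 / c ^ 2 * M)
      ((∫ s in (0 : ℝ)..1, ‖x s‖) ^ 2 - ‖∫ s in (0 : ℝ)..1, x s‖ ^ 2)
      ((∫ s in (0 : ℝ)..1, ‖x s + κ s‖) ^ 2 - ‖∫ s in (0 : ℝ)..1, (x s + κ s)‖ ^ 2)
      (2 * (∫ s in (0 : ℝ)..1, ‖x s‖) * (∫ s in (0 : ℝ)..1, dnorm (x s) (κ s))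
        - 2 * inner ℝ (∫ s in (0 : ℝ)..1, x s) (∫ s in (0 : ℝ)..1, κ s)) := by
  have hd : Continuous fun s => dnorm (x s) (κ s) :=
    continuous_dnorm hx hκ fun s => norm_pos_iff.1 (hc.trans_le (hxc s))
  have hJ := fun s t => jet_norm_mul_norm_sub_inner hc hc1 (hxc s) (hxc t) (hκη s) (hκη t) hη0 hη
  -- an opaque name, so that continuity of the integrands is found automatically
  obtain ⟨d, hdd⟩ : ∃ d : ℝ → ℝ, ∀ s, d s = dnorm (x s) (κ s) := ⟨_, fun _ => rfl⟩
  simp only [← hdd] at hd hJ ⊢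
  have hder : 2 * (∫ s in (0 : ℝ)..1, ‖x s‖) * (∫ s in (0 : ℝ)..1, d s)
        - 2 * inner ℝ (∫ s in (0 : ℝ)..1, x s) (∫ s in (0 : ℝ)..1, κ s)
      = ∫ s in (0 : ℝ)..1, ∫ t in (0 : ℝ)..1, (d s * ‖x t‖ + ‖x s‖ * d t
        - inner ℝ (κ s) (x t) - inner ℝ (x s) (κ t)) := by
    rw [integral_integral_sub (by unfold Function.uncurry; fun_prop)
      (by unfold Function.uncurry; fun_prop), integral_integral_sub
      (by unfold Function.uncurry; fun_prop) (by unfold Function.uncurry; fun_prop),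
      integral_integral_add (by unfold Function.uncurry; fun_prop)
      (by unfold Function.uncurry; fun_prop), integral_integral_mul, integral_integral_mul,
      integral_integral_inner hx hκ, integral_integral_inner hκ hx,
      real_inner_comm (∫ s in (0 : ℝ)..1, x s) (∫ s in (0 : ℝ)..1, κ s)]
    ring
  have hQ4 := integral_integral_sq_sub_le hx
  have hκ4 := integral_integral_sq_sub_le hκ
  have hc2 : 0 ≤ 40 / c ^ 2 := by positivity
  have hM4 : ∫ s in (0 : ℝ)..1, ∫ t in (0 : ℝ)..1,
      40 / c ^ 2 * (‖κ s - κ t‖ ^ 2 + η ^ 2 * ‖x s - x t‖ ^ 2) ≤ 160 / c ^ 2 * M := by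
    simp only [intervalIntegral.integral_const_mul]
    rw [integral_integral_add (by unfold Function.uncurry; fun_prop)
      (by unfold Function.uncurry; fun_prop)]
    simp only [intervalIntegral.integral_const_mul]
    rw [← hQ] at hQ4
    calc _ ≤ 40 / c ^ 2 * (4 * (∫ s in (0 : ℝ)..1, ‖κ s - κ 0‖ ^ 2) + η ^ 2 * (4 * Q)) := by gcongr
      _ = _ := by rw [hM]; ring
  rw [speed_sq_sub_chord_sq hx, speed_sq_sub_chord_sq (x := fun s => x s + κ s) (by fun_prop),
    hder]
  refine ⟨?_, ?_, ?_⟩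
  · refine (abs_integral_integral_le (G := fun s t => 40 / c ^ 2 * ‖x s - x t‖ ^ 2)
      (by unfold Function.uncurry; fun_prop)
      fun s t => (hJ s t).val).trans ?_
    simp only [intervalIntegral.integral_const_mul]
    rw [← hQ] at hQ4
    calc _ ≤ 40 / c ^ 2 * (4 * Q) := by gcongr
      _ = _ := by ring
  · refine (abs_integral_integral_le
      (G := fun s t => 40 / c ^ 2 * (‖κ s - κ t‖ ^ 2 + η ^ 2 * ‖x s - x t‖ ^ 2) / η)
      (by unfold Function.uncurry; fun_prop)
      fun s t => (hJ s t).der).trans ?_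
    simp only [intervalIntegral.integral_div]
    gcongr
  · rw [← integral_integral_sub (by unfold Function.uncurry; fun_prop)
      (by unfold Function.uncurry; fun_prop), ← integral_integral_sub
      (by unfold Function.uncurry; fun_prop) (by unfold Function.uncurry; fun_prop)]
    exact (abs_integral_integral_le (by unfold Function.uncurry; fun_prop)
      fun s t => (hJ s t).rem).trans hM4

end Path

/-! ### Composition with powers -/

/-- Taylor's formula of second order, without the factor `1/2`. -/
theorem abs_taylor_two_le {φ φ' φ'' : ℝ → ℝ} {B : ℝ}
    (h1 : ∀ τ ∈ Icc (0 : ℝ) 1, HasDerivAt φ (φ' τ) τ)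
    (h2 : ∀ τ ∈ Icc (0 : ℝ) 1, HasDerivAt φ' (φ'' τ) τ)
    (hB : ∀ τ ∈ Icc (0 : ℝ) 1, |φ'' τ| ≤ B) : |φ 1 - φ 0 - φ' 0| ≤ B := by
  obtain ⟨ξ, hξ, e1⟩ := exists_hasDerivAt_eq_slope φ φ' zero_lt_one
    (fun τ hτ => (h1 τ hτ).continuousAt.continuousWithinAt)
    fun τ hτ => h1 τ (Ioo_subset_Icc_self hτ)
  have hsub : Icc 0 ξ ⊆ Icc (0 : ℝ) 1 := Icc_subset_Icc le_rfl hξ.2.le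
  obtain ⟨ζ, hζ, e2⟩ := exists_hasDerivAt_eq_slope φ' φ'' hξ.1
    (fun τ hτ => (h2 τ (hsub hτ)).continuousAt.continuousWithinAt)
    fun τ hτ => h2 τ (hsub (Ioo_subset_Icc_self hτ))
  have hζ1 := hsub (Ioo_subset_Icc_self hζ)
  rw [sub_zero, div_one] at e1
  rw [sub_zero, eq_div_iff hξ.1.ne'] at e2
  rw [← e1, ← e2, abs_mul, abs_of_pos hξ.1]
  have := hB ζ hζ1
  nlinarith [abs_nonneg (φ'' ζ), hξ.1, hξ.2]

/-- Uniform bounds and Lipschitz constants for `x ↦ x ^ (-β)` and its first two derivatives on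
`[a, ∞)`. -/
structure PowBound (β a K : ℝ) : Prop where
  one_le : 1 ≤ K
  val : ∀ x, a ≤ x → |x ^ (-β)| ≤ K
  der : ∀ x, a ≤ x → |-β * x ^ (-β - 1)| ≤ K
  der_two : ∀ x, a ≤ x → |-β * ((-β - 1) * x ^ (-β - 2))| ≤ K
  lip_zero : ∀ x y, a ≤ x → a ≤ y → |x ^ (-β) - y ^ (-β)| ≤ K * |x - y|
  lip : ∀ x y, a ≤ x → a ≤ y →
    |-β * x ^ (-β - 1) - -β * y ^ (-β - 1)| ≤ K * |x - y|
  lip_two : ∀ x y, a ≤ x → a ≤ y →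
    |-β * ((-β - 1) * x ^ (-β - 2)) - -β * ((-β - 1) * y ^ (-β - 2))| ≤ K * |x - y|

theorem hasDerivAt_rpow_neg (β : ℝ) {x : ℝ} (hx : 0 < x) :
    HasDerivAt (fun x : ℝ => x ^ (-β)) (-β * x ^ (-β - 1)) x :=
  Real.hasDerivAt_rpow_const (Or.inl hx.ne')

theorem hasDerivAt_rpow_neg_two (β : ℝ) {x : ℝ} (hx : 0 < x) :
    HasDerivAt (fun x : ℝ => -β * x ^ (-β - 1)) (-β * ((-β - 1) * x ^ (-β - 2))) x := by
  have h := (Real.hasDerivAt_rpow_const (p := -β - 1) (Or.inl hx.ne')).const_mul (-β)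
  have e : -β - 1 - 1 = -β - 2 := by ring
  rwa [e] at h

theorem exists_powBound (β : ℝ) (hβ : 0 ≤ β) {a : ℝ} (ha : 0 < a) : ∃ K, PowBound β a K := by
  have hmono : ∀ p : ℝ, p ≤ 0 → ∀ x, a ≤ x → |x ^ p| ≤ a ^ p := fun p hp x hx => by
    rw [abs_of_nonneg (Real.rpow_nonneg (ha.le.trans hx) _)]
    exact Real.rpow_le_rpow_of_nonpos ha hx hp
  have hmul : ∀ (q : ℝ) {p : ℝ}, p ≤ 0 → ∀ x, a ≤ x → |q * x ^ p| ≤ |q| * a ^ p :=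
    fun q p hp x hx => by
      rw [abs_mul]; exact mul_le_mul_of_nonneg_left (hmono p hp x hx) (abs_nonneg q)
  have hlip : ∀ (f f' : ℝ → ℝ) (B : ℝ), (∀ x, a ≤ x → HasDerivAt f (f' x) x) →
      (∀ x, a ≤ x → |f' x| ≤ B) → ∀ x y, a ≤ x → a ≤ y → |f x - f y| ≤ B * |x - y| :=
    fun f f' B h1 h2 x y hx hy =>
      (convex_Ici a).norm_image_sub_le_of_norm_hasDerivWithin_le (f := f) (f' := f')
        (fun z hz => (h1 z hz).hasDerivWithinAt) (fun z hz => h2 z hz) hy hx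
  set K₀ := a ^ (-β)
  set K₁ := |-β| * a ^ (-β - 1)
  set K₂ := |-β * (-β - 1)| * a ^ (-β - 2)
  set K₃ := |-β * (-β - 1) * (-β - 2)| * a ^ (-β - 3)
  have k0 : 0 ≤ K₀ := by positivity
  have k1 : 0 ≤ K₁ := by positivity
  have k2 : 0 ≤ K₂ := by positivity
  have k3 : 0 ≤ K₃ := by positivity
  have b2 : ∀ x, a ≤ x → |-β * ((-β - 1) * x ^ (-β - 2))| ≤ K₂ := fun x hx => by
    rw [← mul_assoc]; exact hmul _ (by linarith) x hx
  refine ⟨1 + K₀ + K₁ + K₂ + K₃, by linarith, fun x hx => ?_, fun x hx => ?_, fun x hx => ?_,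
    fun x y hx hy => ?_, fun x y hx hy => ?_, fun x y hx hy => ?_⟩
  · linarith [hmono (-β) (by linarith) x hx]
  · linarith [hmul (-β) (p := -β - 1) (by linarith) x hx]
  · linarith [b2 x hx]
  · refine (hlip _ _ K₁ (fun x hx => hasDerivAt_rpow_neg β (ha.trans_le hx))
      (hmul _ (by linarith)) x y hx hy).trans ?_
    gcongr
    linarith
  · refine (hlip _ _ K₂ (fun x hx => hasDerivAt_rpow_neg_two β
      (ha.trans_le hx)) b2 x y hx hy).trans ?_
    gcongr
    linarith
  · refine (hlip (fun x => -β * ((-β - 1) * x ^ (-β - 2)))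
      (fun x => -β * (-β - 1) * (-β - 2) * x ^ (-β - 3)) K₃ (fun x hx => ?_)
      (fun x hx => hmul _ (by linarith) x hx) x y hx hy).trans ?_
    · have h := ((Real.hasDerivAt_rpow_const (p := -β - 2)
        (Or.inl (ha.trans_le hx).ne')).const_mul (-β - 1)).const_mul (-β)
      have e : -β - 2 - 1 = -β - 3 := by ring
      rw [e] at h
      exact h.congr_deriv (by ring)
    · gcongr
      linarith

theorem abs_add_mul_le_of_mem_Icc {a b τ : ℝ} (hτ : τ ∈ Icc (0 : ℝ) 1) :
    |a + τ * b| ≤ |a| + |b| := by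
  refine (abs_add_le _ _).trans ?_
  rw [abs_mul, abs_of_nonneg hτ.1]
  nlinarith [abs_nonneg b, hτ.2]

theorem le_segment {a y y₁ τ : ℝ} (hy : a ≤ y) (hy₁ : a ≤ y₁) (hτ : τ ∈ Icc (0 : ℝ) 1) :
    a ≤ y + τ * (y₁ - y) := by
  have h : y + τ * (y₁ - y) = (1 - τ) * y + τ * y₁ := by ring
  have h1 : (1 - τ) * a ≤ (1 - τ) * y := mul_le_mul_of_nonneg_left hy (by linarith [hτ.2])
  have h2 : τ * a ≤ τ * y₁ := mul_le_mul_of_nonneg_left hy₁ hτ.1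
  linarith

theorem hasDerivAt_segment (y d τ : ℝ) : HasDerivAt (fun τ : ℝ => y + τ * d) d τ := by
  simpa using ((hasDerivAt_id τ).mul_const d).const_add y

theorem Jet.diff_le_two {A η l x x₁ x' : ℝ} (hA : 0 ≤ A) (hη : 0 ≤ η) (hη1 : η ≤ 1)
    (h : Jet l (A * η) (A * η ^ 2) x x₁ x') : |x₁ - x| ≤ 2 * A * η := by
  have h1 : η ^ 2 ≤ η := by nlinarith
  have h2 : A * η ^ 2 ≤ A * η := by gcongr
  linarith [h.diff_le]

/-- If `z - y` is of second order, so is the difference of powers `y ^ (-β) - z ^ (-β)`. -/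
theorem jet_rpow_sub {β a K A η Q M y y₁ y' z z₁ z' l m : ℝ} (ha : 0 < a) (hP : PowBound β a K)
    (hA : 1 ≤ A) (hη : 0 < η) (hη1 : η ≤ 1) (hQM : η ^ 2 * Q ≤ M)
    (hy : Jet l (A * η) (A * η ^ 2) y y₁ y') (hz : Jet m (A * η) (A * η ^ 2) z z₁ z')
    (hd : Jet (A * Q) (A * M / η) (A * M) (z - y) (z₁ - y₁) (z' - y'))
    (hya : a ≤ y) (hy₁a : a ≤ y₁) (hza : a ≤ z) (hz₁a : a ≤ z₁) :
    Jet (22 * K * A ^ 3 * Q) (22 * K * A ^ 3 * M / η) (22 * K * A ^ 3 * M)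
      (y ^ (-β) - z ^ (-β)) (y₁ ^ (-β) - z₁ ^ (-β))
      (-β * y ^ (-β - 1) * y' - -β * z ^ (-β - 1) * z') := by
  have hK := hP.one_le
  have hA0 : 0 < A := by linarith
  have hQ : 0 ≤ Q := by
    have := (abs_nonneg _).trans hd.val
    exact nonneg_of_mul_nonneg_right this hA0
  have hM : 0 ≤ M := (by positivity : 0 ≤ η ^ 2 * Q).trans hQM
  have hA12 : A ≤ A ^ 2 := by nlinarith
  have hA23 : A ^ 2 ≤ A ^ 3 := by nlinarith [sq_nonneg A]
  have hKM : 0 ≤ K * M := by positivity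
  have hyz : |y - z| ≤ A * Q := by rw [abs_sub_comm]; exact hd.val
  have hdif : |-β * y ^ (-β - 1) - -β * z ^ (-β - 1)| ≤ K * (A * Q) :=
    (hP.lip y z hya hza).trans (by gcongr)
  refine ⟨?_, ?_, ?_⟩
  · calc _ ≤ K * |y - z| := hP.lip_zero y z hya hza
      _ ≤ K * (A * Q) := by gcongr
      _ ≤ K * (22 * A ^ 3 * Q) := by
        have : A ≤ 22 * A ^ 3 := by linarith
        gcongr
      _ = _ := by ring
  · have e : -β * y ^ (-β - 1) * y' - -β * z ^ (-β - 1) * z'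
        = (-β * y ^ (-β - 1) - -β * z ^ (-β - 1)) * y' - -β * z ^ (-β - 1) * (z' - y') := by ring
    rw [e, le_div_iff₀ hη]
    have b1 : |(-β * y ^ (-β - 1) - -β * z ^ (-β - 1)) * y'| ≤ K * (A * Q) * (A * η) := by
      rw [abs_mul]; exact mul_le_mul hdif hy.der (abs_nonneg _) (by positivity)
    have b2 : |-β * z ^ (-β - 1) * (z' - y')| ≤ K * (A * M / η) := by
      rw [abs_mul]; exact mul_le_mul (hP.der z hza) hd.der (abs_nonneg _) (by positivity)
    calc _ ≤ (K * (A * Q) * (A * η) + K * (A * M / η)) * η := by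
          gcongr; exact (abs_sub _ _).trans (add_le_add b1 b2)
      _ = K * A ^ 2 * (η ^ 2 * Q) + K * A * M := by field_simp
      _ ≤ K * A ^ 2 * M + K * A * M := by gcongr
      _ = K * M * (A ^ 2 + A) := by ring
      _ ≤ K * M * (22 * A ^ 3) := by gcongr; linarith
      _ = _ := by ring
  · set Δy := y₁ - y with hΔy
    set Δz := z₁ - z with hΔz
    have h1 : |Δy| ≤ 2 * A * η := hy.diff_le_two hA0.le hη.le hη1
    have h2 : |Δz| ≤ 2 * A * η := hz.diff_le_two hA0.le hη.le hη1
    have h3 : |Δz - Δy| ≤ 2 * A * M / η := by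
      have e : Δz - Δy = (z₁ - y₁) - (z - y) := by rw [hΔy, hΔz]; ring
      rw [e]
      refine hd.diff_le.trans ?_
      have : A * M ≤ A * M / η := by rw [le_div_iff₀ hη]; nlinarith [mul_nonneg hA0.le hM]
      calc _ ≤ A * M / η + A * M / η := by linarith
        _ = _ := by ring
    -- Taylor's formula for the difference along the segments from `y` to `y₁` and from `z` to `z₁`:
    -- the second derivatives cancel up to terms of the size of `z - y` and its change
    have hT := abs_taylor_two_le
      (φ := fun τ => (y + τ * Δy) ^ (-β) - (z + τ * Δz) ^ (-β))
      (φ' := fun τ => -β * (y + τ * Δy) ^ (-β - 1) * Δy - -β * (z + τ * Δz) ^ (-β - 1) * Δz)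
      (φ'' := fun τ => -β * ((-β - 1) * (y + τ * Δy) ^ (-β - 2)) * Δy * Δy
        - -β * ((-β - 1) * (z + τ * Δz) ^ (-β - 2)) * Δz * Δz) (B := 20 * K * A ^ 3 * M)
      (fun τ hτ => by
        have hy0 := ha.trans_le (le_segment hya hy₁a hτ)
        have hz0 := ha.trans_le (le_segment hza hz₁a hτ)
        exact ((hasDerivAt_rpow_neg β hy0).comp τ (hasDerivAt_segment y Δy τ)).sub
          ((hasDerivAt_rpow_neg β hz0).comp τ (hasDerivAt_segment z Δz τ)))
      (fun τ hτ => by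
        have hy0 := ha.trans_le (le_segment hya hy₁a hτ)
        have hz0 := ha.trans_le (le_segment hza hz₁a hτ)
        exact (((hasDerivAt_rpow_neg_two β hy0).comp τ (hasDerivAt_segment y Δy τ)).mul_const
          Δy).sub (((hasDerivAt_rpow_neg_two β hz0).comp τ (hasDerivAt_segment z Δz τ)).mul_const
          Δz))
      (fun τ hτ => by
        have hy0 := le_segment hya hy₁a hτ
        have hz0 := le_segment hza hz₁a hτ
        have hl := hP.lip_two _ _ hy0 hz0
        have hb := hP.der_two _ hz0
        have hs : |y + τ * Δy - (z + τ * Δz)| ≤ A * Q + 2 * A * M / η := by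
          have e : y + τ * Δy - (z + τ * Δz) = -((z - y) + τ * (Δz - Δy)) := by ring
          rw [e, abs_neg]
          exact (abs_add_mul_le_of_mem_Icc hτ).trans (add_le_add hd.val h3)
        change |-β * ((-β - 1) * (y + τ * Δy) ^ (-β - 2)) * Δy * Δy
          - -β * ((-β - 1) * (z + τ * Δz) ^ (-β - 2)) * Δz * Δz| ≤ _
        generalize -β * ((-β - 1) * (y + τ * Δy) ^ (-β - 2)) = p at hl ⊢
        generalize -β * ((-β - 1) * (z + τ * Δz) ^ (-β - 2)) = q at hl hb ⊢
        have e : p * Δy * Δy - q * Δz * Δz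
            = (p - q) * Δy * Δy - q * (Δz - Δy) * (Δy + Δz) := by ring
        have b1 : |(p - q) * Δy * Δy|
            ≤ K * (A * Q + 2 * A * M / η) * (2 * A * η) * (2 * A * η) := by
          rw [abs_mul, abs_mul]
          have := hl.trans (mul_le_mul_of_nonneg_left hs (by linarith))
          gcongr
        have b2 : |q * (Δz - Δy) * (Δy + Δz)| ≤ K * (2 * A * M / η) * (4 * A * η) := by
          rw [abs_mul, abs_mul]
          gcongr
          exact (abs_add_le _ _).trans (by linarith)
        rw [e]
        calc _ ≤ K * (A * Q + 2 * A * M / η) * (2 * A * η) * (2 * A * η)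
              + K * (2 * A * M / η) * (4 * A * η) := (abs_sub _ _).trans (add_le_add b1 b2)
          _ = K * (4 * A ^ 3 * (η ^ 2 * Q) + 8 * A ^ 3 * M * η + 8 * A ^ 2 * M) := by
              field_simp
              ring
          _ ≤ K * (4 * A ^ 3 * M + 8 * A ^ 3 * M * 1 + 8 * A ^ 3 * M) := by gcongr
          _ = _ := by ring)
    simp only [one_mul, zero_mul, add_zero] at hT
    have ey : y + Δy = y₁ := by rw [hΔy]; ring
    have ez : z + Δz = z₁ := by rw [hΔz]; ring
    rw [ey, ez] at hT
    have hr : |-β * y ^ (-β - 1) * (Δy - y') - -β * z ^ (-β - 1) * (Δz - z')|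
        ≤ 2 * K * A ^ 3 * M := by
      have e : -β * y ^ (-β - 1) * (Δy - y') - -β * z ^ (-β - 1) * (Δz - z')
          = (-β * y ^ (-β - 1) - -β * z ^ (-β - 1)) * (Δy - y')
            - -β * z ^ (-β - 1) * ((z₁ - y₁) - (z - y) - (z' - y')) := by
        rw [hΔy, hΔz]; ring
      have b1 : |(-β * y ^ (-β - 1) - -β * z ^ (-β - 1)) * (Δy - y')|
          ≤ K * (A * Q) * (A * η ^ 2) := by
        rw [abs_mul]; exact mul_le_mul hdif hy.rem (abs_nonneg _) (by positivity)
      have b2 : |-β * z ^ (-β - 1) * ((z₁ - y₁) - (z - y) - (z' - y'))| ≤ K * (A * M) := by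
        rw [abs_mul]; exact mul_le_mul (hP.der z hza) hd.rem (abs_nonneg _) (by positivity)
      rw [e]
      calc _ ≤ K * (A * Q) * (A * η ^ 2) + K * (A * M) := (abs_sub _ _).trans (add_le_add b1 b2)
        _ = K * (A ^ 2 * (η ^ 2 * Q) + A * M) := by ring
        _ ≤ K * (A ^ 3 * M + A ^ 3 * M) := by
          have : A ≤ A ^ 3 := hA12.trans hA23
          gcongr
        _ = _ := by ring
    have e : y₁ ^ (-β) - z₁ ^ (-β) - (y ^ (-β) - z ^ (-β))
          - (-β * y ^ (-β - 1) * y' - -β * z ^ (-β - 1) * z')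
        = (y₁ ^ (-β) - z₁ ^ (-β) - (y ^ (-β) - z ^ (-β))
            - (-β * y ^ (-β - 1) * Δy - -β * z ^ (-β - 1) * Δz))
          + (-β * y ^ (-β - 1) * (Δy - y') - -β * z ^ (-β - 1) * (Δz - z')) := by ring
    rw [e]
    exact (abs_add_le _ _).trans ((add_le_add hT hr).trans_eq (by ring))

theorem jet_rpow {β a K y y₁ y' d r D : ℝ} (ha : 0 < a) (hP : PowBound β a K)
    (hy' : |y'| ≤ d) (hr : |y₁ - y - y'| ≤ r) (hD : |y₁ - y| ≤ D)
    (hya : a ≤ y) (hy₁a : a ≤ y₁) :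
    Jet K (K * d) (K * (D ^ 2 + r)) (y ^ (-β)) (y₁ ^ (-β)) (-β * y ^ (-β - 1) * y') := by
  have hK := hP.one_le
  refine ⟨hP.val y hya, ?_, ?_⟩
  · rw [abs_mul]
    exact mul_le_mul (hP.der y hya) hy' (abs_nonneg _) (by linarith)
  · have hT := abs_taylor_two_le
      (φ := fun τ => (y + τ * (y₁ - y)) ^ (-β))
      (φ' := fun τ => -β * (y + τ * (y₁ - y)) ^ (-β - 1) * (y₁ - y))
      (φ'' := fun τ => -β * ((-β - 1) * (y + τ * (y₁ - y)) ^ (-β - 2)) * (y₁ - y) * (y₁ - y))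
      (B := K * D ^ 2)
      (fun τ hτ => HasDerivAt.comp (h₂ := fun x : ℝ => x ^ (-β)) τ
        (hasDerivAt_rpow_neg β (ha.trans_le (le_segment hya hy₁a hτ)))
          (hasDerivAt_segment y (y₁ - y) τ))
      (fun τ hτ => ((hasDerivAt_rpow_neg_two β (ha.trans_le (le_segment hya hy₁a hτ))).comp τ
          (hasDerivAt_segment y (y₁ - y) τ)).mul_const _)
      (fun τ hτ => by
        rw [mul_assoc _ (y₁ - y), ← sq, abs_mul]
        have h1 : |(y₁ - y) ^ 2| ≤ D ^ 2 := by rw [abs_pow]; gcongr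
        exact mul_le_mul (hP.der_two _ (le_segment hya hy₁a hτ)) h1 (abs_nonneg _) (by linarith))
    simp only [one_mul, zero_mul, add_zero, add_sub_cancel] at hT
    have e : y₁ ^ (-β) - y ^ (-β) - -β * y ^ (-β - 1) * y'
        = (y₁ ^ (-β) - y ^ (-β) - -β * y ^ (-β - 1) * (y₁ - y))
          + -β * y ^ (-β - 1) * (y₁ - y - y') := by ring
    rw [e, mul_add]
    refine (abs_add_le _ _).trans (add_le_add hT ?_)
    rw [abs_mul]
    exact mul_le_mul (hP.der y hya) hr (abs_nonneg _) (by linarith)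

/-- Expansion of a maximum: the remainder is of second order unless the two entries are close. -/
theorem max_remainder_le {A η X X₁ X' Y Y₁ Y' l m : ℝ} (hη : 0 ≤ η) (hη1 : η ≤ 1) (hA : 0 ≤ A)
    (hX : Jet l (A * η) (A * η ^ 2) X X₁ X') (hY : Jet m (A * η) (A * η ^ 2) Y Y₁ Y') :
    |max X₁ Y₁ - max X Y| ≤ 2 * A * η ∧ |if Y < X then X' else Y'| ≤ A * η ∧
      |max X₁ Y₁ - max X Y - if Y < X then X' else Y'|
        ≤ A * η ^ 2 + 3 * A * η * if |X - Y| ≤ 4 * A * η then 1 else 0 := by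
  have h1 : |max X₁ Y₁ - max X Y| ≤ 2 * A * η :=
    (abs_max_sub_max_le_max _ _ _ _).trans (max_le (hX.diff_le_two hA hη hη1)
      (hY.diff_le_two hA hη hη1))
  have h2 : |if Y < X then X' else Y'| ≤ A * η := by
    split_ifs
    exacts [hX.der, hY.der]
  refine ⟨h1, h2, ?_⟩
  by_cases hc : |X - Y| ≤ 4 * A * η
  · rw [if_pos hc]
    refine (abs_sub _ _).trans ?_
    nlinarith [mul_nonneg hA (sq_nonneg η)]
  · rw [if_neg hc]
    push Not at hc
    have a1 := abs_le.1 (hX.diff_le_two hA hη hη1)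
    have a2 := abs_le.1 (hY.diff_le_two hA hη hη1)
    by_cases hXY : Y < X
    · rw [abs_of_pos (by linarith)] at hc
      rw [if_pos hXY, max_eq_left hXY.le, max_eq_left (by linarith)]
      linarith [hX.rem]
    · push Not at hXY
      rw [abs_of_nonpos (by linarith)] at hc
      rw [if_neg (not_lt.2 hXY), max_eq_right hXY, max_eq_right (by linarith)]
      linarith [hY.rem]

/-- Expansion of `max X Y ^ (-α) - Y ^ (-α)`. -/
theorem jet_max_rpow_sub {α a K A η X X₁ X' Y Y₁ Y' l m : ℝ} (ha : 0 < a) (hP : PowBound α a K)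
    (hη : 0 ≤ η) (hη1 : η ≤ 1) (hA : 1 ≤ A)
    (hX : Jet l (A * η) (A * η ^ 2) X X₁ X') (hY : Jet m (A * η) (A * η ^ 2) Y Y₁ Y')
    (hYa : a ≤ Y) (hY₁a : a ≤ Y₁) :
    Jet (2 * K) (2 * K * A * η)
      (10 * K * A ^ 2 * (η ^ 2 + η * if |X - Y| ≤ 4 * A * η then 1 else 0))
      (max X Y ^ (-α) - Y ^ (-α)) (max X₁ Y₁ ^ (-α) - Y₁ ^ (-α))
      (-α * max X Y ^ (-α - 1) * (if Y < X then X' else Y') - -α * Y ^ (-α - 1) * Y') := by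
  obtain ⟨h1, h2, h3⟩ := max_remainder_le hη hη1 (by linarith) hX hY
  have hYd : |Y₁ - Y| ≤ 2 * A * η := hY.diff_le_two (by linarith) hη hη1
  have j1 := jet_rpow ha hP h2 h3 h1 (hYa.trans (le_max_right _ _)) (hY₁a.trans (le_max_right _ _))
  have j2 := jet_rpow ha hP hY.der hY.rem hYd hYa hY₁a
  have hK := hP.one_le
  have hA2 : A ≤ A ^ 2 := by nlinarith
  refine (j1.sub j2).mono (by linarith) (by linarith) ?_
  generalize hι : (if |X - Y| ≤ 4 * A * η then (1 : ℝ) else 0) = ι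
  have hι0 : 0 ≤ ι := by rw [← hι]; split_ifs <;> norm_num
  calc _ = K * (8 * (A ^ 2 * η ^ 2) + 2 * (A * η ^ 2) + 3 * (A * (η * ι))) := by ring
    _ ≤ K * (8 * (A ^ 2 * η ^ 2) + 2 * (A ^ 2 * η ^ 2) + 10 * (A ^ 2 * (η * ι))) := by
      have b1 : A * η ^ 2 ≤ A ^ 2 * η ^ 2 := by gcongr
      have b2 : A * (η * ι) ≤ A ^ 2 * (η * ι) := by gcongr
      have b3 : 0 ≤ A ^ 2 * (η * ι) := by positivity
      gcongr
      linarith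
    _ = _ := by ring

/-! ### Averages along arcs -/

section ArcMean

variable {E : Type*} [NormedAddCommGroup E] [NormedSpace ℝ E]

/-- The average of `f` over the arc from `u` to `u + w`, in the parameter. -/
noncomputable def arcMean (f : UnitAddCircle → E) (p : UnitAddCircle × ℝ) : E :=
  ∫ θ in (0 : ℝ)..1, f (p.1 + ((θ * p.2 : ℝ) : UnitAddCircle))

theorem continuous_arc_point :
    Continuous fun q : (UnitAddCircle × ℝ) × ℝ => q.1.1 + ((q.2 * q.1.2 : ℝ) : UnitAddCircle) :=
  (continuous_fst.comp continuous_fst).add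
    ((AddCircle.continuous_mk' 1).comp (by fun_prop))

theorem continuous_path {X : Type*} [TopologicalSpace X] {f : UnitAddCircle → X}
    (hf : Continuous f) (p : UnitAddCircle × ℝ) :
    Continuous fun θ : ℝ => f (p.1 + ((θ * p.2 : ℝ) : UnitAddCircle)) :=
  hf.comp (continuous_arc_point.comp (by fun_prop : Continuous fun θ : ℝ => (p, θ)))

theorem continuous_translate {X : Type*} [TopologicalSpace X] {f : UnitAddCircle → X}
    (hf : Continuous f) : Continuous fun p : UnitAddCircle × ℝ => f (p.1 + (p.2 : UnitAddCircle)) :=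
  hf.comp (continuous_fst.add ((AddCircle.continuous_mk' 1).comp continuous_snd))

theorem continuous_arcMean {f : UnitAddCircle → E} (hf : Continuous f) : Continuous
    (arcMean f) := by
  refine intervalIntegral.continuous_parametric_intervalIntegral_of_continuous'
    (f := fun (p : UnitAddCircle × ℝ) (θ : ℝ) => f (p.1 + ((θ * p.2 : ℝ) : UnitAddCircle))) ?_ 0 1
  exact hf.comp continuous_arc_point

theorem arcMean_zero [CompleteSpace E] (f : UnitAddCircle → E) (u : UnitAddCircle) : arcMean f
    (u, 0) = f u := by
  simp [arcMean]

theorem arcMean_symm (f : UnitAddCircle → E) (u : UnitAddCircle) (w : ℝ) :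
    arcMean f (u + (w : UnitAddCircle), -w) = arcMean f (u, w) := by
  unfold arcMean
  have h := intervalIntegral.integral_comp_sub_left (a := 0) (b := 1)
    (fun θ : ℝ => f (u + ((θ * w : ℝ) : UnitAddCircle))) 1
  simp only [sub_self, sub_zero] at h
  rw [← h]
  congr 1
  ext θ
  congr 1
  rw [add_assoc, ← AddCircle.coe_add]
  congr 2
  ring

theorem smul_arcMean (f : UnitAddCircle → E) (u : UnitAddCircle) (w : ℝ) :
    w • arcMean f (u, w) = ∫ θ in (0 : ℝ)..w, f (u + (θ : UnitAddCircle)) := by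
  unfold arcMean
  have := intervalIntegral.smul_integral_comp_mul_right (a := 0) (b := 1)
    (fun θ : ℝ => f (u + (θ : UnitAddCircle))) w
  simpa using this

theorem integral_circle_eq (f : UnitAddCircle → E) (u : UnitAddCircle) :
    ∫ v, f v = ∫ θ in (0 : ℝ)..1, f (u + (θ : UnitAddCircle)) := by
  have h := UnitAddCircle.intervalIntegral_preimage 0 (fun v => f (u + v))
  rw [zero_add] at h
  rw [h, integral_add_left_eq_self f u]

theorem integral_sub_smul_arcMean {f : UnitAddCircle → E} (hf : Continuous f) (u : UnitAddCircle)
    (w : ℝ) : (∫ v, f v) - w • arcMean f (u, w) = ∫ θ in w..1, f (u + (θ : UnitAddCircle)) := by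
  have hc : Continuous fun θ : ℝ => f (u + (θ : UnitAddCircle)) :=
    hf.comp (continuous_const.add (AddCircle.continuous_mk' 1))
  rw [smul_arcMean, integral_circle_eq f u, intervalIntegral.integral_interval_sub_left
    (hc.intervalIntegrable _ _) (hc.intervalIntegrable _ _)]

theorem norm_arcMean_le (f : UnitAddCircle → E) (p : UnitAddCircle × ℝ) :
    ‖arcMean f p‖ ≤ arcMean (fun u => ‖f u‖) p :=
  intervalIntegral.norm_integral_le_integral_norm zero_le_one

theorem arcMean_add {f g : UnitAddCircle → E} (hf : Continuous f) (hg : Continuous g)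
    (p : UnitAddCircle × ℝ) :
    arcMean (fun u => f u + g u) p = arcMean f p + arcMean g p :=
  intervalIntegral.integral_add ((continuous_path hf p).intervalIntegrable _ _)
    ((continuous_path hg p).intervalIntegrable _ _)

theorem arcMean_smul (t : ℝ) (f : UnitAddCircle → E) (p : UnitAddCircle × ℝ) :
    arcMean (fun u => t • f u) p = t • arcMean f p :=
  intervalIntegral.integral_smul t _

theorem abs_mem_of_mem_W {w : ℝ} (hw : w ∈ W) : |w| ≤ 1 / 2 := abs_le.2 hw

/-- An arc and its complement: by the reflection `(u, w) ↦ (u + w, -w)` one may assume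
`0 ≤ w`. -/
theorem forall_W_of_symm {P : UnitAddCircle → ℝ → Prop}
    (hsymm : ∀ (u : UnitAddCircle) (w : ℝ), P (u + (w : UnitAddCircle)) (-w) → P u w)
    (h : ∀ u w, 0 ≤ w → w ≤ 1 / 2 → P u w) (u : UnitAddCircle) {w : ℝ} (hw : w ∈ W) : P u w := by
  rcases le_total 0 w with h0 | h0
  · exact h u w h0 hw.2
  · exact hsymm u w (h _ _ (by linarith) (by linarith [hw.1]))

theorem half_le_integral_sub_abs_mul_arcMean {f : UnitAddCircle → ℝ} (hf : Continuous f) {c : ℝ}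
    (hc : 0 ≤ c) (h : ∀ u, c ≤ f u) (u : UnitAddCircle) {w : ℝ} (hw : w ∈ W) :
    c / 2 ≤ (∫ v, f v) - |w| * arcMean f (u, w) := by
  refine forall_W_of_symm (P := fun u w => c / 2 ≤ (∫ v, f v) - |w| * arcMean f (u, w))
    (fun u w h => by rwa [arcMean_symm, abs_neg] at h) (fun u w h0 h1 => ?_) u hw
  rw [abs_of_nonneg h0, ← smul_eq_mul, integral_sub_smul_arcMean hf]
  have hcont : Continuous fun θ : ℝ => f (u + (θ : UnitAddCircle)) :=
    hf.comp (continuous_const.add (AddCircle.continuous_mk' 1))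
  have := intervalIntegral.integral_mono_on (μ := volume) (a := w) (b := 1) (f := fun _ => c)
    (by linarith)
    intervalIntegrable_const (hcont.intervalIntegrable _ _) fun θ _ => h _
  rw [intervalIntegral.integral_const, smul_eq_mul] at this
  nlinarith

/-- On a closed curve, a chord is at most as long as the complementary arc. -/
theorem abs_mul_norm_arcMean_le {g : UnitAddCircle → E} (hg : Continuous g)
    (h0 : ∫ v, g v = 0) (u : UnitAddCircle) {w : ℝ} (hw : w ∈ W) :
    |w| * ‖arcMean g (u, w)‖ ≤ (∫ v, ‖g v‖) - |w| * arcMean (fun v => ‖g v‖) (u, w) := by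
  refine forall_W_of_symm (P := fun u w => |w| * ‖arcMean g (u, w)‖
      ≤ (∫ v, ‖g v‖) - |w| * arcMean (fun v => ‖g v‖) (u, w))
    (fun u w h => by rwa [arcMean_symm, arcMean_symm, abs_neg] at h) (fun u w hw0 hw1 => ?_) u hw
  have h1 := integral_sub_smul_arcMean hg u w
  rw [h0, zero_sub] at h1
  have h2 := integral_sub_smul_arcMean hg.norm u w
  rw [smul_eq_mul] at h2
  rw [abs_of_nonneg hw0, h2, ← Real.norm_of_nonneg hw0, ← norm_smul, ← norm_neg,
    Real.norm_of_nonneg hw0, h1]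
  exact intervalIntegral.norm_integral_le_integral_norm (by linarith)

end ArcMean

/-! ### The density of the energy -/

section Density

variable {V : Type*} [NormedAddCommGroup V] [InnerProductSpace ℝ V]

/-- The length of the arc from `u` to `u + w` of a curve with derivative `g`. -/
noncomputable def arcLen (g : UnitAddCircle → V) (p : UnitAddCircle × ℝ) : ℝ :=
  |p.2| * arcMean (fun u => ‖g u‖) p

/-- The length of the complementary arc. -/
noncomputable def coarcLen (g : UnitAddCircle → V) (p : UnitAddCircle × ℝ) : ℝ :=
  (∫ u, ‖g u‖) - arcLen g p

/-- The change of `arcLen g` when `g` moves in direction `k`. -/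
noncomputable def dArcLen (g k : UnitAddCircle → V) (p : UnitAddCircle × ℝ) : ℝ :=
  |p.2| * arcMean (fun u => dnorm (g u) (k u)) p

/-- The change of `coarcLen g` when `g` moves in direction `k`. -/
noncomputable def dCoarcLen (g k : UnitAddCircle → V) (p : UnitAddCircle × ℝ) : ℝ :=
  (∫ u, dnorm (g u) (k u)) - dArcLen g k p

/-- The difference of the powers `-α` of the chord length and of the intrinsic distance
`min X Y`, where `X` and `Y` are the lengths of the arc and of its complement. It is written as the
difference for chord and arc, which is singular on the diagonal only, plus the bounded term
`max X Y ^ (-α) - Y ^ (-α) = X ^ (-α) - min X Y ^ (-α)`. -/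
noncomputable def powDiff (α : ℝ) (g : UnitAddCircle → V) (p : UnitAddCircle × ℝ) : ℝ :=
  |p.2| ^ (-α) * ((‖arcMean g p‖ ^ 2) ^ (-(α / 2)) - (arcMean (fun u => ‖g u‖) p ^ 2) ^ (-(α / 2)))
    + (max (arcLen g p) (coarcLen g p) ^ (-α) - coarcLen g p ^ (-α))

/-- The change of `powDiff α g` when `g` moves in direction `k`. Where the arc and its complement
have equal length, a set of measure zero for regular curves, the choice made for the maximum is
irrelevant. -/
noncomputable def dPowDiff (α : ℝ) (g k : UnitAddCircle → V) (p : UnitAddCircle × ℝ) : ℝ :=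
  |p.2| ^ (-α) * (-(α / 2) * (‖arcMean g p‖ ^ 2) ^ (-(α / 2) - 1)
        * (2 * inner ℝ (arcMean g p) (arcMean k p))
      - -(α / 2) * (arcMean (fun u => ‖g u‖) p ^ 2) ^ (-(α / 2) - 1)
        * (2 * arcMean (fun u => ‖g u‖) p * arcMean (fun u => dnorm (g u) (k u)) p))
    + (-α * max (arcLen g p) (coarcLen g p) ^ (-α - 1)
        * (if coarcLen g p < arcLen g p then dArcLen g k p else dCoarcLen g k p)
      - -α * coarcLen g p ^ (-α - 1) * dCoarcLen g k p)

/-- The product of the speeds at the end points. -/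
noncomputable def speedProd (g : UnitAddCircle → V) (p : UnitAddCircle × ℝ) : ℝ :=
  ‖g (p.1 + (p.2 : UnitAddCircle))‖ * ‖g p.1‖

/-- The change of `speedProd g` when `g` moves in direction `k`. -/
noncomputable def dSpeedProd (g k : UnitAddCircle → V) (p : UnitAddCircle × ℝ) : ℝ :=
  dnorm (g (p.1 + (p.2 : UnitAddCircle))) (k (p.1 + (p.2 : UnitAddCircle))) * ‖g p.1‖
    + ‖g (p.1 + (p.2 : UnitAddCircle))‖ * dnorm (g p.1) (k p.1)

/-- The integrand of O'Hara's energy in terms of the derivative `g` of the curve. -/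
noncomputable def density (α : ℝ) (g : UnitAddCircle → V) (p : UnitAddCircle × ℝ) : ℝ :=
  powDiff α g p * speedProd g p

/-- The change of `density α g` when `g` moves in direction `k`. -/
noncomputable def dDensity (α : ℝ) (g k : UnitAddCircle → V) (p : UnitAddCircle × ℝ) : ℝ :=
  dPowDiff α g k p * speedProd g p + powDiff α g p * dSpeedProd g k p

/-- The mean square oscillation on the arc from `u` to `u + w`, relative to the value at `u`. -/
noncomputable def osc (g : UnitAddCircle → V) (p : UnitAddCircle × ℝ) : ℝ :=
  ∫ θ in (0 : ℝ)..1, ‖g (p.1 + ((θ * p.2 : ℝ) : UnitAddCircle)) - g p.1‖ ^ 2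

/-- `g` is the derivative of a curve with controlled speed, whose chords over arcs of parameter
length at most `1/2` have length at least `c` times the parameter length. For `w = 0` the last
condition bounds the speed from below. -/
structure Controlled (c C : ℝ) (g : UnitAddCircle → V) : Prop where
  cont : Continuous g
  le : ∀ u, ‖g u‖ ≤ C
  chord : ∀ u, ∀ w ∈ W, c ≤ ‖arcMean g (u, w)‖

theorem zero_mem_W : (0 : ℝ) ∈ W := ⟨by norm_num, by norm_num⟩

theorem Controlled.le_norm [CompleteSpace V] {c C : ℝ} {g : UnitAddCircle → V}
    (h : Controlled c C g) (u : UnitAddCircle) : c ≤ ‖g u‖ := by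
  have := h.chord u 0 zero_mem_W
  rwa [arcMean_zero] at this

theorem Controlled.half_le_coarcLen [CompleteSpace V] {c C : ℝ} (hc : 0 < c)
    {g : UnitAddCircle → V} (h : Controlled c C g) (p : UnitAddCircle × ℝ) (hp : p.2 ∈ W) :
    c / 2 ≤ coarcLen g p :=
  half_le_integral_sub_abs_mul_arcMean h.cont.norm hc.le h.le_norm p.1 hp

theorem jet_mul_of_jet {c C η x x₁ x' y y₁ y' : ℝ} (hc : 0 < c) (hc1 : c ≤ 1) (hC : 1 ≤ C)
    (hη0 : 0 < η) (hη : η ≤ c / 2) (hx : Jet C η (η ^ 2 / c) x x₁ x')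
    (hy : Jet C η (η ^ 2 / c) y y₁ y') :
    Jet (200 * C ^ 2 / c ^ 2) (200 * C ^ 2 / c ^ 2 * η) (200 * C ^ 2 / c ^ 2 * η ^ 2)
      (x * y) (x₁ * y₁) (x' * y + x * y') := by
  have h1 : 1 ≤ 1 / c := by rw [le_div_iff₀ hc]; linarith
  have e : 200 * C ^ 2 / c ^ 2 = 200 * (C ^ 2 * (1 / c) ^ 2) := by field_simp
  have hC2 : C ≤ C ^ 2 := by nlinarith
  have hc2 : 1 / c ≤ (1 / c) ^ 2 := by nlinarith
  have b1 : C ^ 2 ≤ C ^ 2 * (1 / c) ^ 2 := by nlinarith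
  have b2 : 1 / c ≤ C ^ 2 * (1 / c) ^ 2 := by nlinarith
  have b3 : C * (1 / c) ≤ C ^ 2 * (1 / c) ^ 2 := by gcongr
  have hηc : η ^ 2 / c ≤ η / 2 := by rw [div_le_iff₀ hc]; nlinarith
  rw [e]
  set S := C ^ 2 * (1 / c) ^ 2
  refine (hx.mul hy).mono (by nlinarith) (by nlinarith) ?_
  have e2 : η ^ 2 / c * (C + η + η ^ 2 / c) + η * (η + η ^ 2 / c) + C * (η ^ 2 / c)
      = η ^ 2 * (2 * (C * (1 / c)) + 1 + 1 / c * (2 * η + η ^ 2 / c)) := by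
    field_simp; ring
  have b4 : 1 / c * (2 * η + η ^ 2 / c) ≤ 1 / c * 3 := by
    gcongr; linarith
  rw [e2, mul_comm (200 * S)]
  gcongr
  linarith

/-- Bounds for the constants that arise in the expansion of the density. -/
theorem jet_density_bounds {K L A a Q M η ι₁ ι B : ℝ} (hK1 : 1 ≤ K) (hL1 : 1 ≤ L) (hA1 : 1 ≤ A)
    (ha0 : 0 ≤ a) (hQ : 0 ≤ Q) (hM : 0 ≤ M) (hη0 : 0 < η) (hη1 : η ≤ 1) (hι0 : 0 ≤ ι₁) (hι : ι₁ ≤ ι)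
    (hB : B = 6 * (22 * K * A ^ 3 * A) + 36 * L * A ^ 3 + 4 * A) :
    22 * K * A ^ 3 * A * (a * Q) + 2 * L * A ≤ B * (a * Q + 1) ∧
    2 * (22 * K * A ^ 3) * A * (a * M) / η + (2 * L * A * η * A + 2 * L * (A * η))
      ≤ B * (a * M / η + η) ∧
    6 * (22 * K * A ^ 3) * A * (a * M) + (10 * L * A ^ 2 * (η ^ 2 + η * ι₁)
        * (A + A * η + A * η ^ 2) + 2 * L * A * η * (A * η + A * η ^ 2) + 2 * L * (A * η ^ 2))
      ≤ B * (a * M + (η ^ 2 + η * ι)) := by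
  have hA2 : A ≤ A ^ 2 := by nlinarith
  have hA3 : A ^ 2 ≤ A ^ 3 := by nlinarith [sq_nonneg A]
  have hη2 : η ^ 2 ≤ η := by
    rw [sq]; exact mul_le_of_le_one_left hη0.le hη1
  have k1 : 0 ≤ K * A ^ 3 * A := by positivity
  have k2 : L * A ≤ L * A ^ 3 := by gcongr; linarith
  have k3 : L * A ^ 2 ≤ L * A ^ 3 := by gcongr
  have k4 : 0 ≤ L * A ^ 3 := by positivity
  have haM : 0 ≤ a * M := by positivity
  have hS : 132 * (K * A ^ 3 * A) ≤ B := by rw [hB]; linarith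
  have hR : 36 * (L * A ^ 3) ≤ B := by rw [hB]; linarith
  have hB0 : 0 ≤ B := by linarith
  refine ⟨?_, ?_, ?_⟩
  · calc _ = 22 * (K * A ^ 3 * A) * (a * Q) + 2 * (L * A) := by ring
      _ ≤ B * (a * Q) + B * 1 := by
        refine add_le_add (mul_le_mul_of_nonneg_right ?_ (by positivity)) ?_ <;> linarith
      _ = _ := by ring
  · calc _ = 44 * (K * A ^ 3 * A) * (a * M / η) + (2 * (L * A ^ 2) + 2 * (L * A)) * η := by ring
      _ ≤ B * (a * M / η) + B * η := by
        refine add_le_add (mul_le_mul_of_nonneg_right ?_ (by positivity))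
          (mul_le_mul_of_nonneg_right ?_ hη0.le) <;> linarith
      _ = _ := by ring
  · have d0 : A * η ^ 2 ≤ A * 1 := by gcongr; linarith
    have d2 : A * η ≤ A * 1 := by gcongr
    have d1 : A + A * η + A * η ^ 2 ≤ 3 * A := by linarith
    have d3 : A * η ^ 2 ≤ A * η := by gcongr
    have hι' := hι0.trans hι
    calc _ ≤ 132 * (K * A ^ 3 * A) * (a * M)
            + (10 * L * A ^ 2 * (η ^ 2 + η * ι₁) * (3 * A) + 2 * L * A * η * (A * η + A * η)
              + 2 * L * (A * η ^ 2)) := by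
            have : 6 * (22 * K * A ^ 3) * A * (a * M) = 132 * (K * A ^ 3 * A) * (a * M) := by ring
            rw [this]
            gcongr
      _ = 132 * (K * A ^ 3 * A) * (a * M) + (30 * (L * A ^ 3) * (η ^ 2 + η * ι₁)
              + (4 * (L * A ^ 2) + 2 * (L * A)) * η ^ 2) := by ring
      _ ≤ B * (a * M) + (30 * (L * A ^ 3) * (η ^ 2 + η * ι) + 6 * (L * A ^ 3) * η ^ 2) := by
            gcongr
            linarith
      _ ≤ B * (a * M) + 36 * (L * A ^ 3) * (η ^ 2 + η * ι) := by
            have : 0 ≤ L * A ^ 3 * (η * ι) := by positivity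
            linarith
      _ ≤ B * (a * M) + B * (η ^ 2 + η * ι) := by gcongr
      _ = _ := by ring

/-- The pointwise expansion of the energy density: value, first-order change and remainder are
bounded by the oscillation weighted with `|w|^{-α}`, up to bounded terms. -/
theorem exists_jet_density [CompleteSpace V] {α c C : ℝ} (hα : 0 < α) (hc : 0 < c) (hc1 : c ≤ 1)
    (hC : 1 ≤ C) : ∃ B : ℝ, 1 ≤ B ∧ ∀ (g k : UnitAddCircle → V) (η : ℝ), 0 < η → η ≤ c / 2 →
      Controlled c C g → Controlled c C (fun u => g u + k u) → Continuous k → (∀ u, ‖k u‖ ≤ η) →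
      ∀ p : UnitAddCircle × ℝ, p.2 ∈ W →
        Jet (B * (|p.2| ^ (-α) * osc g p + 1))
          (B * (|p.2| ^ (-α) * (osc k p + η ^ 2 * osc g p) / η + η))
          (B * (|p.2| ^ (-α) * (osc k p + η ^ 2 * osc g p)
            + (η ^ 2 + η * if |arcLen g p - coarcLen g p| ≤ B * η then 1 else 0)))
          (density α g p) (density α (fun u => g u + k u) p) (dDensity α g k p) := by
  obtain ⟨K, hK⟩ := exists_powBound (α / 2) (by linarith) (a := c ^ 2) (by positivity)
  obtain ⟨L, hL⟩ := exists_powBound α hα.le (a := c / 2) (by positivity)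
  have hK1 := hK.one_le
  have hL1 := hL.one_le
  set A := 200 * C ^ 2 / c ^ 2 with hAdef
  have h1c : 1 ≤ 1 / c := by rw [le_div_iff₀ hc]; linarith
  have e : A = 200 * (C ^ 2 * (1 / c) ^ 2) := by rw [hAdef]; field_simp
  have hC2 : C ≤ C ^ 2 := by nlinarith
  have hc2 : 1 / c ≤ (1 / c) ^ 2 := by nlinarith
  have b1 : C ^ 2 ≤ C ^ 2 * (1 / c) ^ 2 := by nlinarith
  have b2 : (1 / c) ^ 2 ≤ C ^ 2 * (1 / c) ^ 2 := by nlinarith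
  have hA160 : 160 / c ^ 2 ≤ A := by
    have : 160 / c ^ 2 = 160 * (1 / c) ^ 2 := by field_simp
    linarith
  have hA1 : 1 ≤ A := by linarith
  refine ⟨6 * (22 * K * A ^ 3 * A) + 36 * L * A ^ 3 + 4 * A, ?_,
    fun g k η hη0 hη hg hg₁ hk hkη p hp => ?_⟩
  · have : 0 ≤ 6 * (22 * K * A ^ 3 * A) + 36 * L * A ^ 3 := by positivity
    linarith
  have hη1 : η ≤ 1 := by linarith
  have hw := abs_mem_of_mem_W hp
  set B := 6 * (22 * K * A ^ 3 * A) + 36 * L * A ^ 3 + 4 * A with hB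
  -- the path `θ ↦ g (u + θ w)` and its perturbation
  have hx := continuous_path hg.cont p
  have hκ := continuous_path hk p
  have js := jet_speed hc hx hκ (fun _ => hg.le_norm _) (fun _ => hg.le _) (fun _ => hkη _) hη
  have jm := jet_chord_sq hx hκ (fun _ => hg.le _) (fun _ => hkη _)
  have jp := jet_speed_sq_sub_chord_sq hc hc1 hx hκ (fun _ => hg.le_norm _) (fun _ => hkη _) hη0 hη
    rfl rfl
  simp only [zero_mul, AddCircle.coe_zero, add_zero] at jp
  have hg' : Continuous fun θ : ℝ => g (θ : UnitAddCircle) :=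
    hg.cont.comp (AddCircle.continuous_mk' 1)
  have hk' : Continuous fun θ : ℝ => k (θ : UnitAddCircle) := hk.comp (AddCircle.continuous_mk' 1)
  have jl := jet_speed hc hg' hk' (fun _ => hg.le_norm _) (fun _ => hg.le _) (fun _ => hkη _) hη
  have hint : ∀ f : UnitAddCircle → ℝ, ∫ θ in (0 : ℝ)..1, f (θ : UnitAddCircle) = ∫ v, f v :=
    fun f => by rw [integral_circle_eq f 0]; simp
  rw [hint (fun u => ‖g u‖), hint (fun u => ‖g u + k u‖), hint (fun u => dnorm (g u) (k u))] at jl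
  change Jet C η (η ^ 2 / c) (arcMean (fun u => ‖g u‖) p) (arcMean (fun u => ‖g u + k u‖) p)
    (arcMean (fun u => dnorm (g u) (k u)) p) at js
  change Jet (C ^ 2) (2 * C * η) (η ^ 2) (‖arcMean g p‖ ^ 2)
    (‖arcMean (fun u => g u + k u) p‖ ^ 2) (2 * inner ℝ (arcMean g p) (arcMean k p)) at jm
  change Jet (160 / c ^ 2 * osc g p) (160 / c ^ 2 * (osc k p + η ^ 2 * osc g p) / η)
    (160 / c ^ 2 * (osc k p + η ^ 2 * osc g p))
    (arcMean (fun u => ‖g u‖) p ^ 2 - ‖arcMean g p‖ ^ 2)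
    (arcMean (fun u => ‖g u + k u‖) p ^ 2 - ‖arcMean (fun u => g u + k u) p‖ ^ 2)
    (2 * arcMean (fun u => ‖g u‖) p * arcMean (fun u => dnorm (g u) (k u)) p
      - 2 * inner ℝ (arcMean g p) (arcMean k p)) at jp
  have hQ : 0 ≤ osc g p :=
    intervalIntegral.integral_nonneg zero_le_one fun _ _ => by positivity
  have hQk : 0 ≤ osc k p :=
    intervalIntegral.integral_nonneg zero_le_one fun _ _ => by positivity
  have hM : 0 ≤ osc k p + η ^ 2 * osc g p := by positivity
  have hQM : η ^ 2 * osc g p ≤ osc k p + η ^ 2 * osc g p := by linarith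
  generalize osc k p + η ^ 2 * osc g p = M at jp hM hQM ⊢
  generalize osc g p = Q at jp hQ hQM ⊢
  set a := |p.2| ^ (-α) with ha
  have ha0 : 0 ≤ a := by positivity
  -- chord and speed
  have hm := hg.chord p.1 p.2 hp
  have hm₁ := hg₁.chord p.1 p.2 hp
  have hs : c ≤ arcMean (fun u => ‖g u‖) p := hm.trans (norm_arcMean_le g p)
  have hs₁ : c ≤ arcMean (fun u => ‖g u + k u‖) p :=
    hm₁.trans (norm_arcMean_le (fun u => g u + k u) p)
  have jy : Jet (C ^ 2) (A * η) (A * η ^ 2) _ _ _ :=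
    jm.mono le_rfl (by gcongr; linarith) (by nlinarith [sq_nonneg η])
  have jz : Jet A (A * η) (A * η ^ 2) (arcMean (fun u => ‖g u‖) p ^ 2)
      (arcMean (fun u => ‖g u + k u‖) p ^ 2)
      (2 * arcMean (fun u => ‖g u‖) p * arcMean (fun u => dnorm (g u) (k u)) p) := by
    have := jet_mul_of_jet hc hc1 hC hη0 hη js js
    rw [← sq, ← sq] at this
    convert this using 1
    ring
  have jP : Jet (A * Q) (A * M / η) (A * M) _ _ _ :=
    jp.mono (by gcongr) (by gcongr) (by gcongr)
  have jΨ := (jet_rpow_sub (by positivity) hK hA1 hη0 hη1 hQM jy jz jP (by gcongr) (by gcongr)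
    (by gcongr) (by gcongr)).const_mul ha0
  have jv := jet_mul_of_jet hc hc1 hC hη0 hη
    (jet_norm hc (hg.le_norm (p.1 + (p.2 : UnitAddCircle))) (hg.le _)
      (hkη (p.1 + (p.2 : UnitAddCircle))) hη)
    (jet_norm hc (hg.le_norm p.1) (hg.le _) (hkη p.1) hη)
  have j1 := Jet.mul_bounded (A := 22 * K * A ^ 3) (Q := a * Q) (M := a * M) hη0 hη1 hA1
    (by positivity) (by
      calc η ^ 2 * (a * Q) = a * (η ^ 2 * Q) := by ring
        _ ≤ a * M := by gcongr) (by positivity)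
    (jΨ.mono (by linarith) (by apply le_of_eq; ring) (by linarith)) jv
  -- arc length and the length of the complementary arc
  have jX : Jet (|p.2| * C) (A / 2 * η) (A / 2 * η ^ 2) (arcLen g p)
      (arcLen (fun u => g u + k u) p) (dArcLen g k p) := by
    refine (js.const_mul (abs_nonneg p.2)).mono le_rfl ?_ ?_
    · nlinarith
    · have : η ^ 2 / c = 1 / c * η ^ 2 := by ring
      rw [this]
      calc |p.2| * (1 / c * η ^ 2) ≤ 1 / 2 * (A * η ^ 2) := by
            gcongr; linarith
        _ = _ := by ring
  have jY : Jet (C + |p.2| * C) (A * η) (A * η ^ 2) (coarcLen g p)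
      (coarcLen (fun u => g u + k u) p) (dCoarcLen g k p) := by
    refine (jl.sub jX).mono le_rfl ?_ ?_
    · nlinarith
    · have : η ^ 2 / c = 1 / c * η ^ 2 := by ring
      rw [this, ← add_mul]
      gcongr
      linarith
  have jX' : Jet (|p.2| * C) (A * η) (A * η ^ 2) _ _ _ :=
    jX.mono le_rfl (by gcongr; linarith) (by gcongr; linarith)
  have jΘ := jet_max_rpow_sub (by positivity) hL hη0.le hη1 hA1 jX' jY
    (hg.half_le_coarcLen hc p hp) (hg₁.half_le_coarcLen hc p hp)
  have j2 := jΘ.mul jv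
  have hι : (if |arcLen g p - coarcLen g p| ≤ 4 * A * η then (1 : ℝ) else 0)
      ≤ if |arcLen g p - coarcLen g p| ≤ B * η then 1 else 0 := by
    have : 4 * A * η ≤ B * η := by
      gcongr
      rw [hB]
      have : 0 ≤ 6 * (22 * K * A ^ 3 * A) + 36 * L * A ^ 3 := by positivity
      linarith
    split_ifs with h1 h2 h2
    · exact le_rfl
    · exact absurd (h1.trans this) h2
    · exact zero_le_one
    · exact le_rfl
  have j := j1.add j2
  have hι0 : (0 : ℝ) ≤ if |arcLen g p - coarcLen g p| ≤ 4 * A * η then (1 : ℝ) else 0 := by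
    split_ifs <;> norm_num
  generalize (if |arcLen g p - coarcLen g p| ≤ 4 * A * η then (1 : ℝ) else 0) = ι₁ at j hι hι0
  generalize (if |arcLen g p - coarcLen g p| ≤ B * η then (1 : ℝ) else 0) = ι at hι ⊢
  obtain ⟨d0, d1, d2⟩ := jet_density_bounds hK1 hL1 hA1 ha0 hQ hM hη0 hη1 hι0 hι hB
  have j' := j.mono d0 d1 d2
  convert j' using 1
  · unfold density powDiff speedProd
    ring
  · unfold density powDiff speedProd
    ring
  · unfold dDensity dPowDiff dSpeedProd powDiff speedProd
    ring

end Density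

/-! ### Integrability of the oscillation -/

section Osc

variable {V : Type*} [NormedAddCommGroup V]

theorem measurableSet_W : MeasurableSet W := measurableSet_Icc

theorem volume_W : volume W = 1 := by
  rw [W, Real.volume_Icc]; norm_num

instance isProbabilityMeasure_restrict_W : IsProbabilityMeasure ((volume : Measure ℝ).restrict W) :=
  ⟨by rw [Measure.restrict_apply_univ, volume_W]⟩

theorem ae_mem_W : ∀ᵐ p : UnitAddCircle × ℝ ∂stripMeasure, p.2 ∈ W :=
  Measure.quasiMeasurePreserving_snd.ae (ae_restrict_mem measurableSet_W)

theorem ae_snd_ne_zero : ∀ᵐ p : UnitAddCircle × ℝ ∂stripMeasure, p.2 ≠ 0 := by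
  have h : ∀ᵐ w : ℝ ∂(volume.restrict W), w ≠ 0 := by
    refine ae_restrict_of_ae ?_
    simp [ae_iff]
  exact Measure.quasiMeasurePreserving_snd.ae h

theorem continuous_osc {g : UnitAddCircle → V} (hg : Continuous g) : Continuous (osc g) := by
  refine intervalIntegral.continuous_parametric_intervalIntegral_of_continuous'
    (f := fun (p : UnitAddCircle × ℝ) (θ : ℝ) =>
      ‖g (p.1 + ((θ * p.2 : ℝ) : UnitAddCircle)) - g p.1‖ ^ 2) ?_ 0 1
  exact ((hg.comp continuous_arc_point).sub (hg.comp (continuous_fst.comp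
    continuous_fst))).norm.pow 2

theorem osc_nonneg (g : UnitAddCircle → V) (p : UnitAddCircle × ℝ) : 0 ≤ osc g p :=
  intervalIntegral.integral_nonneg zero_le_one fun _ _ => by positivity

/-- Rescaling the arc parameter. -/
theorem lintegral_W_comp_mul_le {φ : ℝ → ℝ≥0∞} (hφ : Measurable φ) {θ : ℝ} (h0 : 0 < θ)
    (h1 : θ ≤ 1) :
    ∫⁻ w in W, φ (θ * w) ≤ ENNReal.ofReal θ⁻¹ * ∫⁻ w in W, φ w := by
  have hψ : Measurable (W.indicator φ) := hφ.indicator measurableSet_W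
  calc ∫⁻ w in W, φ (θ * w) = ∫⁻ w, W.indicator (fun w => φ (θ * w)) w :=
        (lintegral_indicator measurableSet_W _).symm
    _ ≤ ∫⁻ w, W.indicator φ (θ * w) := by
        refine lintegral_mono fun w => ?_
        by_cases hw : w ∈ W
        · have : θ * w ∈ W := by
            have := abs_mem_of_mem_W hw
            refine abs_le.1 ?_
            rw [abs_mul, abs_of_pos h0]
            nlinarith [abs_nonneg w]
          rw [indicator_of_mem hw, indicator_of_mem this]
        · rw [indicator_of_notMem hw]; exact zero_le
    _ = ENNReal.ofReal θ⁻¹ * ∫⁻ w in W, φ w := by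
        rw [← lintegral_map hψ (measurable_const_mul θ), Real.map_volume_mul_left h0.ne',
          lintegral_smul_measure, abs_of_pos (inv_pos.2 h0), lintegral_indicator measurableSet_W,
          smul_eq_mul]

/-- The weighted oscillation is controlled by the Gagliardo seminorm: rescale the arc. -/
theorem lintegral_osc_le {α : ℝ} (hα : 1 ≤ α) {g : UnitAddCircle → V} (hg : Continuous g) :
    ∫⁻ p, ENNReal.ofReal (|p.2| ^ (-α) * osc g p) ∂stripMeasure ≤
      ∫⁻ u : UnitAddCircle, ∫⁻ w : ℝ in W,
        ENNReal.ofReal (‖g (u + (w : UnitAddCircle)) - g u‖ ^ 2 / |w| ^ α) := by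
  have hm : Measurable fun p : UnitAddCircle × ℝ => ENNReal.ofReal (|p.2| ^ (-α) * osc g p) := by
    have := (continuous_osc hg).measurable
    fun_prop
  rw [lintegral_prod _ hm.aemeasurable]
  refine lintegral_mono fun u => ?_
  set φ : ℝ → ℝ≥0∞ := fun w => ENNReal.ofReal (‖g (u + (w : UnitAddCircle)) - g u‖ ^ 2 / |w| ^ α)
  have hφ : Measurable φ := by
    have : Measurable fun w : ℝ => ‖g (u + (w : UnitAddCircle)) - g u‖ :=
      ((continuous_translate hg).comp (by fun_prop : Continuous fun w : ℝ => (u, w))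
        |>.sub continuous_const).norm.measurable
    fun_prop
  have hc : ∀ w : ℝ, Continuous fun θ : ℝ =>
      ‖g (u + ((θ * w : ℝ) : UnitAddCircle)) - g u‖ ^ 2 := fun w =>
    ((continuous_path hg (u, w)).sub continuous_const).norm.pow 2
  have e1 : ∀ w : ℝ, ENNReal.ofReal (|w| ^ (-α) * osc g (u, w))
      = ∫⁻ θ in Ioc (0 : ℝ) 1, ENNReal.ofReal (|w| ^ (-α) *
          ‖g (u + ((θ * w : ℝ) : UnitAddCircle)) - g u‖ ^ 2) := fun w => by
    rw [osc, ← intervalIntegral.integral_const_mul, intervalIntegral.integral_of_le zero_le_one,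
      ofReal_integral_eq_lintegral_ofReal]
    · exact (((hc w).const_mul _).intervalIntegrable 0 1).1
    · exact Eventually.of_forall fun θ => by positivity
  simp only [e1]
  rw [lintegral_lintegral_swap]
  · calc _ ≤ ∫⁻ θ in Ioc (0 : ℝ) 1, ∫⁻ w in W, φ w := by
          refine setLIntegral_mono' measurableSet_Ioc fun θ hθ => ?_
          calc _ ≤ ∫⁻ w in W, ENNReal.ofReal (θ ^ α) * φ (θ * w) := by
                refine lintegral_mono fun w => ?_
                rw [← ENNReal.ofReal_mul (by have := hθ.1.le; positivity)]
                refine ENNReal.ofReal_le_ofReal (le_of_eq ?_)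
                by_cases hw : w = 0
                · simp [hw]
                · have hw0 : 0 < |w| := abs_pos.2 hw
                  have h1 := hθ.1
                  rw [abs_mul, abs_of_pos h1, Real.mul_rpow h1.le hw0.le, Real.rpow_neg hw0.le]
                  have : 0 < θ ^ α := by positivity
                  field_simp
            _ ≤ ENNReal.ofReal (θ ^ α) * (ENNReal.ofReal θ⁻¹ * ∫⁻ w in W, φ w) := by
                rw [lintegral_const_mul' _ _ ENNReal.ofReal_ne_top]
                gcongr
                exact lintegral_W_comp_mul_le hφ hθ.1 hθ.2
            _ ≤ 1 * ∫⁻ w in W, φ w := by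
                rw [← mul_assoc, ← ENNReal.ofReal_mul (by have := hθ.1.le; positivity)]
                gcongr
                rw [← ENNReal.ofReal_one]
                refine ENNReal.ofReal_le_ofReal ?_
                rw [← div_eq_mul_inv, div_le_one hθ.1]
                simpa using Real.rpow_le_rpow_of_exponent_ge hθ.1 hθ.2 hα
            _ = _ := one_mul _
      _ = _ := by
          rw [lintegral_const, Measure.restrict_apply_univ, Real.volume_Ioc]
          simp [φ]
  · have h2 : Measurable fun q : ℝ × ℝ =>
        ‖g (u + ((q.2 * q.1 : ℝ) : UnitAddCircle)) - g u‖ :=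
      ((hg.comp (continuous_const.add ((AddCircle.continuous_mk' 1).comp
        (by fun_prop : Continuous fun q : ℝ × ℝ => q.2 * q.1)))).sub
          continuous_const).norm.measurable
    have : Measurable (Function.uncurry fun (w θ : ℝ) => ENNReal.ofReal (|w| ^ (-α) *
          ‖g (u + ((θ * w : ℝ) : UnitAddCircle)) - g u‖ ^ 2)) := by
      unfold Function.uncurry
      fun_prop
    exact this.aemeasurable

theorem integrable_osc {α : ℝ} (hα : 1 ≤ α) {g : UnitAddCircle → V} (hg : Continuous g) {N : ℝ}
    (hN0 : 0 ≤ N) (hN : ∫⁻ u : UnitAddCircle, ∫⁻ w : ℝ in W,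
        ENNReal.ofReal (‖g (u + (w : UnitAddCircle)) - g u‖ ^ 2 / |w| ^ α) ≤ ENNReal.ofReal N) :
    Integrable (fun p => |p.2| ^ (-α) * osc g p) stripMeasure ∧
      ∫ p, |p.2| ^ (-α) * osc g p ∂stripMeasure ≤ N := by
  have h := (lintegral_osc_le hα hg).trans hN
  have hm : Measurable fun p : UnitAddCircle × ℝ => |p.2| ^ (-α) * osc g p := by
    have := (continuous_osc hg).measurable
    fun_prop
  have h0 : ∀ p : UnitAddCircle × ℝ, 0 ≤ |p.2| ^ (-α) * osc g p := fun p =>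
    mul_nonneg (by positivity) (osc_nonneg g p)
  refine ⟨⟨hm.aestronglyMeasurable, ?_⟩, ?_⟩
  · rw [hasFiniteIntegral_iff_ofReal (Eventually.of_forall h0)]
    exact h.trans_lt ENNReal.ofReal_lt_top
  · rw [integral_eq_lintegral_of_nonneg_ae (Eventually.of_forall h0) hm.aestronglyMeasurable]
    exact ENNReal.toReal_le_of_le_ofReal hN0 h

/-! ### Pairs of nearly antipodal points -/

theorem continuous_arcLen {g : UnitAddCircle → V} (hg : Continuous g) : Continuous (arcLen g) :=
  (continuous_snd.abs).mul (continuous_arcMean hg.norm)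

theorem continuous_coarcLen {g : UnitAddCircle → V} (hg : Continuous g) : Continuous (coarcLen g) :=
  continuous_const.sub (continuous_arcLen hg)

theorem arcLen_symm (g : UnitAddCircle → V) (u : UnitAddCircle) (w : ℝ) :
    arcLen g (u + (w : UnitAddCircle), -w) = arcLen g (u, w) := by
  unfold arcLen
  rw [arcMean_symm, abs_neg]

theorem coarcLen_symm (g : UnitAddCircle → V) (u : UnitAddCircle) (w : ℝ) :
    coarcLen g (u + (w : UnitAddCircle), -w) = coarcLen g (u, w) := by
  unfold coarcLen
  rw [arcLen_symm]

theorem arcLen_of_nonneg (g : UnitAddCircle → V) (u : UnitAddCircle) {w : ℝ} (hw : 0 ≤ w) :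
    arcLen g (u, w) = ∫ θ in (0 : ℝ)..w, ‖g (u + (θ : UnitAddCircle))‖ := by
  rw [arcLen, abs_of_nonneg hw, ← smul_eq_mul, smul_arcMean]

theorem arcLen_of_nonpos (g : UnitAddCircle → V) (u : UnitAddCircle) {w : ℝ} (hw : w ≤ 0) :
    arcLen g (u, w) = ∫ θ in w..0, ‖g (u + (θ : UnitAddCircle))‖ := by
  rw [arcLen, abs_of_nonpos hw, neg_mul, ← smul_eq_mul, smul_arcMean,
    intervalIntegral.integral_symm w 0, neg_neg]

/-- For each `u`, arc and complement have almost equal length only for `w` in a small set. -/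
theorem volume_arcLen_close_le {g : UnitAddCircle → V} (hg : Continuous g) {c : ℝ} (hc : 0 < c)
    (h : ∀ u, c ≤ ‖g u‖) (u : UnitAddCircle) {r : ℝ} (hr : 0 ≤ r) :
    volume.restrict W {w | |arcLen g (u, w) - coarcLen g (u, w)| ≤ r}
      ≤ ENNReal.ofReal (2 * (r / c)) := by
  have hcont : Continuous fun θ : ℝ => ‖g (u + (θ : UnitAddCircle))‖ :=
    (hg.comp (continuous_const.add (AddCircle.continuous_mk' 1))).norm
  have hmono : ∀ a b : ℝ, a ≤ b → c * (b - a) ≤ ∫ θ in a..b, ‖g (u + (θ : UnitAddCircle))‖ :=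
    fun a b hab => by
      have := intervalIntegral.integral_mono_on (μ := volume) (a := a) (b := b)
        (f := fun _ => c) hab
        intervalIntegrable_const (hcont.intervalIntegrable _ _) fun θ _ => h _
      rw [intervalIntegral.integral_const, smul_eq_mul] at this
      linarith
  have hsub : ∀ a b d : ℝ, (∫ θ in a..b, ‖g (u + (θ : UnitAddCircle))‖)
      + ∫ θ in b..d, ‖g (u + (θ : UnitAddCircle))‖ = ∫ θ in a..d, ‖g (u + (θ : UnitAddCircle))‖ :=
    fun a b d => intervalIntegral.integral_add_adjacent_intervals (hcont.intervalIntegrable _ _)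
      (hcont.intervalIntegrable _ _)
  set S := {w : ℝ | |arcLen g (u, w) - coarcLen g (u, w)| ≤ r} with hS
  -- a set on which the arc length varies with slope at least `c`, such as each of the two half
  -- lines, meets `S` in a set of diameter at most `r / c`
  have key : ∀ T : Set ℝ, (∀ a ∈ T, ∀ b ∈ T, a ≤ b → c * (b - a) ≤
      |arcLen g (u, b) - arcLen g (u, a)|) → volume (S ∩ T) ≤ ENNReal.ofReal (r / c) := by
    intro T hT
    refine (Real.volume_le_diam _).trans (Metric.ediam_le_of_forall_dist_le fun a ha b hb => ?_)
    have main : ∀ a ∈ S ∩ T, ∀ b ∈ S ∩ T, a ≤ b → b - a ≤ r / c := by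
      intro a ha b hb hab
      have h1 := hT a ha.2 b hb.2 hab
      have h2 : |arcLen g (u, a) - coarcLen g (u, a)| ≤ r := ha.1
      have h3 : |arcLen g (u, b) - coarcLen g (u, b)| ≤ r := hb.1
      rw [abs_le] at h2 h3
      simp only [coarcLen] at h2 h3
      have h4 : |arcLen g (u, b) - arcLen g (u, a)| ≤ r := abs_le.2 ⟨by linarith, by linarith⟩
      rw [le_div_iff₀ hc]
      linarith
    rw [Real.dist_eq]
    rcases le_total a b with hab | hab
    · rw [abs_sub_comm, abs_of_nonneg (by linarith)]; exact main a ha b hb hab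
    · rw [abs_of_nonneg (by linarith)]; exact main b hb a ha hab
  have h1 := key (Ici 0) fun a ha b hb hab => by
    rw [arcLen_of_nonneg g u ha, arcLen_of_nonneg g u hb]
    have := hsub 0 a b
    exact (hmono a b hab).trans (le_trans (by linarith) (le_abs_self _))
  have h2 := key (Iic 0) fun a ha b hb hab => by
    rw [arcLen_of_nonpos g u ha, arcLen_of_nonpos g u hb]
    have := hsub a b 0
    exact (hmono a b hab).trans (le_trans (by linarith) (neg_le_abs _))
  calc volume.restrict W S ≤ volume S := Measure.restrict_apply_le _ _
    _ ≤ volume (S ∩ Ici 0 ∪ S ∩ Iic 0) := measure_mono fun w hw =>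
        (le_total 0 w).elim (fun h => Or.inl ⟨hw, h⟩) fun h => Or.inr ⟨hw, h⟩
    _ ≤ ENNReal.ofReal (r / c) + ENNReal.ofReal (r / c) :=
        (measure_union_le _ _).trans (add_le_add h1 h2)
    _ = _ := by
        rw [← ENNReal.ofReal_add (by positivity) (by positivity)]
        congr 1; ring

theorem measurableSet_arcLen_close {g : UnitAddCircle → V} (hg : Continuous g) (r : ℝ) :
    MeasurableSet {p | |arcLen g p - coarcLen g p| ≤ r} :=
  (isClosed_le ((continuous_arcLen hg).sub (continuous_coarcLen hg)).abs
    continuous_const).measurableSet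

theorem stripMeasure_arcLen_close_le {g : UnitAddCircle → V} (hg : Continuous g) {c : ℝ}
    (hc : 0 < c) (h : ∀ u, c ≤ ‖g u‖) {r : ℝ} (hr : 0 ≤ r) :
    stripMeasure {p | |arcLen g p - coarcLen g p| ≤ r} ≤ ENNReal.ofReal (2 * (r / c)) := by
  rw [Measure.prod_apply (measurableSet_arcLen_close hg r)]
  calc _ ≤ ∫⁻ _ : UnitAddCircle, ENNReal.ofReal (2 * (r / c)) :=
        lintegral_mono fun u => volume_arcLen_close_le hg hc h u hr
    _ = _ := by simp

theorem ae_arcLen_ne_coarcLen {g : UnitAddCircle → V} (hg : Continuous g) {c : ℝ}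
    (hc : 0 < c) (h : ∀ u, c ≤ ‖g u‖) :
    ∀ᵐ p ∂stripMeasure, arcLen g p ≠ coarcLen g p := by
  have h1 := stripMeasure_arcLen_close_le hg hc h le_rfl
  rw [zero_div, mul_zero, ENNReal.ofReal_zero, nonpos_iff_eq_zero] at h1
  rw [ae_iff]
  refine measure_mono_null (fun p hp => ?_) h1
  simp only [ne_eq, not_not, mem_ofPred_eq] at hp ⊢
  rw [hp, sub_self, abs_zero]

/-! ### Measurability of the density -/

theorem continuous_speedProd {g : UnitAddCircle → V} (hg : Continuous g) :
    Continuous (speedProd g) :=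
  (continuous_translate hg).norm.mul (hg.comp continuous_fst).norm

variable [InnerProductSpace ℝ V]

theorem continuous_dArcLen {g k : UnitAddCircle → V} (hg : Continuous g) (hk : Continuous k)
    (h0 : ∀ u, g u ≠ 0) : Continuous (dArcLen g k) :=
  (continuous_snd.abs).mul (continuous_arcMean (continuous_dnorm hg hk h0))

theorem continuous_dCoarcLen {g k : UnitAddCircle → V} (hg : Continuous g) (hk : Continuous k)
    (h0 : ∀ u, g u ≠ 0) : Continuous (dCoarcLen g k) :=
  continuous_const.sub (continuous_dArcLen hg hk h0)

theorem continuous_dSpeedProd {g k : UnitAddCircle → V} (hg : Continuous g) (hk : Continuous k)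
    (h0 : ∀ u, g u ≠ 0) : Continuous (dSpeedProd g k) :=
  ((continuous_translate (continuous_dnorm hg hk h0)).mul (hg.comp continuous_fst).norm).add
    ((continuous_translate hg).norm.mul ((continuous_dnorm hg hk h0).comp continuous_fst))

theorem measurable_powDiff (α : ℝ) {g : UnitAddCircle → V} (hg : Continuous g) :
    Measurable (powDiff α g) := by
  have h1 := (continuous_arcMean hg).norm.measurable
  have h2 := (continuous_arcMean hg.norm).measurable
  have h3 := (continuous_arcLen hg).measurable
  have h4 := (continuous_coarcLen hg).measurable
  unfold powDiff
  fun_prop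

theorem measurable_density (α : ℝ) {g : UnitAddCircle → V} (hg : Continuous g) :
    Measurable (density α g) :=
  (measurable_powDiff α hg).mul (continuous_speedProd hg).measurable

theorem measurable_dPowDiff (α : ℝ) {g k : UnitAddCircle → V} (hg : Continuous g)
    (hk : Continuous k) (h0 : ∀ u, g u ≠ 0) : Measurable (dPowDiff α g k) := by
  have h1 := (continuous_arcMean hg).norm.measurable
  have h2 := (continuous_arcMean hg.norm).measurable
  have h3 := (continuous_arcLen hg).measurable
  have h4 := (continuous_coarcLen hg).measurable
  have h5 := ((continuous_arcMean hg).inner (𝕜 := ℝ) (continuous_arcMean hk)).measurable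
  have h6 := (continuous_arcMean (continuous_dnorm hg hk h0)).measurable
  have h7 := (continuous_dArcLen hg hk h0).measurable
  have h8 := (continuous_dCoarcLen hg hk h0).measurable
  have h9 : Measurable fun p =>
      if coarcLen g p < arcLen g p then dArcLen g k p else dCoarcLen g k p :=
    Measurable.ite (measurableSet_lt h4 h3) h7 h8
  unfold dPowDiff
  fun_prop

theorem measurable_dDensity (α : ℝ) {g k : UnitAddCircle → V} (hg : Continuous g)
    (hk : Continuous k) (h0 : ∀ u, g u ≠ 0) : Measurable (dDensity α g k) :=
  ((measurable_dPowDiff α hg hk h0).mul (continuous_speedProd hg).measurable).add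
    ((measurable_powDiff α hg).mul (continuous_dSpeedProd hg hk h0).measurable)

/-! ### Linearity of the first-order change -/

theorem dArcLen_add {g k l : UnitAddCircle → V} (hg : Continuous g) (hk : Continuous k)
    (hl : Continuous l) (h0 : ∀ u, g u ≠ 0) (p : UnitAddCircle × ℝ) :
    dArcLen g (fun u => k u + l u) p = dArcLen g k p + dArcLen g l p := by
  simp only [dArcLen, dnorm_add_right]
  rw [arcMean_add (continuous_dnorm hg hk h0) (continuous_dnorm hg hl h0), mul_add]

theorem integrable_circle {f : UnitAddCircle → ℝ} (hf : Continuous f) : Integrable f :=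
  hf.integrable_of_hasCompactSupport (HasCompactSupport.of_compactSpace _)

theorem dCoarcLen_add {g k l : UnitAddCircle → V} (hg : Continuous g) (hk : Continuous k)
    (hl : Continuous l) (h0 : ∀ u, g u ≠ 0) (p : UnitAddCircle × ℝ) :
    dCoarcLen g (fun u => k u + l u) p = dCoarcLen g k p + dCoarcLen g l p := by
  simp only [dCoarcLen, dArcLen_add hg hk hl h0, dnorm_add_right]
  rw [integral_add (integrable_circle (continuous_dnorm hg hk h0))
    (integrable_circle (continuous_dnorm hg hl h0))]
  ring

theorem dDensity_add (α : ℝ) {g k l : UnitAddCircle → V} (hg : Continuous g) (hk : Continuous k)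
    (hl : Continuous l) (h0 : ∀ u, g u ≠ 0) (p : UnitAddCircle × ℝ) :
    dDensity α g (fun u => k u + l u) p = dDensity α g k p + dDensity α g l p := by
  simp only [dDensity, dPowDiff, dSpeedProd, dArcLen_add hg hk hl h0, dCoarcLen_add hg hk hl h0,
    dnorm_add_right, arcMean_add hk hl, inner_add_right,
    arcMean_add (continuous_dnorm hg hk h0) (continuous_dnorm hg hl h0)]
  split_ifs <;> ring

theorem dArcLen_smul (t : ℝ) (g k : UnitAddCircle → V) (p : UnitAddCircle × ℝ) :
    dArcLen g (fun u => t • k u) p = t * dArcLen g k p := by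
  simp only [dArcLen, dnorm_smul_right]
  have := arcMean_smul t (fun u => dnorm (g u) (k u)) p
  simp only [smul_eq_mul] at this
  rw [this]; ring

theorem dCoarcLen_smul (t : ℝ) (g k : UnitAddCircle → V) (p : UnitAddCircle × ℝ) :
    dCoarcLen g (fun u => t • k u) p = t * dCoarcLen g k p := by
  simp only [dCoarcLen, dArcLen_smul, dnorm_smul_right]
  rw [integral_const_mul]
  ring

theorem dDensity_smul (α t : ℝ) (g k : UnitAddCircle → V) (p : UnitAddCircle × ℝ) :
    dDensity α g (fun u => t • k u) p = t * dDensity α g k p := by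
  have h := arcMean_smul t (fun u => dnorm (g u) (k u)) p
  simp only [smul_eq_mul] at h
  simp only [dDensity, dPowDiff, dSpeedProd, dArcLen_smul, dCoarcLen_smul, dnorm_smul_right,
    arcMean_smul, inner_smul_right, h]
  split_ifs <;> ring

end Osc

/-! ### Functionals with quadratic remainder -/

/-- If the first-order expansions of `E` at the points of a ball have linear part `L x` and a
remainder that is quadratic uniformly on the ball, then `E` is differentiable there, and its
derivative is Lipschitz continuous, in particular continuous, at the centre. -/
theorem hasFDerivAt_of_quadratic_remainder {H : Type*} [NormedAddCommGroup H] [NormedSpace ℝ H]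
    {E : H → ℝ} {L : H → H → ℝ} {x₀ : H} {r C : ℝ} (hr : 0 < r) (hC : 0 ≤ C)
    (hlin : ∀ x ∈ Metric.ball x₀ r, IsLinearMap ℝ (L x))
    (hbd : ∀ x ∈ Metric.ball x₀ r, ∀ h, x + h ∈ Metric.ball x₀ r → |L x h| ≤ C * ‖h‖)
    (hrem : ∀ x ∈ Metric.ball x₀ r, ∀ h, x + h ∈ Metric.ball x₀ r →
      |E (x + h) - E x - L x h| ≤ C * ‖h‖ ^ 2) :
    (∀ x ∈ Metric.ball x₀ r, ∃ F : H →L[ℝ] ℝ, (∀ h, F h = L x h) ∧ HasFDerivAt E F x) ∧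
      ContinuousAt (fderiv ℝ E) x₀ := by
  have hmem : ∀ x ∈ Metric.ball x₀ r, ∀ h : H, ‖h‖ < r - dist x x₀ → x + h ∈ Metric.ball x₀ r :=
    fun x _ h hh => by
      rw [Metric.mem_ball, dist_eq_norm] at *
      have : x + h - x₀ = (x - x₀) + h := by abel
      rw [this]
      exact (norm_add_le _ _).trans_lt (by linarith)
  have hbd' : ∀ x ∈ Metric.ball x₀ r, ∀ h, |L x h| ≤ C * ‖h‖ := fun x hx h => by
    have hρ : 0 < r - dist x x₀ := sub_pos.2 hx
    by_cases h0 : h = 0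
    · rw [h0, (hlin x hx).map_zero]; simp
    have hn : 0 < ‖h‖ := norm_pos_iff.2 h0
    set t := (r - dist x x₀) / (2 * ‖h‖) with ht
    have ht0 : 0 < t := by positivity
    have hth : ‖t • h‖ = (r - dist x x₀) / 2 := by
      rw [norm_smul, Real.norm_of_nonneg ht0.le, ht]; field_simp
    have h1 := hbd x hx (t • h) (hmem x hx _ (by rw [hth]; linarith))
    rw [(hlin x hx).map_smul, smul_eq_mul, abs_mul, abs_of_pos ht0, norm_smul,
      Real.norm_of_nonneg ht0.le] at h1
    have h2 : t * |L x h| ≤ t * (C * ‖h‖) := h1.trans_eq (by ring)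
    exact le_of_mul_le_mul_left h2 ht0
  have hF : ∀ x ∈ Metric.ball x₀ r, ∃ F : H →L[ℝ] ℝ, (∀ h, F h = L x h) ∧ HasFDerivAt E F x :=
    fun x hx => by
      refine ⟨LinearMap.mkContinuous (IsLinearMap.mk' _ (hlin x hx)) C fun h => hbd' x hx h,
        fun h => rfl, ?_⟩
      rw [hasFDerivAt_iff_isLittleO_nhds_zero]
      refine Asymptotics.IsBigO.trans_isLittleO (g := fun h : H => ‖h‖ ^ 2) ?_
        (Asymptotics.isLittleO_norm_pow_id one_lt_two)
      refine Asymptotics.IsBigO.of_bound C ?_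
      have hρ : 0 < r - dist x x₀ := sub_pos.2 hx
      filter_upwards [Metric.ball_mem_nhds (0 : H) hρ] with h hh
      rw [norm_pow, norm_norm]
      exact hrem x hx h (hmem x hx h (by simpa using hh))
  refine ⟨hF, ?_⟩
  have hx₀ : x₀ ∈ Metric.ball x₀ r := Metric.mem_ball_self hr
  have hfd : ∀ x ∈ Metric.ball x₀ r, ∀ h, fderiv ℝ E x h = L x h := fun x hx h => by
    obtain ⟨F, h1, h2⟩ := hF x hx
    rw [h2.fderiv, h1]
  have hlip : ∀ x ∈ Metric.ball x₀ (r / 4), ‖fderiv ℝ E x - fderiv ℝ E x₀‖ ≤ 6 * C * ‖x - x₀‖ := by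
    intro x hx
    rw [Metric.mem_ball, dist_eq_norm] at hx
    have hxr : x ∈ Metric.ball x₀ r := by rw [Metric.mem_ball, dist_eq_norm]; linarith
    set δ := ‖x - x₀‖ with hδ
    refine ContinuousLinearMap.opNorm_le_bound _ (by positivity) fun k => ?_
    rw [sub_apply, hfd x hxr, hfd x₀ hx₀]
    by_cases hδ0 : δ = 0
    · have : x = x₀ := by rwa [hδ, norm_sub_eq_zero_iff] at hδ0
      rw [this, sub_self, norm_zero]; positivity
    by_cases hk0 : k = 0
    · rw [hk0, (hlin x hxr).map_zero, (hlin x₀ hx₀).map_zero]; simp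
    have hn : 0 < ‖k‖ := norm_pos_iff.2 hk0
    have hδp : 0 < δ := lt_of_le_of_ne (norm_nonneg _) (Ne.symm hδ0)
    -- compare the expansions of `E (x + k')` at `x` and at `x₀`, for `k'` of length `‖x - x₀‖`
    set t := δ / ‖k‖ with ht
    have ht0 : 0 < t := by positivity
    have htk : ‖t • k‖ = δ := by
      rw [norm_smul, Real.norm_of_nonneg ht0.le, ht]; field_simp
    have e1 : x₀ + (x - x₀) = x := by abel
    have e2 : x₀ + ((x - x₀) + t • k) = x + t • k := by abel
    have m1 : x + t • k ∈ Metric.ball x₀ r := by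
      have e : x + t • k - x₀ = (x - x₀) + t • k := by abel
      rw [Metric.mem_ball, dist_eq_norm, e]
      exact (norm_add_le _ _).trans_lt (by rw [htk]; linarith)
    have r1 := hrem x hxr (t • k) m1
    have r2 := hrem x₀ hx₀ (x - x₀) (by rwa [e1])
    have r3 := hrem x₀ hx₀ ((x - x₀) + t • k) (by rwa [e2])
    rw [e1] at r2
    rw [e2, (hlin x₀ hx₀).map_add] at r3
    have r4 : C * ‖(x - x₀) + t • k‖ ^ 2 ≤ C * (2 * δ) ^ 2 := by
      gcongr
      exact (norm_add_le _ _).trans (by rw [htk]; linarith)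
    rw [htk] at r1
    have key : |L x (t • k) - L x₀ (t • k)| ≤ 6 * C * δ ^ 2 := by
      have a1 := abs_le.1 r1
      have a2 := abs_le.1 r2
      have a3 := abs_le.1 (r3.trans r4)
      rw [abs_le]
      constructor <;> linarith
    rw [(hlin x hxr).map_smul, (hlin x₀ hx₀).map_smul, smul_eq_mul, smul_eq_mul, ← mul_sub, abs_mul,
      abs_of_pos ht0] at key
    rw [Real.norm_eq_abs]
    have : t * |L x k - L x₀ k| ≤ t * (6 * C * δ * ‖k‖) := by
      refine key.trans_eq ?_
      rw [ht]; field_simp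
    exact le_of_mul_le_mul_left this ht0
  rw [ContinuousAt, tendsto_iff_norm_sub_tendsto_zero]
  refine squeeze_zero' (g := fun x => 6 * C * ‖x - x₀‖) (Eventually.of_forall fun _ => norm_nonneg
    _)
    ?_ ?_
  · filter_upwards [Metric.ball_mem_nhds x₀ (by positivity : 0 < r / 4)] with x hx
    exact hlip x hx
  · have : Continuous fun x : H => 6 * C * ‖x - x₀‖ := by fun_prop
    simpa using this.tendsto x₀

/-- A function of one variable with a quadratic remainder at `0`. -/
theorem hasDerivAt_of_quadratic_remainder {f : ℝ → ℝ} {d r C : ℝ} (hr : 0 < r)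
    (h : ∀ τ, |τ| < r → |f τ - f 0 - τ * d| ≤ C * τ ^ 2) : HasDerivAt f d 0 := by
  rw [hasDerivAt_iff_isLittleO_nhds_zero]
  refine Asymptotics.IsBigO.trans_isLittleO (g := fun τ : ℝ => ‖τ‖ ^ 2) ?_
    (Asymptotics.isLittleO_norm_pow_id one_lt_two)
  refine Asymptotics.IsBigO.of_bound C ?_
  filter_upwards [Metric.ball_mem_nhds (0 : ℝ) hr] with τ hτ
  rw [norm_pow, norm_norm, Real.norm_eq_abs, Real.norm_eq_abs, sq_abs, zero_add, smul_eq_mul]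
  exact h τ (by simpa using hτ)

/-! ### The density in terms of chord length and intrinsic distance -/

section Identities

theorem sq_rpow_neg_half {x : ℝ} (hx : 0 ≤ x) (α : ℝ) : (x ^ 2) ^ (-(α / 2)) = x ^ (-α) := by
  rw [← Real.rpow_natCast, ← Real.rpow_mul hx]
  congr 1
  push_cast
  ring

theorem sq_rpow_neg_half_sub_one {x : ℝ} (hx : 0 ≤ x) (α : ℝ) :
    (x ^ 2) ^ (-(α / 2) - 1) = x ^ (-(α + 2)) := by
  rw [← Real.rpow_natCast, ← Real.rpow_mul hx]
  congr 1
  push_cast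
  ring

variable {V : Type*} [NormedAddCommGroup V]

theorem arcLen_pos [InnerProductSpace ℝ V] {g : UnitAddCircle → V} {p : UnitAddCircle × ℝ}
    (hm : arcMean g p ≠ 0) (hw : p.2 ≠ 0) : 0 < arcLen g p :=
  mul_pos (abs_pos.2 hw) ((norm_pos_iff.2 hm).trans_le (norm_arcMean_le g p))

theorem powDiff_eq [InnerProductSpace ℝ V] (α : ℝ) {g : UnitAddCircle → V}
    {p : UnitAddCircle × ℝ} :
    powDiff α g p = ‖p.2 • arcMean g p‖ ^ (-α) - min (arcLen g p) (coarcLen g p) ^ (-α) := by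
  have hb : 0 ≤ arcMean (fun u => ‖g u‖) p := (norm_nonneg _).trans (norm_arcMean_le g p)
  have h1 : arcLen g p ^ (-α) = |p.2| ^ (-α) * arcMean (fun u => ‖g u‖) p ^ (-α) :=
    Real.mul_rpow (abs_nonneg _) hb
  rw [powDiff, sq_rpow_neg_half (norm_nonneg _), sq_rpow_neg_half hb, mul_sub, ← h1, norm_smul,
    Real.norm_eq_abs, Real.mul_rpow (abs_nonneg _) (norm_nonneg _)]
  rcases le_total (arcLen g p) (coarcLen g p) with h | h
  · rw [max_eq_right h, min_eq_left h]; ring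
  · rw [max_eq_left h, min_eq_right h]; ring

variable [InnerProductSpace ℝ V]

/-- The change of the intrinsic distance when `g` moves in direction `k`, off the set where the arc
and its complement have equal length. -/
noncomputable def dMinLen (g k : UnitAddCircle → V) (p : UnitAddCircle × ℝ) : ℝ :=
  if coarcLen g p < arcLen g p then dCoarcLen g k p else dArcLen g k p

theorem dPowDiff_eq (α : ℝ) {g k : UnitAddCircle → V} {p : UnitAddCircle × ℝ}
    (hm : arcMean g p ≠ 0) (hw : p.2 ≠ 0) (hY : 0 < coarcLen g p) :
    dPowDiff α g k p = -(α * (inner ℝ (p.2 • arcMean g p) (p.2 • arcMean k p)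
        / ‖p.2 • arcMean g p‖ ^ (α + 2)
      - dMinLen g k p / min (arcLen g p) (coarcLen g p) ^ (α + 1))) := by
  have hm0 : 0 < ‖arcMean g p‖ := norm_pos_iff.2 hm
  have hw0 : 0 < |p.2| := abs_pos.2 hw
  have hb : 0 < arcMean (fun u => ‖g u‖) p := hm0.trans_le (norm_arcMean_le g p)
  have hX := arcLen_pos hm hw
  -- the chord
  have e1 : |p.2| ^ (-α) * (-(α / 2) * (‖arcMean g p‖ ^ 2) ^ (-(α / 2) - 1)
        * (2 * inner ℝ (arcMean g p) (arcMean k p)))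
      = -(α * (inner ℝ (p.2 • arcMean g p) (p.2 • arcMean k p)
        / ‖p.2 • arcMean g p‖ ^ (α + 2))) := by
    rw [sq_rpow_neg_half_sub_one hm0.le, real_inner_smul_left, real_inner_smul_right, norm_smul,
      Real.norm_eq_abs, Real.mul_rpow hw0.le hm0.le, Real.rpow_neg hm0.le, Real.rpow_neg hw0.le,
      Real.rpow_add hw0, Real.rpow_two, sq_abs]
    have : 0 < |p.2| ^ α := by positivity
    have : 0 < ‖arcMean g p‖ ^ (α + 2) := by positivity
    field_simp
  -- the arc
  have e2 : |p.2| ^ (-α) * (-(α / 2) * (arcMean (fun u => ‖g u‖) p ^ 2) ^ (-(α / 2) - 1)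
        * (2 * arcMean (fun u => ‖g u‖) p * arcMean (fun u => dnorm (g u) (k u)) p))
      = -α * arcLen g p ^ (-α - 1) * dArcLen g k p := by
    have : (-α - 1 : ℝ) = -(α + 1) := by ring
    rw [sq_rpow_neg_half_sub_one hb.le, this, arcLen, dArcLen, Real.mul_rpow hw0.le hb.le,
      Real.rpow_neg hb.le, Real.rpow_neg hw0.le, Real.rpow_neg hb.le, Real.rpow_neg hw0.le,
      Real.rpow_add hw0, Real.rpow_add hb, Real.rpow_add hb, Real.rpow_two, Real.rpow_one,
      Real.rpow_one]
    have : 0 < |p.2| ^ α := by positivity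
    have : 0 < arcMean (fun u => ‖g u‖) p ^ α := by positivity
    field_simp
  have e3 : ∀ {x : ℝ}, 0 < x → x ^ (-α - 1) = (x ^ (α + 1))⁻¹ := fun hx => by
    rw [← Real.rpow_neg hx.le]; congr 1; ring
  rw [dPowDiff, mul_sub, e1, e2, dMinLen]
  by_cases h : coarcLen g p < arcLen g p
  · rw [if_pos h, if_pos h, max_eq_left h.le, min_eq_right h.le, e3 hX, e3 hY]
    ring
  · rw [if_neg h, if_neg h, max_eq_right (not_lt.1 h), min_eq_left (not_lt.1 h), e3 hX, e3 hY]
    ring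

end Identities

/-! ### The reflection `(u, w) ↦ (u + w, -w)` -/

/-- The map exchanging the roles of the two end points of an arc. -/
noncomputable def flip (p : UnitAddCircle × ℝ) : UnitAddCircle × ℝ :=
  (p.1 + (p.2 : UnitAddCircle), -p.2)

theorem flip_flip (p : UnitAddCircle × ℝ) : flip (flip p) = p := by
  unfold flip
  ext
  · simp
  · simp

theorem continuous_flip : Continuous flip :=
  (continuous_fst.add ((AddCircle.continuous_mk' 1).comp continuous_snd)).prodMk continuous_snd.neg

theorem measurePreserving_flip : MeasurePreserving flip stripMeasure stripMeasure := by
  have h1 : MeasurePreserving (fun w : ℝ => -w) (volume.restrict W) (volume.restrict W) := by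
    have := (Measure.measurePreserving_neg (volume : Measure ℝ)).restrict_preimage measurableSet_W
    have e : (fun w : ℝ => -w) ⁻¹' W = W := by
      ext w
      simp only [W, mem_preimage, mem_Icc]
      constructor <;> rintro ⟨h1, h2⟩ <;> constructor <;> linarith
    have e' : Neg.neg ⁻¹' W = W := e
    rwa [e'] at this
  have h2 : MeasurePreserving (fun q : ℝ × UnitAddCircle => (-q.1, q.2 + (q.1 : UnitAddCircle)))
      ((volume.restrict W).prod volume) ((volume.restrict W).prod volume) := by
    refine h1.skew_product (g := fun w u => u + (w : UnitAddCircle)) ?_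
      (Eventually.of_forall fun w => (measurePreserving_add_right volume _).map_eq)
    exact (continuous_snd.add ((AddCircle.continuous_mk' 1).comp continuous_fst)).measurable
  exact (Measure.measurePreserving_swap.comp h2).comp Measure.measurePreserving_swap

theorem integral_comp_flip (f : UnitAddCircle × ℝ → ℝ) :
    ∫ p, f (flip p) ∂stripMeasure = ∫ p, f p ∂stripMeasure := by
  let e : (UnitAddCircle × ℝ) ≃ₜ (UnitAddCircle × ℝ) :=
    { toFun := flip, invFun := flip, left_inv := flip_flip, right_inv := flip_flip
      continuous_toFun := continuous_flip, continuous_invFun := continuous_flip }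
  exact measurePreserving_flip.integral_comp e.measurableEmbedding f

/-! ### Curves of class `C¹` on the circle -/

section ClassCOne

/-- A curve of class `C¹` on `ℝ/ℤ`: its lift to `ℝ` is differentiable everywhere, and its derivative
is continuous. -/
structure IsCOne {F : Type*} [NormedAddCommGroup F] [NormedSpace ℝ F]
    (f : UnitAddCircle → F) : Prop where
  hasDerivAt : ∀ t : ℝ, HasDerivAt (fun t : ℝ => f (t : UnitAddCircle))
    (circleDeriv f (t : UnitAddCircle)) t
  cont : Continuous (circleDeriv f)

section

variable {F : Type*} [NormedAddCommGroup F] [NormedSpace ℝ F] {f h : UnitAddCircle → F}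

theorem IsCOne.hasDerivAt_add (hf : IsCOne f) (u : UnitAddCircle) (t : ℝ) :
    HasDerivAt (fun t : ℝ => f (u + (t : UnitAddCircle)))
      (circleDeriv f (u + (t : UnitAddCircle))) t := by
  obtain ⟨a, rfl⟩ := QuotientAddGroup.mk_surjective u
  have h1 := hf.hasDerivAt (a + t)
  have h2 := h1.comp_const_add a t
  simpa using h2

theorem IsCOne.circleDeriv_add_smul (hf : IsCOne f) (hh : IsCOne h) (τ : ℝ) :
    circleDeriv (fun v => f v + τ • h v) = fun u => circleDeriv f u + τ • circleDeriv h u := by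
  funext u
  have h1 := (hf.hasDerivAt_add u 0).add ((hh.hasDerivAt_add u 0).const_smul τ)
  simp only [AddCircle.coe_zero, add_zero] at h1
  exact h1.deriv

variable [CompleteSpace F]

theorem IsCOne.sub_eq (hf : IsCOne f) (u : UnitAddCircle) (w : ℝ) :
    f (u + (w : UnitAddCircle)) - f u = w • arcMean (circleDeriv f) (u, w) := by
  have hc : Continuous fun θ : ℝ => circleDeriv f (u + (θ : UnitAddCircle)) :=
    hf.cont.comp (continuous_const.add (AddCircle.continuous_mk' 1))
  have h1 := intervalIntegral.integral_eq_sub_of_hasDerivAt (a := 0) (b := w)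
    (fun t _ => hf.hasDerivAt_add u t) (hc.intervalIntegrable _ _)
  rw [smul_arcMean, h1]
  simp

theorem IsCOne.integral_circleDeriv (hf : IsCOne f) : ∫ u, circleDeriv f u = 0 := by
  have h := hf.sub_eq 0 1
  have e : ((1 : ℝ) : UnitAddCircle) = 0 := AddCircle.coe_period 1
  rw [smul_arcMean, ← integral_circle_eq, e, add_zero, sub_self] at h
  exact h.symm

end

section Length

variable {n : ℕ}

theorem arcLength_eq (γ : UnitAddCircle → EuclideanSpace ℝ (Fin n)) (u : UnitAddCircle) (w : ℝ) :
    arcLength γ u w = arcLen (circleDeriv γ) (u, w) := by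
  have h0 : 0 ≤ arcMean (fun v => ‖circleDeriv γ v‖) (u, w) :=
    (norm_nonneg _).trans (norm_arcMean_le (circleDeriv γ) (u, w))
  rw [arcLength, ← smul_arcMean (fun v => ‖circleDeriv γ v‖) u w, smul_eq_mul, abs_mul,
    abs_of_nonneg h0, arcLen]

theorem totalLength_eq (γ : UnitAddCircle → EuclideanSpace ℝ (Fin n)) :
    totalLength γ = ∫ u, ‖circleDeriv γ u‖ := by
  rw [totalLength, integral_circle_eq _ 0]
  simp

theorem intrinsicDist_eq (γ : UnitAddCircle → EuclideanSpace ℝ (Fin n)) (p : UnitAddCircle × ℝ) :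
    intrinsicDist γ p.1 p.2 = min (arcLen (circleDeriv γ) p) (coarcLen (circleDeriv γ) p) := by
  rw [intrinsicDist, arcLength_eq, totalLength_eq]
  rfl

theorem IsCOne.delta_eq {γ : UnitAddCircle → EuclideanSpace ℝ (Fin n)} (hγ : IsCOne γ)
    (p : UnitAddCircle × ℝ) : delta γ p.1 p.2 = p.2 • arcMean (circleDeriv γ) p :=
  hγ.sub_eq p.1 p.2

end Length

/-! ### Injective regular curves -/

variable {V : Type*} [NormedAddCommGroup V] [InnerProductSpace ℝ V]

theorem isCompact_strip : IsCompact ((univ : Set UnitAddCircle) ×ˢ W) :=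
  isCompact_univ.prod isCompact_Icc

/-- A `C¹` curve is injective and regular iff its chords over arcs of parameter length at most
`1/2`, divided by this length, do not vanish, up to the diagonal. -/
theorem IsCOne.injective_and_regular_iff [CompleteSpace V] {γ : UnitAddCircle → V}
    (hγ : IsCOne γ) : (Function.Injective γ ∧ ∀ u, circleDeriv γ u ≠ 0) ↔
      ∀ u, ∀ w ∈ W, arcMean (circleDeriv γ) (u, w) ≠ 0 := by
  constructor
  · rintro ⟨hi, hr⟩ u w hw h0
    by_cases hw0 : w = 0
    · rw [hw0, arcMean_zero] at h0
      exact hr u h0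
    have h1 := hγ.sub_eq u w
    rw [h0, smul_zero, sub_eq_zero] at h1
    have h2 : (w : UnitAddCircle) = 0 := by simpa using hi h1
    obtain ⟨m, hm⟩ := (AddCircle.coe_eq_zero_iff (1 : ℝ)).1 h2
    rw [zsmul_eq_mul, mul_one] at hm
    have h3 := abs_mem_of_mem_W hw
    have h4 : |(m : ℝ)| < 1 := by rw [hm]; linarith
    have h5 : |m| < 1 := by exact_mod_cast h4
    rw [Int.abs_lt_one_iff] at h5
    rw [h5] at hm
    exact hw0 (by simpa using hm.symm)
  · intro h
    refine ⟨fun x y hxy => ?_, fun u hu => h u 0 zero_mem_W (by rw [arcMean_zero, hu])⟩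
    obtain ⟨w, hw, hxw⟩ := AddCircle.eq_coe_Ico (p := (1 : ℝ)) (x - y +
      ((1 / 2 : ℝ) : UnitAddCircle))
    have hx : x = y + ((w - 1 / 2 : ℝ) : UnitAddCircle) := by
      rw [AddCircle.coe_sub, hxw]; abel
    have h1 := hγ.sub_eq y (w - 1 / 2)
    rw [← hx, hxy, sub_self] at h1
    rcases smul_eq_zero.1 h1.symm with h2 | h2
    · rw [hx, h2]; simp
    · exact absurd h2 (h y _ ⟨by linarith [hw.1], by linarith [hw.2]⟩)

/-- By compactness, nonvanishing chords and speeds are bounded away from zero. -/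
theorem exists_controlled {g : UnitAddCircle → V} (hg : Continuous g)
    (h : ∀ u, ∀ w ∈ W, arcMean g (u, w) ≠ 0) :
    ∃ c C : ℝ, 0 < c ∧ c ≤ 1 ∧ 1 ≤ C ∧ Controlled c C g := by
  obtain ⟨C, hC⟩ := isCompact_univ.exists_bound_of_continuousOn hg.continuousOn
  obtain ⟨q, hq, hmin⟩ := isCompact_strip.exists_isMinOn ⟨((0 : UnitAddCircle), (0 : ℝ)),
    mem_univ _, zero_mem_W⟩ (continuous_arcMean hg).norm.continuousOn
  have hq0 : 0 < ‖arcMean g q‖ := norm_pos_iff.2 (h q.1 q.2 hq.2)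
  refine ⟨min ‖arcMean g q‖ 1, max C 1, lt_min hq0 one_pos, min_le_right _ _, le_max_right _ _, hg,
    fun u => (hC u (mem_univ u)).trans (le_max_left _ _), fun u w hw => ?_⟩
  exact (min_le_left _ _).trans (hmin (show (u, w) ∈ univ ×ˢ W from ⟨mem_univ _, hw⟩))

theorem norm_arcMean_le_of_le {g : UnitAddCircle → V} {S : ℝ} (h : ∀ u, ‖g u‖ ≤ S)
    (p : UnitAddCircle × ℝ) : ‖arcMean g p‖ ≤ S := by
  have := intervalIntegral.norm_integral_le_of_norm_le_const (a := 0) (b := 1) (C := S)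
    (f := fun θ : ℝ => g (p.1 + ((θ * p.2 : ℝ) : UnitAddCircle))) fun θ _ => h _
  simpa [arcMean] using this

theorem Controlled.add {c C δ : ℝ} {g k : UnitAddCircle → V} (h : Controlled c C g)
    (hk : Continuous k) (hδ : ∀ u, ‖k u‖ ≤ δ) :
    Controlled (c - δ) (C + δ) (fun u => g u + k u) where
  cont := h.cont.add hk
  le u := (norm_add_le _ _).trans (add_le_add (h.le u) (hδ u))
  chord u w hw := by
    rw [arcMean_add h.cont hk]
    have h1 := h.chord u w hw
    have h2 := norm_arcMean_le_of_le hδ (u, w)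
    have h3 := norm_sub_le (arcMean g (u, w) + arcMean k (u, w)) (arcMean k (u, w))
    rw [add_sub_cancel_right] at h3
    linarith

theorem Controlled.arcMean_ne_zero {c C : ℝ} (hc : 0 < c) {g : UnitAddCircle → V}
    (h : Controlled c C g) {p : UnitAddCircle × ℝ} (hp : p.2 ∈ W) : arcMean g p ≠ 0 :=
  norm_pos_iff.1 (hc.trans_le (h.chord p.1 p.2 hp))

/-! ### The energy as an integral of the density -/

theorem powDiff_nonneg {α : ℝ} (hα : 0 ≤ α) {g : UnitAddCircle → V} (hg : Continuous g)
    (h0 : ∫ u, g u = 0) {p : UnitAddCircle × ℝ} (hp : p.2 ∈ W) (hw : p.2 ≠ 0)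
    (hm : arcMean g p ≠ 0) : 0 ≤ powDiff α g p := by
  rw [powDiff_eq α]
  have h1 : 0 < ‖p.2 • arcMean g p‖ := norm_pos_iff.2 (smul_ne_zero hw hm)
  refine sub_nonneg.2 (Real.rpow_le_rpow_of_nonpos h1 (le_min ?_ ?_) (by linarith))
  · rw [norm_smul, Real.norm_eq_abs, arcLen]
    exact mul_le_mul_of_nonneg_left (norm_arcMean_le g p) (abs_nonneg _)
  · rw [norm_smul, Real.norm_eq_abs]
    exact abs_mul_norm_arcMean_le hg h0 p.1 hp

theorem energy_eq_lintegral {n : ℕ} {α : ℝ} {γ : UnitAddCircle → EuclideanSpace ℝ (Fin n)}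
    (hγ : IsCOne γ) {c C : ℝ} (hc : 0 < c) (h : Controlled c C (circleDeriv γ)) :
    energy α γ = ∫⁻ p, ENNReal.ofReal (density α (circleDeriv γ) p) ∂stripMeasure := by
  rw [lintegral_prod _ (measurable_density α hγ.cont).ennreal_ofReal.aemeasurable, energy]
  refine lintegral_congr fun u => lintegral_congr_ae ?_
  have hne : ∀ᵐ w : ℝ ∂(volume.restrict W), w ≠ 0 := ae_restrict_of_ae (by simp [ae_iff])
  filter_upwards [hne, ae_restrict_mem measurableSet_W] with w hw0 hw
  have hm := h.arcMean_ne_zero hc (p := (u, w)) hw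
  have hd : 0 < ‖w • arcMean (circleDeriv γ) (u, w)‖ := norm_pos_iff.2 (smul_ne_zero hw0 hm)
  have hmin : 0 < min (arcLen (circleDeriv γ) (u, w)) (coarcLen (circleDeriv γ) (u, w)) :=
    lt_min (arcLen_pos hm hw0) ((half_pos hc).trans_le (h.half_le_coarcLen hc (u, w) hw))
  rw [density, powDiff_eq α, speedProd, hγ.delta_eq (u, w), intrinsicDist_eq γ (u, w)]
  have e : ∀ {x : ℝ}, 0 < x → (ENNReal.ofReal x ^ α)⁻¹ = ENNReal.ofReal (x ^ (-α)) := fun hx => by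
    rw [ENNReal.ofReal_rpow_of_pos hx, Real.rpow_neg hx.le, ENNReal.ofReal_inv_of_pos
      (by positivity)]
  rw [e hd, e hmin, ← ENNReal.ofReal_sub _ (by positivity), mul_assoc,
    ← ENNReal.ofReal_mul (norm_nonneg _), ← ENNReal.ofReal_mul' (by positivity)]

theorem energy_eq_integral {n : ℕ} {α : ℝ} (hα : 0 ≤ α)
    {γ : UnitAddCircle → EuclideanSpace ℝ (Fin n)} (hγ : IsCOne γ) {c C : ℝ} (hc : 0 < c)
    (h : Controlled c C (circleDeriv γ))
    (hi : Integrable (density α (circleDeriv γ)) stripMeasure) :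
    energy α γ < ⊤ ∧ (energy α γ).toReal = ∫ p, density α (circleDeriv γ) p ∂stripMeasure := by
  have h0 : 0 ≤ᵐ[stripMeasure] density α (circleDeriv γ) := by
    filter_upwards [ae_mem_W, ae_snd_ne_zero] with p hp hw
    exact mul_nonneg (powDiff_nonneg hα hγ.cont hγ.integral_circleDeriv hp hw
      (h.arcMean_ne_zero hc hp)) (mul_nonneg (norm_nonneg _) (norm_nonneg _))
  rw [energy_eq_lintegral hγ hc h, integral_eq_lintegral_of_nonneg_ae h0 hi.aestronglyMeasurable]
  exact ⟨hi.lintegral_lt_top, rfl⟩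

end ClassCOne

section Variation

variable {V : Type*} [NormedAddCommGroup V] [InnerProductSpace ℝ V]

/-! ### Differentiability of the intrinsic distance -/

theorem hasDerivAt_integral_norm {c C S : ℝ} (hc : 0 < c) (hS : 0 < S) {x κ : ℝ → V}
    (hx : Continuous x) (hκ : Continuous κ) (hcx : ∀ s, c ≤ ‖x s‖) (hxC : ∀ s, ‖x s‖ ≤ C)
    (hκS : ∀ s, ‖κ s‖ ≤ S) :
    HasDerivAt (fun τ : ℝ => ∫ θ in (0 : ℝ)..1, ‖x θ + τ • κ θ‖)
      (∫ θ in (0 : ℝ)..1, dnorm (x θ) (κ θ)) 0 := by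
  refine hasDerivAt_of_quadratic_remainder (r := c / (2 * S)) (C := S ^ 2 / c) (by positivity)
    fun τ hτ => ?_
  have h1 : |τ| * S ≤ c / 2 := by
    rw [lt_div_iff₀ (by positivity)] at hτ; linarith
  have j := jet_speed hc hx (hκ.const_smul τ) hcx hxC (η := |τ| * S) (fun s => by
    rw [Pi.smul_apply, norm_smul, Real.norm_eq_abs]
    exact mul_le_mul_of_nonneg_left (hκS s) (abs_nonneg _)) h1
  have h2 := j.rem
  simp only [Pi.smul_apply, dnorm_smul_right, intervalIntegral.integral_const_mul] at h2
  simp only [zero_smul, add_zero]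
  refine h2.trans_eq ?_
  rw [mul_pow, sq_abs]; ring

theorem hasDerivAt_min {f g : ℝ → ℝ} {a b : ℝ} (hf : HasDerivAt f a 0) (hg : HasDerivAt g b 0)
    (hne : f 0 ≠ g 0) :
    HasDerivAt (fun τ => min (f τ) (g τ)) (if g 0 < f 0 then b else a) 0 := by
  by_cases h : g 0 < f 0
  · rw [if_pos h]
    refine hg.congr_of_eventuallyEq ?_
    filter_upwards [hg.continuousAt.eventually_lt hf.continuousAt h] with τ hτ
    exact min_eq_right hτ.le
  · have h' : f 0 < g 0 := lt_of_le_of_ne (not_lt.1 h) hne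
    rw [if_neg h]
    refine hf.congr_of_eventuallyEq ?_
    filter_upwards [hf.continuousAt.eventually_lt hg.continuousAt h'] with τ hτ
    exact min_eq_left hτ.le

/-- Where an arc and its complement have different lengths, the smaller length is differentiable
along `g + τ k`. -/
theorem hasDerivAt_min_arcLen {c C S : ℝ} (hc : 0 < c) (hS : 0 < S) {g k : UnitAddCircle → V}
    (hg : Continuous g) (hk : Continuous k) (hcg : ∀ u, c ≤ ‖g u‖) (hgC : ∀ u, ‖g u‖ ≤ C)
    (hkS : ∀ u, ‖k u‖ ≤ S) {p : UnitAddCircle × ℝ} (hp : arcLen g p ≠ coarcLen g p) :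
    HasDerivAt (fun τ : ℝ => min (arcLen (fun u => g u + τ • k u) p)
      (coarcLen (fun u => g u + τ • k u) p)) (dMinLen g k p) 0 := by
  have h1 : HasDerivAt (fun τ : ℝ => arcLen (fun u => g u + τ • k u) p) (dArcLen g k p) 0 :=
    (hasDerivAt_integral_norm hc hS (continuous_path hg p) (continuous_path hk p)
      (fun _ => hcg _) (fun _ => hgC _) (fun _ => hkS _)).const_mul _
  have hcoe : Continuous fun θ : ℝ => ((θ : ℝ) : UnitAddCircle) := AddCircle.continuous_mk' 1
  have h2 : HasDerivAt (fun τ : ℝ => ∫ u, ‖g u + τ • k u‖) (∫ u, dnorm (g u) (k u)) 0 := by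
    have := hasDerivAt_integral_norm hc hS (hg.comp hcoe) (hk.comp hcoe)
      (fun _ => hcg _) (fun _ => hgC _) (fun _ => hkS _)
    simp only [integral_circle_eq _ (0 : UnitAddCircle), zero_add]
    exact this
  have h3 := hasDerivAt_min h1 (h2.sub h1) (by simpa [coarcLen] using hp)
  have h4 : (fun u => g u + (0 : ℝ) • k u) = g := by simp
  change HasDerivAt _ (if coarcLen (fun u => g u + (0 : ℝ) • k u) p
    < arcLen (fun u => g u + (0 : ℝ) • k u) p then _ else _) 0 at h3
  rwa [h4] at h3

/-! ### Integrated expansions -/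

theorem integral_strip_const (a : ℝ) : ∫ _, a ∂stripMeasure = a := by
  have h : (stripMeasure univ) = 1 := by
    rw [← univ_prod_univ, Measure.prod_prod, Measure.restrict_apply_univ, volume_W,
      UnitAddCircle.measure_univ, one_mul]
  rw [integral_const, measureReal_def, h]
  simp

/-- The square of the Gagliardo seminorm with weight `|w|^{-α}`. -/
noncomputable def sqGagliardo (α : ℝ) (g : UnitAddCircle → V) : ℝ≥0∞ :=
  ∫⁻ u : UnitAddCircle, ∫⁻ w : ℝ in W,
    ENNReal.ofReal (‖g (u + (w : UnitAddCircle)) - g u‖ ^ 2 / |w| ^ α)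

theorem integrable_indicator_close {c C : ℝ} (hc : 0 < c) {g : UnitAddCircle → V} [CompleteSpace V]
    (hg : Controlled c C g) {r : ℝ} (hr : 0 ≤ r) :
    Integrable (fun p => if |arcLen g p - coarcLen g p| ≤ r then (1 : ℝ) else 0) stripMeasure ∧
      ∫ p, (if |arcLen g p - coarcLen g p| ≤ r then (1 : ℝ) else 0) ∂stripMeasure
        ≤ 2 * (r / c) := by
  have hm := measurableSet_arcLen_close hg.cont r
  have e : (fun p => if |arcLen g p - coarcLen g p| ≤ r then (1 : ℝ) else 0)
      = {p | |arcLen g p - coarcLen g p| ≤ r}.indicator fun _ => (1 : ℝ) := by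
    ext p; simp [indicator_apply]
  rw [e]
  refine ⟨(integrable_const _).indicator hm, ?_⟩
  rw [integral_indicator_const _ hm, smul_eq_mul, mul_one]
  exact ENNReal.toReal_le_of_le_ofReal (by positivity)
    (stripMeasure_arcLen_close_le hg.cont hc hg.le_norm hr)

variable [CompleteSpace V]

theorem integrable_density {α c C N : ℝ} (hα : 1 ≤ α) (hc : 0 < c) (hc1 : c ≤ 1) (hC : 1 ≤ C)
    (hN : 0 ≤ N) {g : UnitAddCircle → V} (hg : Controlled c C g)
    (hgN : sqGagliardo α g ≤ ENNReal.ofReal N) : Integrable (density α g) stripMeasure := by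
  obtain ⟨B, hB, H⟩ := exists_jet_density (V := V) (zero_lt_one.trans_le hα) hc hc1 hC
  have hj := H g (fun _ => 0) (c / 2) (by positivity) le_rfl hg (by simpa using hg)
    continuous_const (fun u => by simp; positivity)
  refine (((integrable_osc hα hg.cont hN hgN).1.add (integrable_const 1)).const_mul B).mono'
    (measurable_density α hg.cont).aestronglyMeasurable ?_
  filter_upwards [ae_mem_W] with p hp
  exact (hj p hp).val

/-- The integrated first-order expansion of the density. The remainder is quadratic because its
part that is only of first order in `η` lives on the set of measure `O(η)` on which an arc and its
complement have almost equal length. -/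
theorem exists_integral_dDensity_le {α c C N : ℝ} (hα : 1 ≤ α) (hc : 0 < c) (hc1 : c ≤ 1)
    (hC : 1 ≤ C) (hN : 0 ≤ N) : ∃ K : ℝ, 0 ≤ K ∧ ∀ (g k : UnitAddCircle → V) (η : ℝ), 0 < η →
      η ≤ c / 2 → Controlled c C g → Controlled c C (fun u => g u + k u) → Continuous k →
      (∀ u, ‖k u‖ ≤ η) → sqGagliardo α g ≤ ENNReal.ofReal N →
      sqGagliardo α k ≤ ENNReal.ofReal (η ^ 2) →
      Integrable (density α (fun u => g u + k u)) stripMeasure →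
      Integrable (dDensity α g k) stripMeasure ∧
      |∫ p, dDensity α g k p ∂stripMeasure| ≤ K * η ∧
      |(∫ p, density α (fun u => g u + k u) p ∂stripMeasure)
        - (∫ p, density α g p ∂stripMeasure) - ∫ p, dDensity α g k p ∂stripMeasure|
        ≤ K * η ^ 2 := by
  obtain ⟨B, hB, H⟩ := exists_jet_density (V := V) (zero_lt_one.trans_le hα) hc hc1 hC
  have hB0 : 0 < B := zero_lt_one.trans_le hB
  refine ⟨B * (2 + N + 2 * (B / c)), by positivity,
    fun g k η hη0 hη hg hg₁ hk hkη hgN hkN hi₁ => ?_⟩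
  have hj := H g k η hη0 hη hg hg₁ hk hkη
  have hi := integrable_density hα hc hc1 hC hN hg hgN
  have hne : ∀ u, g u ≠ 0 := fun u => norm_pos_iff.1 (hc.trans_le (hg.le_norm u))
  obtain ⟨og, og'⟩ := integrable_osc hα hg.cont hN hgN
  obtain ⟨ok, ok'⟩ := integrable_osc hα hk (sq_nonneg η) hkN
  -- the weighted oscillation of the perturbation is quadratic
  have eM : (fun p : UnitAddCircle × ℝ => |p.2| ^ (-α) * (osc k p + η ^ 2 * osc g p))
      = fun p => |p.2| ^ (-α) * osc k p + η ^ 2 * (|p.2| ^ (-α) * osc g p) := by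
    funext p; ring
  have iM : Integrable (fun p : UnitAddCircle × ℝ =>
      |p.2| ^ (-α) * (osc k p + η ^ 2 * osc g p)) stripMeasure := by
    rw [eM]; exact ok.add (og.const_mul _)
  have bM : ∫ p, |p.2| ^ (-α) * (osc k p + η ^ 2 * osc g p) ∂stripMeasure ≤ η ^ 2 * (1 + N) := by
    rw [eM, integral_add ok (og.const_mul _), integral_const_mul]
    nlinarith [sq_nonneg η]
  obtain ⟨iι, bι⟩ := integrable_indicator_close hc hg (r := B * η) (by positivity)
  have i1 : Integrable (fun p : UnitAddCircle × ℝ =>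
      B * (|p.2| ^ (-α) * (osc k p + η ^ 2 * osc g p) / η + η)) stripMeasure :=
    ((iM.div_const η).add (integrable_const η)).const_mul B
  have i2 : Integrable (fun p : UnitAddCircle × ℝ =>
      B * (|p.2| ^ (-α) * (osc k p + η ^ 2 * osc g p)
        + (η ^ 2 + η * if |arcLen g p - coarcLen g p| ≤ B * η then 1 else 0))) stripMeasure :=
    (iM.add ((integrable_const _).add (iι.const_mul η))).const_mul B
  have m2 := (measurable_dDensity α hg.cont hk hne).aestronglyMeasurable (μ := stripMeasure)
  have hr : ∀ᵐ p ∂stripMeasure, ‖density α (fun u => g u + k u) p - density α g p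
      - dDensity α g k p‖ ≤ B * (|p.2| ^ (-α) * (osc k p + η ^ 2 * osc g p)
        + (η ^ 2 + η * if |arcLen g p - coarcLen g p| ≤ B * η then 1 else 0)) := by
    filter_upwards [ae_mem_W] with p hp using (hj p hp).rem
  have hd : ∀ᵐ p ∂stripMeasure, ‖dDensity α g k p‖ ≤
      B * (|p.2| ^ (-α) * (osc k p + η ^ 2 * osc g p) / η + η) := by
    filter_upwards [ae_mem_W] with p hp using (hj p hp).der
  have id : Integrable (dDensity α g k) stripMeasure := i1.mono' m2 hd
  refine ⟨id, ?_, ?_⟩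
  · refine (norm_integral_le_of_norm_le i1 hd).trans ?_
    rw [integral_const_mul, integral_add (iM.div_const η) (integrable_const η), integral_div,
      integral_strip_const, mul_assoc]
    refine mul_le_mul_of_nonneg_left ?_ hB0.le
    have h1 : (∫ p, |p.2| ^ (-α) * (osc k p + η ^ 2 * osc g p) ∂stripMeasure) / η
        ≤ η * (1 + N) := by
      rw [div_le_iff₀ hη0]; linarith
    have h2 : 0 ≤ 2 * (B / c) * η := by positivity
    linarith
  · rw [← integral_sub hi₁ hi, ← integral_sub (by exact hi₁.sub hi) id]
    refine (norm_integral_le_of_norm_le i2 hr).trans ?_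
    rw [integral_const_mul, integral_add iM (by exact (integrable_const _).add (iι.const_mul η)),
      integral_add (integrable_const _) (iι.const_mul η), integral_const_mul,
      integral_strip_const, mul_assoc]
    refine mul_le_mul_of_nonneg_left ?_ hB0.le
    have h1 := mul_le_mul_of_nonneg_left bι hη0.le
    have h2 : η * (2 * (B * η / c)) = 2 * (B / c) * η ^ 2 := by ring
    linarith

end Variation

/-! ### Integrals over punctured strips -/

section Punctured

theorem measurableSet_U (ε : ℝ) : MeasurableSet (U ε) :=
  MeasurableSet.univ.prod (measurableSet_Icc.union measurableSet_Icc)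

theorem U_subset {ε : ℝ} (hε : 0 < ε) : U ε ⊆ univ ×ˢ W := by
  rintro ⟨u, w⟩ ⟨-, h⟩
  refine ⟨mem_univ _, ?_⟩
  rcases h with h | h
  · exact ⟨h.1, by linarith [h.2]⟩
  · exact ⟨by linarith [h.1], h.2⟩

theorem le_abs_of_mem_U {ε : ℝ} {p : UnitAddCircle × ℝ} (hp : p ∈ U ε) :
    ε ≤ |p.2| := by
  rcases hp.2 with h | h
  · exact (le_neg_of_le_neg h.2).trans (neg_le_abs _)
  · exact h.1.trans (le_abs_self _)

theorem mem_U_iff {ε : ℝ} {p : UnitAddCircle × ℝ} (hp : p.2 ∈ W) : p ∈ U ε ↔ ε ≤ |p.2| := by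
  refine ⟨le_abs_of_mem_U, fun h => ⟨mem_univ _, ?_⟩⟩
  rcases le_abs.1 h with h | h
  · exact Or.inr ⟨h, hp.2⟩
  · exact Or.inl ⟨hp.1, by linarith⟩

theorem stripMeasure_eq : stripMeasure = (volume : Measure (UnitAddCircle × ℝ)).restrict
    (univ ×ˢ W) := by
  rw [Measure.volume_eq_prod, ← Measure.prod_restrict, Measure.restrict_univ]

theorem stripMeasure_restrict_U {ε : ℝ} (hε : 0 < ε) :
    stripMeasure.restrict (U ε) = (volume : Measure (UnitAddCircle × ℝ)).restrict (U ε) := by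
  rw [stripMeasure_eq, Measure.restrict_restrict_of_subset (U_subset hε)]

theorem integrableOn_U {f : UnitAddCircle × ℝ → ℝ} (hf : Integrable f stripMeasure) {ε : ℝ}
    (hε : 0 < ε) : IntegrableOn f (U ε) := by
  rw [IntegrableOn, ← stripMeasure_restrict_U hε]
  exact hf.restrict

theorem tendsto_integral_U {f : UnitAddCircle × ℝ → ℝ} (hf : Integrable f stripMeasure) :
    Tendsto (fun ε : ℝ => ∫ p in U ε, f p) (𝓝[>] 0) (𝓝 (∫ p, f p ∂stripMeasure)) := by
  have h : Tendsto (fun ε : ℝ => ∫ p, (U ε).indicator f p ∂stripMeasure) (𝓝[>] 0)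
      (𝓝 (∫ p, f p ∂stripMeasure)) := by
    refine tendsto_integral_filter_of_dominated_convergence (fun p => ‖f p‖)
      (Eventually.of_forall fun ε => hf.aestronglyMeasurable.indicator (measurableSet_U ε))
      (Eventually.of_forall fun ε => Eventually.of_forall fun p => norm_indicator_le_norm_self _ _)
      hf.norm ?_
    filter_upwards [ae_mem_W, ae_snd_ne_zero] with p hp hw
    refine tendsto_const_nhds.congr' ?_
    filter_upwards [Ioo_mem_nhdsGT (abs_pos.2 hw)] with ε hε
    rw [indicator_of_mem ((mem_U_iff hp).2 hε.2.le)]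
  refine h.congr' ?_
  filter_upwards [self_mem_nhdsWithin] with ε hε
  rw [integral_indicator (measurableSet_U ε), stripMeasure_restrict_U hε]

theorem ae_U {P : UnitAddCircle × ℝ → Prop} (h : ∀ᵐ p ∂stripMeasure, P p) {ε : ℝ} (hε : 0 < ε) :
    ∀ᵐ p ∂(volume : Measure (UnitAddCircle × ℝ)).restrict (U ε), P p := by
  rw [← stripMeasure_restrict_U hε]
  exact ae_restrict_of_ae h

/-- The deviation of a function from its averages along arcs has mean zero over the circle. -/
theorem integral_sub_arcMean {T : UnitAddCircle → ℝ} (hT : Continuous T) (w : ℝ) :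
    ∫ u, (T u - arcMean T (u, w)) = 0 := by
  have hc : Continuous fun u => arcMean T (u, w) :=
    (continuous_arcMean hT).comp (continuous_id.prodMk continuous_const)
  have h : ∫ u, arcMean T (u, w) = ∫ u, T u := by
    have hF : Continuous fun q : UnitAddCircle × ℝ =>
        T (q.1 + ((q.2 * w : ℝ) : UnitAddCircle)) :=
      hT.comp (continuous_fst.add ((AddCircle.continuous_mk' 1).comp (by fun_prop)))
    have hi : Integrable (fun q : UnitAddCircle × ℝ => T (q.1 + ((q.2 * w : ℝ) : UnitAddCircle)))
        ((volume : Measure UnitAddCircle).prod ((volume : Measure ℝ).restrict (Ioc 0 1))) := by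
      obtain ⟨S, hS⟩ := isCompact_univ.exists_bound_of_continuousOn hT.continuousOn
      exact Integrable.of_bound hF.aestronglyMeasurable S
        (Eventually.of_forall fun q => hS _ (mem_univ _))
    simp only [arcMean, intervalIntegral.integral_of_le zero_le_one]
    rw [integral_integral_swap hi]
    simp [integral_add_right_eq_self T]
  rw [integral_sub (integrable_circle hT) (integrable_circle hc), h, sub_self]

theorem setIntegral_U_sub_arcMean {T : UnitAddCircle → ℝ} (hT : Continuous T) {a : ℝ → ℝ}
    (ha : Measurable a) {ε M : ℝ} (hM : ∀ w : ℝ, ε ≤ |w| → |a w| ≤ M) :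
    IntegrableOn (fun p => a p.2 * (T p.1 - arcMean T p)) (U ε) ∧
      ∫ p in U ε, a p.2 * (T p.1 - arcMean T p) = 0 := by
  set A : Set ℝ := Icc (-(1 / 2)) (-ε) ∪ Icc ε (1 / 2) with hA
  have e : (volume : Measure (UnitAddCircle × ℝ)).restrict (U ε)
      = (volume : Measure UnitAddCircle).prod ((volume : Measure ℝ).restrict A) := by
    rw [Measure.volume_eq_prod, U, ← Measure.prod_restrict, Measure.restrict_univ]
  obtain ⟨S, hS⟩ := isCompact_univ.exists_bound_of_continuousOn hT.continuousOn
  have hS' : ∀ p, |T p.1 - arcMean T p| ≤ S + S := fun p =>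
    (abs_sub _ _).trans (add_le_add (hS _ (mem_univ _))
      (norm_arcMean_le_of_le (fun u => hS u (mem_univ u)) p))
  have hcont : Continuous fun p : UnitAddCircle × ℝ => T p.1 - arcMean T p :=
    (hT.comp continuous_fst).sub (continuous_arcMean hT)
  have hfin : IsFiniteMeasure ((volume : Measure ℝ).restrict A) :=
    ⟨by
      rw [Measure.restrict_apply_univ]
      exact (isCompact_Icc.union isCompact_Icc).measure_lt_top⟩
  have hi : IntegrableOn (fun p => a p.2 * (T p.1 - arcMean T p)) (U ε) := by
    have hfin' : IsFiniteMeasure ((volume : Measure (UnitAddCircle × ℝ)).restrict (U ε)) := by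
      rw [e]; infer_instance
    refine Integrable.of_bound ((ha.comp measurable_snd).mul
      hcont.measurable).aestronglyMeasurable (M * (S + S)) ?_
    filter_upwards [ae_restrict_mem (measurableSet_U ε)] with p hp
    have h1 := hM p.2 (le_abs_of_mem_U hp)
    rw [Real.norm_eq_abs, abs_mul]
    exact mul_le_mul h1 (hS' p) (abs_nonneg _) ((abs_nonneg _).trans h1)
  refine ⟨hi, ?_⟩
  rw [IntegrableOn, e] at hi
  rw [e, integral_prod_symm _ hi]
  simp only [integral_const_mul, integral_sub_arcMean hT, mul_zero, integral_zero]

end Punctured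

/-! ### The first variation -/

section FirstVariation

variable {V : Type*} [NormedAddCommGroup V] [InnerProductSpace ℝ V]

theorem powDiff_flip (α : ℝ) (g : UnitAddCircle → V) (p : UnitAddCircle × ℝ) :
    powDiff α g (flip p) = powDiff α g p := by
  obtain ⟨u, w⟩ := p
  simp only [powDiff, flip, arcMean_symm, arcLen_symm, coarcLen_symm, abs_neg]

/-- The contribution of the first end point `u` to `dSpeedProd`. -/
noncomputable def dSpeedLeft (g k : UnitAddCircle → V) (p : UnitAddCircle × ℝ) : ℝ :=
  ‖g (p.1 + (p.2 : UnitAddCircle))‖ * dnorm (g p.1) (k p.1)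

theorem dSpeedProd_eq (g k : UnitAddCircle → V) (p : UnitAddCircle × ℝ) :
    dSpeedProd g k p = dSpeedLeft g k (flip p) + dSpeedLeft g k p := by
  simp only [dSpeedProd, dSpeedLeft, flip, AddCircle.coe_neg, add_neg_cancel_right]
  ring

variable [CompleteSpace V]

theorem integrable_powDiff_mul {α c C : ℝ} (hc : 0 < c) {g : UnitAddCircle → V}
    (hg : Controlled c C g) (hi : Integrable (density α g) stripMeasure)
    {ψ : UnitAddCircle × ℝ → ℝ} (hψ : Measurable ψ) {M : ℝ} (hM : ∀ p, |ψ p| ≤ M) :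
    Integrable (fun p => powDiff α g p * ψ p) stripMeasure := by
  have hM0 : 0 ≤ M := (abs_nonneg _).trans (hM (0, 0))
  refine (hi.norm.const_mul (M / c ^ 2)).mono'
    ((measurable_powDiff α hg.cont).mul hψ).aestronglyMeasurable (Eventually.of_forall fun p => ?_)
  have hs : c ^ 2 ≤ speedProd g p := by
    rw [sq]
    exact mul_le_mul (hg.le_norm _) (hg.le_norm _) hc.le (norm_nonneg _)
  rw [norm_mul, density, norm_mul, Real.norm_eq_abs (ψ p),
    Real.norm_of_nonneg ((sq_nonneg c).trans hs)]
  calc ‖powDiff α g p‖ * |ψ p| ≤ ‖powDiff α g p‖ * M := by gcongr; exact hM p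
    _ = M / c ^ 2 * (‖powDiff α g p‖ * c ^ 2) := by field_simp
    _ ≤ M / c ^ 2 * (‖powDiff α g p‖ * speedProd g p) := by gcongr

/-- By symmetry in the two end points, the variation of the product of the speeds may be replaced
by twice the variation of the speed at the first end point. -/
theorem integral_dDensity_symm {α c C : ℝ} (hc : 0 < c) {g k : UnitAddCircle → V}
    (hg : Controlled c C g) (hk : Continuous k) (hi : Integrable (density α g) stripMeasure)
    (hd : Integrable (dDensity α g k) stripMeasure) :
    Integrable (fun p => dPowDiff α g k p * speedProd g p
        + powDiff α g p * (2 * dSpeedLeft g k p)) stripMeasure ∧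
      ∫ p, (dPowDiff α g k p * speedProd g p + powDiff α g p * (2 * dSpeedLeft g k p))
        ∂stripMeasure = ∫ p, dDensity α g k p ∂stripMeasure := by
  have hne : ∀ u, g u ≠ 0 := fun u => norm_pos_iff.1 (hc.trans_le (hg.le_norm u))
  obtain ⟨S, hS⟩ := isCompact_univ.exists_bound_of_continuousOn hk.continuousOn
  have hC : 0 ≤ C := (norm_nonneg _).trans (hg.le 0)
  have hcont : Continuous (dSpeedLeft g k) := (continuous_translate hg.cont).norm.mul
    ((continuous_dnorm hg.cont hk hne).comp continuous_fst)
  have hR : Integrable (fun p => powDiff α g p * dSpeedLeft g k p) stripMeasure := by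
    refine integrable_powDiff_mul hc hg hi hcont.measurable (M := C * S) fun p => ?_
    rw [dSpeedLeft, abs_mul, abs_norm]
    exact mul_le_mul (hg.le _) ((abs_dnorm_le _ _).trans (hS _ (mem_univ _))) (abs_nonneg _) hC
  have hR' : Integrable (fun p => powDiff α g p * dSpeedLeft g k (flip p)) stripMeasure := by
    have := measurePreserving_flip.integrable_comp_of_integrable hR
    simpa only [Function.comp_def, powDiff_flip] using this
  have e : (fun p => dPowDiff α g k p * speedProd g p + powDiff α g p * (2 * dSpeedLeft g k p))
      = fun p => dDensity α g k p + (powDiff α g p * dSpeedLeft g k p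
        - powDiff α g p * dSpeedLeft g k (flip p)) := by
    funext p
    rw [dDensity, dSpeedProd_eq]; ring
  rw [e]
  refine ⟨hd.add (hR.sub hR'), ?_⟩
  rw [integral_add hd (by exact hR.sub hR'), integral_sub hR hR']
  have h := integral_comp_flip fun p => powDiff α g p * dSpeedLeft g k p
  simp only [powDiff_flip] at h
  rw [h, sub_self, add_zero]

end FirstVariation

/-! ### The variational formulas -/

section Formulas

variable {n : ℕ} {α c C : ℝ} {γ h : UnitAddCircle → EuclideanSpace ℝ (Fin n)}

theorem hasDerivAt_intrinsicDist (hγ : IsCOne γ) (hh : IsCOne h) (hc : 0 < c)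
    (hg : Controlled c C (circleDeriv γ)) :
    ∀ᵐ p ∂stripMeasure, HasDerivAt
      (fun τ : ℝ => intrinsicDist (fun v => γ v + τ • h v) p.1 p.2)
      (dMinLen (circleDeriv γ) (circleDeriv h) p) 0 := by
  obtain ⟨S, hS⟩ := isCompact_univ.exists_bound_of_continuousOn hh.cont.continuousOn
  filter_upwards [ae_arcLen_ne_coarcLen hg.cont hc hg.le_norm] with p hp
  simp only [intrinsicDist_eq, hγ.circleDeriv_add_smul hh]
  exact hasDerivAt_min_arcLen hc (lt_max_of_lt_right one_pos) hg.cont hh.cont hg.le_norm hg.le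
    (fun u => (hS u (mem_univ u)).trans (le_max_left S 1)) hp

theorem variationIntegrand_ae_eq (hγ : IsCOne γ) (hh : IsCOne h) (hc : 0 < c)
    (hg : Controlled c C (circleDeriv γ)) :
    ∀ᵐ p ∂stripMeasure, variationIntegrand α γ h p =
      dPowDiff α (circleDeriv γ) (circleDeriv h) p * speedProd (circleDeriv γ) p
        + powDiff α (circleDeriv γ) p * (2 * dSpeedLeft (circleDeriv γ) (circleDeriv h) p) := by
  filter_upwards [hasDerivAt_intrinsicDist hγ hh hc hg, ae_mem_W, ae_snd_ne_zero] with p hd hp hw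
  have hm := hg.arcMean_ne_zero hc hp
  have hY : 0 < coarcLen (circleDeriv γ) p := (half_pos hc).trans_le (hg.half_le_coarcLen hc p hp)
  have hX := arcLen_pos hm hw
  have hn : 0 < ‖circleDeriv γ p.1‖ := hc.trans_le (hg.le_norm _)
  have e : ∀ {x : ℝ}, 0 ≤ x → x ^ (-α) = 1 / x ^ α := fun hx => by
    rw [Real.rpow_neg hx, one_div]
  simp only [variationIntegrand, intrinsicDistDeriv]
  rw [hd.deriv, intrinsicDist_eq, hγ.delta_eq, hh.delta_eq, dPowDiff_eq α hm hw hY, powDiff_eq α,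
    e (norm_nonneg _), e (lt_min hX hY).le, speedProd, dSpeedLeft, dnorm, real_inner_smul_left]
  field_simp
  ring

theorem integral_variationIntegrand (hγ : IsCOne γ) (hh : IsCOne h) (hc : 0 < c)
    (hg : Controlled c C (circleDeriv γ))
    (hi : Integrable (density α (circleDeriv γ)) stripMeasure)
    (hd : Integrable (dDensity α (circleDeriv γ) (circleDeriv h)) stripMeasure) :
    Integrable (variationIntegrand α γ h) stripMeasure ∧
      ∫ p, variationIntegrand α γ h p ∂stripMeasure
        = ∫ p, dDensity α (circleDeriv γ) (circleDeriv h) p ∂stripMeasure := by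
  have h1 := variationIntegrand_ae_eq (α := α) hγ hh hc hg
  obtain ⟨h2, h3⟩ := integral_dDensity_symm hc hg hh.cont hi hd
  exact ⟨(integrable_congr h1).2 h2, (integral_congr_ae h1).trans h3⟩

/-- At a curve parametrized by arc length, the two integrands differ by a function with vanishing
integral over each punctured strip. -/
theorem arcVariationIntegrand_ae_eq (hγ : IsCOne γ) (hh : IsCOne h) (hc : 0 < c)
    (hg : Controlled c C (circleDeriv γ)) (h1 : ∀ u, ‖circleDeriv γ u‖ = 1) :
    ∀ᵐ p ∂stripMeasure, arcVariationIntegrand α γ h p = variationIntegrand α γ h p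
      + α * (|p.2| ^ α)⁻¹ * (inner ℝ (circleDeriv γ p.1) (circleDeriv h p.1)
        - arcMean (fun u => inner ℝ (circleDeriv γ u) (circleDeriv h u)) p) := by
  filter_upwards [hasDerivAt_intrinsicDist hγ hh hc hg, ae_mem_W, ae_snd_ne_zero,
    ae_arcLen_ne_coarcLen hg.cont hc hg.le_norm] with p hd hp hw hne
  have hw0 : 0 < |p.2| := abs_pos.2 hw
  have hA : arcLen (circleDeriv γ) p = |p.2| := by simp [arcLen, arcMean, h1]
  have hB : coarcLen (circleDeriv γ) p = 1 - |p.2| := by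
    simp [coarcLen, hA, h1, measureReal_def]
  have hlt : |p.2| < 1 - |p.2| := by
    rw [hA, hB] at hne
    exact lt_of_le_of_ne (by linarith [abs_mem_of_mem_W hp]) hne
  have hD : dMinLen (circleDeriv γ) (circleDeriv h) p
      = |p.2| * arcMean (fun u => inner ℝ (circleDeriv γ u) (circleDeriv h u)) p := by
    rw [dMinLen, hA, hB, if_neg (not_lt.2 hlt.le), dArcLen]
    simp [dnorm, h1]
  simp only [variationIntegrand, arcVariationIntegrand, intrinsicDistDeriv]
  rw [hd.deriv, intrinsicDist_eq, hA, hB, min_eq_left hlt.le, hD, h1, h1, Real.rpow_add_one hw0.ne',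
    real_inner_smul_left]
  have : |p.2| ^ α ≠ 0 := by positivity
  field_simp
  ring

theorem tendsto_arcVariationIntegrand (hα : 0 ≤ α) (hγ : IsCOne γ) (hh : IsCOne h) (hc : 0 < c)
    (hg : Controlled c C (circleDeriv γ)) (h1 : ∀ u, ‖circleDeriv γ u‖ = 1)
    (hv : Integrable (variationIntegrand α γ h) stripMeasure) :
    (∀ ε > 0, IntegrableOn (arcVariationIntegrand α γ h) (U ε)) ∧
      Tendsto (fun ε : ℝ => ∫ p in U ε, arcVariationIntegrand α γ h p) (𝓝[>] 0)
        (𝓝 (∫ p, variationIntegrand α γ h p ∂stripMeasure)) := by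
  have hT : Continuous fun u => (inner ℝ (circleDeriv γ u) (circleDeriv h u) : ℝ) :=
    hγ.cont.inner hh.cont
  have ha : Measurable fun w : ℝ => α * (|w| ^ α)⁻¹ := by fun_prop
  have key : ∀ ε > 0, IntegrableOn (arcVariationIntegrand α γ h) (U ε) ∧
      ∫ p in U ε, arcVariationIntegrand α γ h p = ∫ p in U ε, variationIntegrand α γ h p := by
    intro ε hε
    have h2 := ae_U (arcVariationIntegrand_ae_eq (α := α) hγ hh hc hg h1) hε
    obtain ⟨h3, h4⟩ := setIntegral_U_sub_arcMean hT ha (ε := ε) (M := α * (ε ^ α)⁻¹) fun w hw => by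
      rw [abs_of_nonneg (by positivity)]
      gcongr
    have hvU := integrableOn_U hv hε
    refine ⟨(integrable_congr h2).2 (hvU.add h3), ?_⟩
    rw [integral_congr_ae h2, integral_add hvU h3, h4, add_zero]
  refine ⟨fun ε hε => (key ε hε).1, (tendsto_integral_U hv).congr' ?_⟩
  filter_upwards [self_mem_nhdsWithin] with ε hε using (key ε hε).2.symm

end Formulas

/-! ### The energy on the fractional Sobolev space -/

namespace FracSobolev

variable {n : ℕ} {s α : ℝ}

theorem isCOne (hs : 1 / 2 < s) (f : FracSobolev n s) : IsCOne f := by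
  obtain ⟨C, -, H⟩ := exists_norm_circleDeriv_le n hs
  exact ⟨(H f).1, (H f).2.1⟩

theorem exists_norm_circleDeriv_le_mul (n : ℕ) (hs : 1 / 2 < s) :
    ∃ S : ℝ, 1 ≤ S ∧ ∀ (f : FracSobolev n s) (u : UnitAddCircle), ‖circleDeriv f u‖ ≤ S * ‖f‖ := by
  obtain ⟨C, -, H⟩ := exists_norm_circleDeriv_le n hs
  refine ⟨max C 1, le_max_right _ _, fun f u => ((H f).2.2.2 u).trans ?_⟩
  gcongr
  exact le_max_left _ _

theorem sqGagliardo_circleDeriv_le (hs : 1 / 2 < s) (hα : 1 + 2 * s = α) (f : FracSobolev n s) :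
    sqGagliardo α (circleDeriv f) ≤ ENNReal.ofReal (‖f‖ ^ 2) := by
  obtain ⟨C, -, H⟩ := exists_norm_circleDeriv_le n hs
  obtain ⟨-, hc, hae, -⟩ := H f
  have h1 : gagliardo s (circleDeriv f) = gagliardo s f.weakDeriv := by
    rw [gagliardo_eq_eLpNorm s hc.stronglyMeasurable,
      gagliardo_eq_eLpNorm s (Lp.stronglyMeasurable _), eLpNorm_congr_ae (diffQuot_congr_ae s hae)]
  have h2 : sqGagliardo α (circleDeriv f) = gagliardo s (circleDeriv f) ^ 2 := by
    rw [gagliardo, ← ENNReal.rpow_natCast, ← ENNReal.rpow_mul, hα]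
    norm_num [sqGagliardo]
  have h3 : gagliardo s f.weakDeriv ≤ ENNReal.ofReal ‖f‖ := by
    rw [← ENNReal.ofReal_toReal f.gagliardo_lt_top.ne, norm_def]
    exact ENNReal.ofReal_le_ofReal (le_add_of_nonneg_left (Real.sqrt_nonneg _))
  rw [h2, h1, ENNReal.ofReal_pow (norm_nonneg _)]
  gcongr

theorem circleDeriv_add (hs : 1 / 2 < s) (f h : FracSobolev n s) :
    circleDeriv (⇑(f + h).toC) = fun u => circleDeriv f u + circleDeriv h u := by
  have := (f.isCOne hs).circleDeriv_add_smul (h.isCOne hs) 1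
  simp only [one_smul] at this
  exact this

theorem circleDeriv_smul (hs : 1 / 2 < s) (t : ℝ) (h : FracSobolev n s) :
    circleDeriv (⇑(t • h).toC) = fun u => t • circleDeriv h u := by
  have e := circleDeriv_add hs (0 : FracSobolev n s) 0
  have h0 : circleDeriv (⇑(0 : FracSobolev n s).toC) = fun _ => 0 := by
    funext u
    have := congrFun e u
    rw [add_zero] at this
    simpa using this
  have := ((0 : FracSobolev n s).isCOne hs).circleDeriv_add_smul (h.isCOne hs) t
  rw [h0] at this
  simp only [zero_add] at this
  rw [← this]
  congr 1
  funext v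
  exact (zero_add (t • h.toC v)).symm

theorem mem_ir_iff (hs : 1 / 2 < s) (γ : FracSobolev n s) :
    γ ∈ ir n s ↔ ∀ u, ∀ w ∈ W, arcMean (circleDeriv γ) (u, w) ≠ 0 :=
  (γ.isCOne hs).injective_and_regular_iff

/-- Near an injective regular curve, speed and chords are controlled uniformly. -/
theorem exists_ball_controlled (hs : 1 / 2 < s) {S : ℝ} (hS : 1 ≤ S)
    (H : ∀ (f : FracSobolev n s) (u : UnitAddCircle), ‖circleDeriv f u‖ ≤ S * ‖f‖)
    {γ₀ : FracSobolev n s} (hγ₀ : γ₀ ∈ ir n s) :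
    ∃ c C r : ℝ, 0 < c ∧ c ≤ 1 ∧ 1 ≤ C ∧ 0 < r ∧ S * (2 * r) ≤ c / 2 ∧
      ∀ γ ∈ Metric.ball γ₀ r, Controlled c C (circleDeriv γ) := by
  obtain ⟨c, C, hc, hc1, hC, hg⟩ := exists_controlled (γ₀.isCOne hs).cont ((mem_ir_iff hs γ₀).1 hγ₀)
  have hS0 : 0 < S := by linarith
  refine ⟨c - c / 2, C + c / 2, c / (8 * S), by linarith, by linarith, by linarith, by positivity,
    ?_, fun γ hγ => ?_⟩
  · apply le_of_eq; field_simp; ring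
  · have h := hg.add (k := circleDeriv (γ - γ₀ : FracSobolev n s)) (δ := c / 2)
      ((γ - γ₀).isCOne hs).cont fun u => by
        rw [Metric.mem_ball, dist_eq_norm] at hγ
        calc _ ≤ S * ‖γ - γ₀‖ := H _ u
          _ ≤ S * (c / (8 * S)) := by gcongr
          _ = c / 8 := by field_simp
          _ ≤ c / 2 := by linarith
    rwa [← circleDeriv_add hs, add_sub_cancel] at h

/-- The first-order change of the energy. -/
noncomputable def firstVariation (α : ℝ) (γ h : FracSobolev n s) : ℝ :=
  ∫ p, dDensity α (circleDeriv γ) (circleDeriv h) p ∂stripMeasure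

theorem isLinearMap_firstVariation (hs : 1 / 2 < s) {γ : FracSobolev n s}
    (h0 : ∀ u, circleDeriv γ u ≠ 0)
    (hd : ∀ h : FracSobolev n s, Integrable (dDensity α (circleDeriv γ) (circleDeriv h))
      stripMeasure) : IsLinearMap ℝ (firstVariation α γ) where
  map_add h k := by
    unfold firstVariation
    rw [← integral_add (hd h) (hd k), circleDeriv_add hs]
    exact integral_congr_ae (Eventually.of_forall fun p =>
      dDensity_add α (γ.isCOne hs).cont (h.isCOne hs).cont (k.isCOne hs).cont h0 p)
  map_smul t h := by
    unfold firstVariation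
    rw [circleDeriv_smul hs, smul_eq_mul, ← integral_const_mul]
    exact integral_congr_ae (Eventually.of_forall fun p => dDensity_smul α t _ _ p)

/-- The local facts about the energy near an injective regular curve: the nearby curves are
injective and regular and have finite energy, and the energy has a first-order expansion with a
uniformly quadratic remainder. -/
theorem exists_energy_expansion (hs : 1 / 2 < s) (hα : 1 + 2 * s = α) {γ₀ : FracSobolev n s}
    (hγ₀ : γ₀ ∈ ir n s) :
    ∃ r K : ℝ, 0 < r ∧ 0 ≤ K ∧
      (∀ γ ∈ Metric.ball γ₀ r, γ ∈ ir n s ∧ energy α γ < ⊤ ∧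
        (∃ c C : ℝ, 0 < c ∧ Controlled c C (circleDeriv γ)) ∧
        Integrable (density α (circleDeriv γ)) stripMeasure ∧
        ∀ h : FracSobolev n s, Integrable (dDensity α (circleDeriv γ) (circleDeriv h))
          stripMeasure) ∧
      ∀ γ ∈ Metric.ball γ₀ r, ∀ h, γ + h ∈ Metric.ball γ₀ r →
        |firstVariation α γ h| ≤ K * ‖h‖ ∧
        |(energy α (γ + h).toC).toReal - (energy α γ).toReal - firstVariation α γ h|
          ≤ K * ‖h‖ ^ 2 := by
  obtain ⟨S, hS, H⟩ := exists_norm_circleDeriv_le_mul n hs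
  obtain ⟨c, C, r, hc, hc1, hC, hr, hSr, hctrl⟩ := exists_ball_controlled hs hS H hγ₀
  have hα1 : 1 ≤ α := by linarith
  set N := (‖γ₀‖ + r) ^ 2 with hN
  obtain ⟨K, hK0, hK⟩ := exists_integral_dDensity_le (V := EuclideanSpace ℝ (Fin n)) (N := N) hα1 hc
    hc1 hC (by positivity)
  have hgN : ∀ γ ∈ Metric.ball γ₀ r, sqGagliardo α (circleDeriv γ) ≤ ENNReal.ofReal N :=
    fun γ hγ => (γ.sqGagliardo_circleDeriv_le hs hα).trans (ENNReal.ofReal_le_ofReal (by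
      have := norm_lt_of_mem_ball hγ
      rw [hN]
      gcongr))
  have hi : ∀ γ ∈ Metric.ball γ₀ r, Integrable (density α (circleDeriv γ)) stripMeasure :=
    fun γ hγ => integrable_density hα1 hc hc1 hC (by positivity) (hctrl γ hγ) (hgN γ hγ)
  have hE := fun γ hγ => energy_eq_integral (by linarith : 0 ≤ α) (γ.isCOne hs) hc (hctrl γ hγ)
    (hi γ hγ)
  -- the expansion in nonzero directions
  have hexp : ∀ γ ∈ Metric.ball γ₀ r, ∀ h, γ + h ∈ Metric.ball γ₀ r → h ≠ 0 →
      Integrable (dDensity α (circleDeriv γ) (circleDeriv h)) stripMeasure ∧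
      |firstVariation α γ h| ≤ K * (S * ‖h‖) ∧
      |(energy α (γ + h).toC).toReal - (energy α γ).toReal - firstVariation α γ h|
        ≤ K * (S * ‖h‖) ^ 2 := by
    intro γ hγ h hγh h0
    have hn : 0 < ‖h‖ := norm_pos_iff.2 h0
    have h2r : ‖h‖ ≤ 2 * r := by
      have h1 := dist_triangle_right (γ + h) γ γ₀
      rw [dist_eq_norm, add_sub_cancel_left] at h1
      rw [Metric.mem_ball] at hγ hγh
      linarith
    have hη : S * ‖h‖ ≤ c / 2 := by
      refine le_trans ?_ hSr
      gcongr
    have e := circleDeriv_add hs γ h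
    have h1 := hctrl _ hγh
    have h2 := hi _ hγh
    rw [e] at h1 h2
    have hk : sqGagliardo α (circleDeriv h) ≤ ENNReal.ofReal ((S * ‖h‖) ^ 2) :=
      (h.sqGagliardo_circleDeriv_le hs hα).trans (ENNReal.ofReal_le_ofReal (by
        gcongr; exact le_mul_of_one_le_left hn.le hS))
    obtain ⟨a1, a2, a3⟩ := hK (circleDeriv γ) (circleDeriv h) (S * ‖h‖) (by positivity) hη
      (hctrl γ hγ) h1 (h.isCOne hs).cont (H h) (hgN γ hγ) hk h2
    refine ⟨a1, a2, ?_⟩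
    rw [(hE _ hγh).2, (hE _ hγ).2, e]
    exact a3
  refine ⟨r, K * S ^ 2, hr, by positivity, fun γ hγ => ⟨?_, (hE γ hγ).1, ⟨c, C, hc, hctrl γ hγ⟩,
    hi γ hγ, fun h => ?_⟩, fun γ hγ h hγh => ?_⟩
  · exact (mem_ir_iff hs γ).2 fun u w hw => (hctrl γ hγ).arcMean_ne_zero hc (p := (u, w)) hw
  · by_cases h0 : h = 0
    · have e := circleDeriv_smul hs 0 h
      rw [zero_smul] at e
      have e2 : dDensity α (circleDeriv γ) (circleDeriv h) = fun _ => 0 := by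
        funext p
        rw [h0, e, dDensity_smul, zero_mul]
      rw [e2]
      exact integrable_zero _ _ _
    · have hn : 0 < ‖h‖ := norm_pos_iff.2 h0
      have hρ : 0 < r - dist γ γ₀ := sub_pos.2 hγ
      set t := (r - dist γ γ₀) / (2 * ‖h‖) with ht
      have ht0 : 0 < t := by positivity
      have hth : ‖t • h‖ = (r - dist γ γ₀) / 2 := by
        rw [norm_smul, Real.norm_of_nonneg ht0.le, ht]; field_simp
      have hm : γ + t • h ∈ Metric.ball γ₀ r := by
        have h1 : dist (γ + t • h) γ = (r - dist γ γ₀) / 2 := by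
          rw [dist_eq_norm, add_sub_cancel_left, hth]
        rw [Metric.mem_ball]
        linarith [dist_triangle (γ + t • h) γ γ₀]
      have h1 := (hexp γ hγ _ hm (smul_ne_zero ht0.ne' h0)).1
      rw [circleDeriv_smul hs] at h1
      have e : dDensity α (circleDeriv γ) (fun u => t • circleDeriv h u)
          = fun p => t * dDensity α (circleDeriv γ) (circleDeriv h) p := by
        funext p; exact dDensity_smul α t _ _ p
      rw [e] at h1
      exact (integrable_const_mul_iff (isUnit_iff_ne_zero.2 ht0.ne') _).1 h1
  · by_cases h0 : h = 0
    · have e := circleDeriv_smul hs 0 h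
      rw [zero_smul] at e
      have e2 : firstVariation α γ h = 0 := by
        rw [firstVariation, h0, e]
        simp only [dDensity_smul, zero_mul, integral_zero]
      rw [e2, h0, add_zero]
      simp
    · obtain ⟨-, a2, a3⟩ := hexp γ hγ h hγh h0
      refine ⟨a2.trans ?_, a3.trans_eq (by ring)⟩
      have : S ≤ S ^ 2 := by nlinarith
      calc K * (S * ‖h‖) ≤ K * (S ^ 2 * ‖h‖) := by gcongr
        _ = _ := by ring

/-- The energy is continuously differentiable on the injective regular curves. -/
theorem hasFDerivAt_energy (hs : 1 / 2 < s) (hα : 1 + 2 * s = α) {γ₀ : FracSobolev n s}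
    (hγ₀ : γ₀ ∈ ir n s) :
    HasFDerivAt (fun η : FracSobolev n s => (energy α η).toReal)
        (fderiv ℝ (fun η : FracSobolev n s => (energy α η).toReal) γ₀) γ₀ ∧
      ContinuousAt (fderiv ℝ (fun η : FracSobolev n s => (energy α η).toReal)) γ₀ ∧
      ∀ h, fderiv ℝ (fun η : FracSobolev n s => (energy α η).toReal) γ₀ h
        = firstVariation α γ₀ h := by
  obtain ⟨r, K, hr, hK, h1, h2⟩ := exists_energy_expansion hs hα hγ₀
  obtain ⟨a1, a2⟩ := hasFDerivAt_of_quadratic_remainder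
    (E := fun η : FracSobolev n s => (energy α η).toReal) (L := firstVariation α) hr hK
    (fun γ hγ => isLinearMap_firstVariation hs (h1 γ hγ).1.2 (h1 γ hγ).2.2.2.2)
    (fun γ hγ h hh => (h2 γ hγ h hh).1) fun γ hγ h hh => (h2 γ hγ h hh).2
  obtain ⟨F, hF1, hF2⟩ := a1 γ₀ (Metric.mem_ball_self hr)
  refine ⟨hF2.differentiableAt.hasFDerivAt, a2, fun h => ?_⟩
  rw [hF2.fderiv, hF1]

end FracSobolev

end OHara

theorem theorem1p1 (n : ℕ) (α : ℝ) (hα : α ∈ Set.Ioo (2 : ℝ) 3) :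
    IsOpen (OHara.FracSobolev.ir n ((α - 1) / 2)) ∧
    (∀ γ ∈ OHara.FracSobolev.ir n ((α - 1) / 2), OHara.energy α γ < ⊤) ∧
    ∃ E' : OHara.FracSobolev n ((α - 1) / 2) → (OHara.FracSobolev n ((α - 1) / 2) →L[ℝ] ℝ),
      (∀ γ ∈ OHara.FracSobolev.ir n ((α - 1) / 2),
        HasFDerivAt (fun η : OHara.FracSobolev n ((α - 1) / 2) => (OHara.energy α η).toReal)
          (E' γ) γ) ∧
      ContinuousOn E' (OHara.FracSobolev.ir n ((α - 1) / 2)) ∧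
      (∀ γ ∈ OHara.FracSobolev.ir n ((α - 1) / 2), ∀ h : OHara.FracSobolev n ((α - 1) / 2),
        (∀ᵐ p : UnitAddCircle × ℝ ∂OHara.stripMeasure,
          DifferentiableAt ℝ
            (fun τ : ℝ => OHara.intrinsicDist (fun v => γ v + τ • h v) p.1 p.2) 0) ∧
        (∀ ε > 0, IntegrableOn (OHara.variationIntegrand α γ h) (OHara.U ε)) ∧
        Tendsto (fun ε : ℝ => ∫ p in OHara.U ε, OHara.variationIntegrand α γ h p)
          (𝓝[>] 0) (𝓝 (E' γ h))) ∧
      (∀ γ ∈ OHara.FracSobolev.ir n ((α - 1) / 2), (∀ u, ‖OHara.circleDeriv γ u‖ = 1) →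
        ∀ h : OHara.FracSobolev n ((α - 1) / 2),
        (∀ ε > 0, IntegrableOn (OHara.arcVariationIntegrand α γ h) (OHara.U ε)) ∧
        Tendsto (fun ε : ℝ => ∫ p in OHara.U ε, OHara.arcVariationIntegrand α γ h p)
          (𝓝[>] 0) (𝓝 (E' γ h))) := by
  have hs : 1 / 2 < (α - 1) / 2 := by linarith [hα.1]
  have hsα : 1 + 2 * ((α - 1) / 2) = α := by ring
  have hα0 : 0 ≤ α := by linarith [hα.1]
  refine ⟨Metric.isOpen_iff.2 fun γ hγ => ?_, fun γ hγ => ?_,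
    fderiv ℝ (fun η : OHara.FracSobolev n ((α - 1) / 2) => (OHara.energy α η).toReal),
    fun γ hγ => (OHara.FracSobolev.hasFDerivAt_energy hs hsα hγ).1,
    fun γ hγ => (OHara.FracSobolev.hasFDerivAt_energy hs hsα hγ).2.1.continuousWithinAt,
    fun γ hγ h => ?_, fun γ hγ h1 h => ?_⟩
  · obtain ⟨r, K, hr, -, H, -⟩ := OHara.FracSobolev.exists_energy_expansion hs hsα hγ
    exact ⟨r, hr, fun γ' hγ' => (H γ' hγ').1⟩
  all_goals
    obtain ⟨r, K, hr, -, H, -⟩ := OHara.FracSobolev.exists_energy_expansion hs hsα hγ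
    obtain ⟨-, hfin, ⟨c, C, hc, hctrl⟩, hi, hd⟩ := H γ (Metric.mem_ball_self hr)
  · exact hfin
  · obtain ⟨hv, hv'⟩ := OHara.integral_variationIntegrand (γ.isCOne hs) (h.isCOne hs) hc hctrl hi
      (hd h)
    refine ⟨?_, fun ε hε => OHara.integrableOn_U hv hε, ?_⟩
    · filter_upwards [OHara.hasDerivAt_intrinsicDist (γ.isCOne hs) (h.isCOne hs) hc hctrl] with p hp
      exact hp.differentiableAt
    · rw [(OHara.FracSobolev.hasFDerivAt_energy hs hsα hγ).2.2 h, OHara.FracSobolev.firstVariation,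
        ← hv']
      exact OHara.tendsto_integral_U hv
  · obtain ⟨hv, hv'⟩ := OHara.integral_variationIntegrand (γ.isCOne hs) (h.isCOne hs) hc hctrl hi
      (hd h)
    rw [(OHara.FracSobolev.hasFDerivAt_energy hs hsα hγ).2.2 h, OHara.FracSobolev.firstVariation,
      ← hv']
    exact OHara.tendsto_arcVariationIntegrand hα0 (γ.isCOne hs) (h.isCOne hs) hc hctrl h1 hv
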